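/- Let $(Y,\omega)$ be a smooth symplectic manifold of dimension $2m$, and let $X\hookrightarrow Y$ be a compact Lagrangian submanifold, with normal bundle $N=TY|_X/TX$. Consider the following supermanifolds, forms and functions. * $\mathcal Y=\Pi\Omega^1Y$ is the supermanifold $(Y,\Lambda^*TY)$, with local coordinates $x^a$ (even) and $\psi_a=\Pi\,\partial/\partial x^a$ (odd), and $\widehat{\mathcal Y}=\mathcal Y\times\mathbb R^{0|1}$, with additional odd coordinate $\varepsilon$. It carries the odd contact form $\widehat\theta=d\varepsilon+\sum_a dx^a\,\psi_a$ and the even function $\widehat\omega=\sum_{a,b}\omega^{ab}\psi_a\psi_b$, where $(\omega^{ab})$ is the inverse matrix of $(\omega_{ab})$. * $\mathcal X=\Pi N^*=(X,\Lambda^*N)$ is embedded in $\widehat{\mathcal Y}$ by the restriction map $\Lambda^*TY\to\Lambda^*TY|_X\to\Lambda^*N$, $\varepsilon\mapsto 0$. * $\mathcal N=T\widehat{\mathcal Y}|_{\mathcal X}/T\mathcal X$ is the normal bundle of $\mathcal X$ in $\widehat{\mathcal Y}$. Its global sections of parity $p$ correspond to the infinitesimal deformations of $\mathcal X$ in $\widehat{\mathcal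 Y}$, that is, the families over $\mathbb R[t]/t^2$ with $t$ of parity $p$. An infinitesimal deformation is Legendrian if $\widehat\theta$ restricts to zero on it (as a form relative to the base of the family, modulo $t^2$), and $\omega$-isotropic if $\widehat\omega$ restricts to zero on it (modulo $t^2$). The Zariski tangent space at $\mathcal X$ to the moduli space $\mathcal M$ of deformations of $\mathcal X$ in $\widehat{\mathcal Y}$ within the class of Legendrian, $\omega$-isotropic sub-supermanifolds is the set $T_{\mathcal X}\mathcal M=T_0\sqcup T_1$, where $T_p\subset H^0(\mathcal X,\mathcal N)_p$ consists of the normal sections of the Legendrian, $\omega$-isotropic infinitesimal deformations of parity $p$. Then $\widehat\theta$ and $\widehat\omega$ can be written near $\mathcal X$ in terms of finitely many globally defined functions $x_a$ and vector fields $e_a$ on $Y$ with $\mathrm{id}_{TY}=\sum_a dx_a\otimes e_a$ near $X$ (replacing $x^a$, $\partial/\partial x^a$ in the formulas above), and $[v]\mapsto\omega(v,\cdot)|_{TX}$ defines an isomorphism $N\cong\Omega^1X$, hence an isomorphism of algebras $\Gamma(\mathcal X,\mathcal O_{\mathcal X})=\Gamma(X,\Lambda^*N)\cong\Gamma(X,\Omega^*X)$.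 For each parity $p\in\mathbb Z/2$ the set $T_p$ is a real vector subspace of $H^0(\mathcal X,\mathcal N)_p$, and contraction with the contact form, $[D]\mapsto D\lrcorner\,\widehat\theta\in\Gamma(\mathcal X,\mathcal O_{\mathcal X})$, followed by this isomorphism, is a well-defined linear isomorphism of $T_p$ onto the space of global closed differential forms on $X$ (of mixed degree) all of whose components have degree congruent to $p+1$ modulo $2$. In other words, the Zariski tangent space to $\mathcal M$ at $\mathcal X$ is $\Pi H^0(X,\Omega^*X_{\mathrm{closed}})$, where $\Omega^*X_{\mathrm{closed}}$ is the sheaf of closed differential forms on $X$. -/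

import Mathlib

open scoped Manifold ContDiff

noncomputable section

namespace OddContact

/-!
Smooth supermanifolds are described by their superalgebras of global functions, and morphisms,
vector fields and differential forms by the corresponding algebraic data: a morphism is an algebra
homomorphism, a vector field is a superderivation, and a differential 1-form is evaluated on
superderivations.
-/

/-! ### Smooth functions and vector fields -/

/-- The algebra of smooth real functions on an `n`-dimensional manifold. -/
abbrev Fn (n : ℕ) (M : Type*) [TopologicalSpace M] [ChartedSpace (EuclideanSpace ℝ (Fin n)) M] :
    Type _ :=
  C^∞⟮𝓡 n, M; ℝ⟯

/-- Vector fields, as derivations of the algebra of functions. -/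
abbrev Vec (R : Type*) [CommRing R] [Algebra ℝ R] : Type _ := Derivation ℝ R R

/-- Differential 1-forms: function-linear functionals on vector fields. -/
abbrev OneForm (R : Type*) [CommRing R] [Algebra ℝ R] : Type _ := Module.Dual R (Vec R)

/-- Restriction of smooth functions along a smooth map. -/
def pullback {k n : ℕ} {X Y : Type*}
    [TopologicalSpace X] [ChartedSpace (EuclideanSpace ℝ (Fin k)) X]
    [TopologicalSpace Y] [ChartedSpace (EuclideanSpace ℝ (Fin n)) Y]
    (i : C^∞⟮𝓡 k, X; 𝓡 n, Y⟯) : Fn n Y →ₐ[ℝ] Fn k X where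
  toFun f := f.comp i
  map_one' := rfl
  map_mul' _ _ := rfl
  map_zero' := rfl
  map_add' _ _ := rfl
  commutes' _ := rfl

/-! ### The normal bundle of a submanifold

Here `φ : R →ₐ[ℝ] S` is the restriction of functions from the manifold `Y` to the
submanifold `X`. -/

section Normal

variable {R S : Type*} [CommRing R] [Algebra ℝ R] [CommRing S] [Algebra ℝ S]

/-- The algebra `S`, as a module over `R` by restriction. -/
def Restr (_φ : R →ₐ[ℝ] S) : Type _ := S

instance (φ : R →ₐ[ℝ] S) : AddCommGroup (Restr φ) := inferInstanceAs (AddCommGroup S)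

instance (φ : R →ₐ[ℝ] S) : Module S (Restr φ) := inferInstanceAs (Module S S)

instance (φ : R →ₐ[ℝ] S) : Module ℝ (Restr φ) := inferInstanceAs (Module ℝ S)

instance (φ : R →ₐ[ℝ] S) : Module R (Restr φ) := Module.compHom S (φ : R →+* S)

instance (φ : R →ₐ[ℝ] S) : SMulCommClass ℝ S (Restr φ) :=
  inferInstanceAs (SMulCommClass ℝ S S)

instance (φ : R →ₐ[ℝ] S) : SMulCommClass S ℝ (Restr φ) :=
  inferInstanceAs (SMulCommClass S ℝ S)

instance (φ : R →ₐ[ℝ] S) : SMulCommClass S R (Restr φ) where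
  smul_comm s r x := mul_left_comm s (φ r) (show S from x)

instance (φ : R →ₐ[ℝ] S) : SMulCommClass ℝ R (Restr φ) where
  smul_comm c r x := (mul_smul_comm c (φ r) (show S from x)).symm

instance (φ : R →ₐ[ℝ] S) : IsScalarTower ℝ S (Restr φ) :=
  inferInstanceAs (IsScalarTower ℝ S S)

/-- Sections of `TY|_X`: derivations of `R` with values in `S` along the restriction map. -/
abbrev AlongField (φ : R →ₐ[ℝ] S) : Type _ := Derivation ℝ R (Restr φ)

/-- The inclusion `TX → TY|_X` on sections: `V ↦ (f ↦ V (f|_X))`. -/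
def pushField (φ : R →ₐ[ℝ] S) : Vec S →ₗ[S] AlongField φ where
  toFun V := Derivation.mk' (M := Restr φ) ((V : S →ₗ[ℝ] S) ∘ₗ φ.toLinearMap) (by
    intro f g
    change V (φ (f * g)) = φ f * V (φ g) + φ g * V (φ f)
    simp)
  map_add' _ _ := rfl
  map_smul' _ _ := rfl

/-- Sections of the normal bundle `N = TY|_X / TX`. -/
abbrev Normal (φ : R →ₐ[ℝ] S) : Type _ := AlongField φ ⧸ LinearMap.range (pushField φ)

/-- A vector field on `Y`, restricted to `X`: `D ↦ (f ↦ (D f)|_X)`. -/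
def restrictField (φ : R →ₐ[ℝ] S) (D : Vec R) : AlongField φ :=
  Derivation.mk' (M := Restr φ) (φ.toLinearMap ∘ₗ (D : R →ₗ[ℝ] R)) (by
    intro f g
    change φ (D (f * g)) = φ f * φ (D g) + φ g * φ (D f)
    simp)

/-- The normal component along `X` of a vector field on `Y`. -/
def normalPart (φ : R →ₐ[ℝ] S) : Vec R →ₛₗ[(φ : R →+* S)] Normal φ where
  toFun D := Submodule.Quotient.mk (restrictField φ D)
  map_add' D D' := by
    rw [← Submodule.Quotient.mk_add]
    congr 1
    ext f
    exact map_add φ (D f) (D' f)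
  map_smul' r D := by
    rw [← Submodule.Quotient.mk_smul]
    congr 1
    ext f
    exact map_mul φ r (D f)

/-- The vector field `D` on `Y` extends the vector field `V` on `X`. -/
def Extends (φ : R →ₐ[ℝ] S) (D : Vec R) (V : Vec S) : Prop := ∀ f, φ (D f) = V (φ f)

end Normal

/-! ### Symplectic forms and Lagrangian submanifolds -/

/-- Symplectic forms on the manifold with function algebra `R`: closed nondegenerate 2-forms. -/
structure SymplecticForm (R : Type*) [CommRing R] [Algebra ℝ R] where
  form : Vec R →ₗ[R] OneForm R
  alt : ∀ D, form D D = 0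
  nondegenerate : Function.Bijective form
  closed : ∀ D₀ D₁ D₂ : Vec R,
    D₀ (form D₁ D₂) - D₁ (form D₀ D₂) + D₂ (form D₀ D₁)
      - form ⁅D₀, D₁⁆ D₂ + form ⁅D₀, D₂⁆ D₁ - form ⁅D₁, D₂⁆ D₀ = 0

section Symplectic

variable {R S : Type*} [CommRing R] [Algebra ℝ R] [CommRing S] [Algebra ℝ S]

/-- The vector field `H` with `ω(H, ·) = df`; in coordinates `H = ∑ ω^{ba} ∂_b f ∂_a`. -/
def SymplecticForm.ham (w : SymplecticForm R) (f : R) : Vec R :=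
  (LinearEquiv.ofBijective w.form w.nondegenerate).symm
    { toFun := fun D => D f
      map_add' := fun _ _ => rfl
      map_smul' := fun _ _ => rfl }

/-- The restriction of `ω` to `X` vanishes. For a submanifold of half the dimension this says
that it is Lagrangian. -/
def IsLagrangian (w : SymplecticForm R) (φ : R →ₐ[ℝ] S) : Prop :=
  ∀ (D D' : Vec R) (V V' : Vec S), Extends φ D V → Extends φ D' V' → φ (w.form D D') = 0

/-- `Φ` is the identification `N ≅ Ω¹X`, `[ν] ↦ ω(ν, ·)|_{TX}`. -/
def IsCanonical (w : SymplecticForm R) (φ : R →ₐ[ℝ] S) (Φ : Normal φ ≃ₗ[S] OneForm S) : Prop :=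
  ∀ (D D' : Vec R) (V : Vec S), Extends φ D' V → Φ (normalPart φ D) V = φ (w.form D D')

end Symplectic

/-! ### Superderivations and infinitesimal families -/

section Super

variable {R M S N : Type*} [CommRing R] [Algebra ℝ R] [AddCommGroup M] [Module R M] [Module ℝ M]
  [IsScalarTower ℝ R M] [CommRing S] [Algebra ℝ S] [AddCommGroup N] [Module S N] [Module ℝ N]
  [IsScalarTower ℝ S N]

/-- The homomorphism of exterior algebras induced by a semilinear map. -/
def extMap {φ : R →+* S} (l : M →ₛₗ[φ] N) : ExteriorAlgebra R M →+* ExteriorAlgebra S N :=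
  letI : Algebra R (ExteriorAlgebra S N) :=
    ((algebraMap S (ExteriorAlgebra S N)).comp φ).toAlgebra'
      fun c x => Algebra.commutes (φ c) x
  (ExteriorAlgebra.lift R
    ⟨{  toFun := fun v => ExteriorAlgebra.ι S (l v)
        map_add' := fun v w => by rw [map_add, map_add]
        map_smul' := fun c v => by
          rw [map_smulₛₗ, map_smul, Algebra.smul_def]
          exact (Algebra.smul_def c _).symm },
      fun v => ExteriorAlgebra.ι_sq_zero (l v)⟩).toRingHom

/-- The part of parity `i` of an exterior algebra. -/
abbrev parityPart (S N : Type*) [CommRing S] [AddCommGroup N] [Module S N] (i : ZMod 2) :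
    Submodule S (ExteriorAlgebra S N) :=
  CliffordAlgebra.evenOdd (0 : QuadraticForm S N) i

/-- Multiplication by `(-1)^{p i}` on elements of parity `i`. -/
def sgn (S N : Type*) [CommRing S] [AddCommGroup N] [Module S N] (p : ZMod 2) :
    ExteriorAlgebra S N →ₐ[S] ExteriorAlgebra S N :=
  if p = 0 then AlgHom.id S _ else CliffordAlgebra.involute

/-- Superderivations of parity `p` along a homomorphism `j`: the vector fields of parity `p` along
the corresponding morphism of supermanifolds. -/
def superDer (j : ExteriorAlgebra R M →+* ExteriorAlgebra S N) (p : ZMod 2) :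
    Submodule ℝ (ExteriorAlgebra R M →ₗ[ℝ] ExteriorAlgebra S N) where
  carrier := {D | (∀ i, ∀ a ∈ parityPart R M i, D a ∈ parityPart S N (i + p)) ∧
    ∀ a b, D (a * b) = D a * j b + sgn S N p (j a) * D b}
  add_mem' := by
    rintro D E ⟨hD, hD'⟩ ⟨hE, hE'⟩
    refine ⟨fun i a ha => add_mem (hD i a ha) (hE i a ha), fun a b => ?_⟩
    simp only [LinearMap.add_apply, hD', hE', add_mul, mul_add]
    abel
  zero_mem' := by
    refine ⟨fun i a _ => zero_mem _, fun a b => ?_⟩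
    simp
  smul_mem' := by
    rintro c D ⟨hD, hD'⟩
    refine ⟨fun i a ha => ?_, fun a b => ?_⟩
    · have h := (parityPart S N (i + p)).smul_mem (algebraMap ℝ S c) (hD i a ha)
      rwa [algebraMap_smul] at h
    · simp only [LinearMap.smul_apply, hD', smul_add, smul_mul_assoc, mul_smul_comm]

/-- The space of superderivations of parity `p` along `j`. -/
def SuperDer (j : ExteriorAlgebra R M →+* ExteriorAlgebra S N) (p : ZMod 2) : Type _ :=
  ↥(superDer j p)

instance (j : ExteriorAlgebra R M →+* ExteriorAlgebra S N) (p : ZMod 2) :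
    AddCommGroup (SuperDer j p) := inferInstanceAs (AddCommGroup (superDer j p))

instance (j : ExteriorAlgebra R M →+* ExteriorAlgebra S N) (p : ZMod 2) :
    Module ℝ (SuperDer j p) := inferInstanceAs (Module ℝ (superDer j p))

/-- Superderivations along the identity: vector fields of parity `p`. -/
abbrev SuperVec (S N : Type*) [CommRing S] [Algebra ℝ S] [AddCommGroup N] [Module S N]
    [Module ℝ N] [IsScalarTower ℝ S N] (p : ZMod 2) : Type _ :=
  SuperDer (RingHom.id (ExteriorAlgebra S N)) p

/-- The vector fields along `j` that are tangent to the source. -/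
def tangentPart (j : ExteriorAlgebra R M →+* ExteriorAlgebra S N) (p : ZMod 2) :
    Submodule ℝ (SuperDer j p) where
  carrier := {D | ∃ V : SuperVec S N p, ∀ a, D.1 a = V.1 (j a)}
  add_mem' := by
    rintro D E ⟨V, hV⟩ ⟨W, hW⟩
    exact ⟨V + W, fun a => congrArg₂ (· + ·) (hV a) (hW a)⟩
  zero_mem' := ⟨0, fun _ => rfl⟩
  smul_mem' := by
    rintro c D ⟨V, hV⟩
    exact ⟨c • V, fun a => congrArg (c • ·) (hV a)⟩

/-- The part of parity `p` of the global sections of the normal bundle of the sub-supermanifold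
with restriction homomorphism `j`: vector fields along `j` modulo tangent ones. They correspond to
the infinitesimal deformations of the sub-supermanifold over `ℝ[t] / t²` with `t` of parity `p`:
`D` gives the family `j + t D` of embeddings, and it is the velocity of a reparametrization of the
source exactly when it is tangent. -/
abbrev NormalSections (j : ExteriorAlgebra R M →+* ExteriorAlgebra S N) (p : ZMod 2) : Type _ :=
  SuperDer j p ⧸ tangentPart j p

/-- The space `t · Λ` for a parameter `t` of parity `p`, as a bimodule over the exterior algebra
`Λ`: the rule `a t = (-1)^{p |a|} t a` twists the left action. -/
def TimesT (S N : Type*) [CommRing S] [AddCommGroup N] [Module S N] (_p : ZMod 2) : Type _ :=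
  ExteriorAlgebra S N

section TimesT

variable (S N) (p : ZMod 2)

instance : AddCommGroup (TimesT S N p) := inferInstanceAs (AddCommGroup (ExteriorAlgebra S N))

instance : Module (ExteriorAlgebra S N) (TimesT S N p) :=
  Module.compHom (ExteriorAlgebra S N) (sgn S N p).toRingHom

instance : Module (ExteriorAlgebra S N)ᵐᵒᵖ (TimesT S N p) :=
  inferInstanceAs (Module (ExteriorAlgebra S N)ᵐᵒᵖ (ExteriorAlgebra S N))

instance : SMulCommClass (ExteriorAlgebra S N) (ExteriorAlgebra S N)ᵐᵒᵖ (TimesT S N p) where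
  smul_comm a b x := (mul_assoc (sgn S N p a) (show ExteriorAlgebra S N from x) b.unop).symm

end TimesT

/-- The superalgebra `Λ[t] / t²`, where `t` has parity `p`; elements are written `a + t b`. -/
abbrev Thick (S N : Type*) [CommRing S] [AddCommGroup N] [Module S N] (p : ZMod 2) : Type _ :=
  TrivSqZeroExt (ExteriorAlgebra S N) (TimesT S N p)

/-- The infinitesimal family `j + t D` of morphisms with velocity `D`, over `ℝ[t] / t²` with `t` of
parity `p`. -/
def family {j : ExteriorAlgebra R M →+* ExteriorAlgebra S N} {p : ZMod 2} (D : SuperDer j p) :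
    ExteriorAlgebra R M →+* Thick S N p where
  toFun a := (j a, (D.1 a : ExteriorAlgebra S N))
  map_one' := by
    have h : D.1 1 = 0 := by
      have h := D.2.2 1 1
      simpa using h
    refine TrivSqZeroExt.ext (map_one j) ?_
    exact h
  map_mul' a b := by
    refine TrivSqZeroExt.ext (map_mul j a b) ?_
    exact (D.2.2 a b).trans (add_comm _ _)
  map_zero' := TrivSqZeroExt.ext (map_zero j) (map_zero D.1)
  map_add' a b := TrivSqZeroExt.ext (map_add j a b) (map_add D.1 a b)

/-- The `t`-linear extension to `Λ[t] / t²` of a vector field `V` of parity `q`: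
`V (a + t b) = V a + (-1)^{p q} t V b`. -/
def extendField {q : ZMod 2} (p : ZMod 2) (V : SuperVec S N q) (z : Thick S N p) : Thick S N p :=
  (V.1 z.fst, ((-1 : ℝ) ^ (p.val * q.val) • V.1 (z.snd : ExteriorAlgebra S N) :
    ExteriorAlgebra S N))

end Super

/-! ### The supermanifold `ΠΩ¹Y × ℝ^{0|1}` and its sub-supermanifold `ΠN*` -/

section Contact

variable {R S : Type*} [CommRing R] [Algebra ℝ R] [CommRing S] [Algebra ℝ S]

/-- Functions on `ΠΩ¹Y × ℝ^{0|1}`: multivector fields on `Y`, with one further odd generator. -/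
abbrev Ambient (R : Type*) [CommRing R] [Algebra ℝ R] : Type _ := ExteriorAlgebra R (Vec R × R)

/-- A function on `Y`, as an even function on `ΠΩ¹Y × ℝ^{0|1}`. -/
def fn (f : R) : Ambient R := algebraMap R (Ambient R) f

/-- A vector field on `Y`, as an odd function on `ΠΩ¹Y × ℝ^{0|1}` that is linear on the fibres;
`psi ∂_a` is the coordinate `ψ_a`. -/
def psi (D : Vec R) : Ambient R := ExteriorAlgebra.ι R (D, 0)

/-- The coordinate of `ℝ^{0|1}`. -/
def eps (R : Type*) [CommRing R] [Algebra ℝ R] : Ambient R := ExteriorAlgebra.ι R (0, 1)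

/-- Functions on `ΠN*`: sections of the exterior algebra of the normal bundle. -/
abbrev Sub (φ : R →ₐ[ℝ] S) : Type _ := ExteriorAlgebra S (Normal φ)

/-- The inclusion `ΠN* → ΠΩ¹Y × ℝ^{0|1}`: it maps `f` to `f|_X`, a vector field to its normal
part along `X`, and `ε` to `0`. -/
def incl (φ : R →ₐ[ℝ] S) : Ambient R →+* Sub φ :=
  extMap ((normalPart φ).comp (LinearMap.fst R (Vec R) R))

end Contact

/-- Finitely many functions `x i` and vector fields `e i` on `Y` with `v = ∑ v(x i) e i` for all
tangent vectors `v` at points near the submanifold, that is `id = ∑ dx^a ⊗ e_a`: a global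
substitute for the pairs `(x^a, ∂_a)` of a local coordinate system. Contractions such as
`∑ dx^a ψ_a` and `∑ ω^{ab} ψ_a ψ_b` do not depend on its choice. -/
structure Frame {k n : ℕ} {X Y : Type*}
    [TopologicalSpace X] [ChartedSpace (EuclideanSpace ℝ (Fin k)) X]
    [TopologicalSpace Y] [ChartedSpace (EuclideanSpace ℝ (Fin n)) Y]
    (i : C^∞⟮𝓡 k, X; 𝓡 n, Y⟯) where
  size : ℕ
  x : Fin size → Fn n Y
  e : Fin size → Vec (Fn n Y)
  domain : Set Y
  isOpen_domain : IsOpen domain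
  range_subset : Set.range i ⊆ domain
  expand : ∀ (D : Vec (Fn n Y)) (f : Fn n Y), ∀ y ∈ domain,
    D f y = ∑ a, D (x a) y * e a f y

section Deformations

variable {k n : ℕ} {X Y : Type*}
  [TopologicalSpace X] [ChartedSpace (EuclideanSpace ℝ (Fin k)) X]
  [TopologicalSpace Y] [ChartedSpace (EuclideanSpace ℝ (Fin n)) Y]
  {i : C^∞⟮𝓡 k, X; 𝓡 n, Y⟯}

/-- The even function `ω̂ = ∑ ω^{ab} ψ_a ψ_b`, near `ΠN*`. -/
def omegaHat (F : Frame i) (w : SymplecticForm (Fn n Y)) : Ambient (Fn n Y) :=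
  ∑ a, psi (F.e a) * psi (w.ham (F.x a))

/-- The family `g` is Legendrian: the pullback along `g` of `θ̂ = dε + ∑ dx^a ψ_a`, as a form
relative to the base of the family, vanishes on all vector fields `V` of `ΠN*` (whose `t`-linear
extensions generate the relative vector fields of the family). -/
def IsLegendrian (F : Frame i) {p : ZMod 2}
    (g : Ambient (Fn n Y) →+* Thick (Fn k X) (Normal (pullback i)) p) : Prop :=
  ∀ (q : ZMod 2) (V : SuperVec (Fn k X) (Normal (pullback i)) q),
    extendField p V (g (eps (Fn n Y)))
      + ∑ a, extendField p V (g (fn (F.x a))) * g (psi (F.e a)) = 0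

/-- The family `g` is `ω`-isotropic: `ω̂` vanishes on it. -/
def IsIsotropic (F : Frame i) (w : SymplecticForm (Fn n Y)) {p : ZMod 2}
    (g : Ambient (Fn n Y) →+* Thick (Fn k X) (Normal (pullback i)) p) : Prop :=
  g (omegaHat F w) = 0

/-- The part of parity `p` of the Zariski tangent space at `ΠN*` to the moduli space of
deformations within Legendrian `ω`-isotropic sub-supermanifolds: the normal sections of the
infinitesimal deformations, over `ℝ[t] / t²` with `t` of parity `p`, that lie in this class. -/
def zariskiTangent (F : Frame i) (w : SymplecticForm (Fn n Y)) (p : ZMod 2) :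
    Set (NormalSections (incl (pullback i)) p) :=
  {ν | ∃ D : SuperDer (incl (pullback i)) p, Submodule.Quotient.mk D = ν ∧
    IsLegendrian F (family D) ∧ IsIsotropic F w (family D)}

/-- The contraction `D ⌟ θ̂` of the contact form with a vector field `D` along `ΠN*`. -/
def contraction (F : Frame i) {p : ZMod 2} (D : SuperDer (incl (pullback i)) p) :
    Sub (pullback i) :=
  D.1 (eps (Fn n Y)) + ∑ a, D.1 (fn (F.x a)) * incl (pullback i) (psi (F.e a))

end Deformations

/-! ### Closed differential forms -/

section Forms

variable {S : Type*} [CommRing S] [Algebra ℝ S]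

/-- Differential forms of all degrees on the manifold with function algebra `S`. -/
abbrev Forms (S : Type*) [CommRing S] [Algebra ℝ S] : Type _ := ExteriorAlgebra S (OneForm S)

/-- The value on vector fields `V₁, …, V_l` of the component of degree `l` of a form. -/
def evalForm : {l : ℕ} → (Fin l → Vec S) → Forms S →ₗ[S] S
  | 0, _ => (ExteriorAlgebra.algebraMapInv : Forms S →ₐ[S] S).toLinearMap
  | _ + 1, V =>
      evalForm (Fin.tail V) ∘ₗ CliffordAlgebra.contractLeft (Module.Dual.eval S (Vec S) (V 0))

/-- The value on vector fields `V₀, …, V_l` of the exterior derivative of the component of degree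
`l` of a form, by the invariant formula
`∑ᵢ (-1)^i Vᵢ(α(…, V̂ᵢ, …)) + ∑_{i < j} (-1)^{i+j} α([Vᵢ, Vⱼ], …, V̂ᵢ, …, V̂ⱼ, …)`.
In the second sum the index pair is `(i, j + 1)` with `i ≤ j`. -/
def evalD : (l : ℕ) → (Fin (l + 1) → Vec S) → Forms S →ₗ[ℝ] S
  | 0, V => (V 0 : S →ₗ[ℝ] S) ∘ₗ (evalForm (Fin.tail V)).restrictScalars ℝ
  | l + 1, V =>
      (∑ i : Fin (l + 2), (-1 : ℝ) ^ (i : ℕ) •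
        ((V i : S →ₗ[ℝ] S) ∘ₗ (evalForm (i.removeNth V)).restrictScalars ℝ))
      - ∑ i : Fin (l + 1), ∑ j ∈ Finset.Ici i, (-1 : ℝ) ^ (i + j : ℕ) •
        (evalForm (Matrix.vecCons ⁅V i.castSucc, V j.succ⁆
          (j.removeNth (i.castSucc.removeNth V)))).restrictScalars ℝ

/-- Global closed differential forms of parity `q`. -/
def closedForms (S : Type*) [CommRing S] [Algebra ℝ S] (q : ZMod 2) : Submodule ℝ (Forms S) :=
  (parityPart S (OneForm S) q).restrictScalars ℝ ⊓ ⨅ (l : ℕ) (V : Fin (l + 1) → Vec S),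
    LinearMap.ker (evalD l V)

end Forms

end OddContact

end

/-!
Why the tangent space consists of closed forms: a velocity `D` along the inclusion of `ΠN*` has the
contact Hamiltonian `H = D ⌟ θ̂`, a function on `ΠN*`, and functions on `ΠN*` are differential forms
on `X` by `N ≅ Ω¹X`. As in contact geometry, Legendrian deformations up to reparametrization are the
same as their Hamiltonians, and the derivative of `ω̂` along the deformation turns out to be the de
Rham differential of the Hamiltonian.

The Legendrian condition is an identity for all vector fields `V` on `ΠN*`. These are generated by
contractions with functionals on `N` and by lifts of vector fields on `X`
(`VecFrame.Expands.exists_decomposition`). For contractions the condition says that the normal part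
of the underlying deformation in `Y` is given by the vertical derivatives of `H`
(`legendrian_contrField`), and for lifts it constrains the values of `D` on the odd coordinates.
* If `H = 0`, then the underlying deformation is tangent to `X`, hence given by a vector field along
  the projection `ΠN* → X`, and the condition for lifts shows that `D` vanishes on the functions
  `psi v` with `v` tangent to `X`, so `D` descends to a vector field on `ΠN*`
  (`tangent_of_hamiltonian`). Conversely, tangent velocities have `H = 0`, since `θ̂` vanishes on
  `ΠN*` (`hamiltonian_of_tangent`).
* For any `H` of the right parity, the condition for contractions prescribes `D` on functions on `Y`,
  and the defect in the condition for lifts is removed by a change of `D` on the odd coordinates,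
  along a projection of `TY|_X` onto `TX` (`exists_legendrian`).
* Let `d` be the de Rham differential, as an odd vector field on `ΠN*`. The Legendrian condition for
  `V = d`, together with `dω = 0`, gives `D ω̂ = ± 2 d H` (`der_omega`). Since `ω̂` vanishes on `ΠN*`,
  the deformation is `ω`-isotropic exactly when `H` is closed (`isotropic_iff`).

Closedness is defined by the invariant formula for the exterior derivative. It is compared with a
differential built from a global substitute for coordinates: Cartan's formula for the Lie derivative
yields the invariant formula by induction on the degree, and an element of the exterior algebra of a
finitely generated projective module vanishes as soon as its iterated contractions do
(`mem_closedForms_iff`).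

All of this is algebra over the function algebras of `Y` and `X`, given the data collected in
`LagrangianFrame`. These data come from finitely many charts of `Y`, cut off so as to be global, in
which `X` is a linear subspace (`exists_adaptedAtlas`); Hadamard's lemma (`exists_hadamard`) shows
that derivations of the algebra of functions are determined by their values on coordinates. The map
`TY|_X → Ω¹X`, `δ ↦ ω(δ, ·)`, is onto because `ω` is nondegenerate and `TX` is a direct summand of
`TY|_X`. Its kernel is `TX`, since at each point of `X` the pairing of the normal with the
tangential coordinate directions is a square matrix with a one-sided inverse (`interior_ker`).
-/

set_option linter.unusedSectionVars false

noncomputable section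

namespace OddContact

/-! ### Signs and parities -/

/-- The sign `(-1)^i` attached to a parity. -/
def parSign (i : ZMod 2) : ℝ := if i = 0 then 1 else -1

@[simp] lemma parSign_zero : parSign 0 = 1 := rfl

@[simp] lemma parSign_one : parSign 1 = -1 := if_neg (by decide)

lemma zmod_two_cases (i : ZMod 2) : i = 0 ∨ i = 1 := by
  revert i; decide

lemma parSign_add (i j : ZMod 2) : parSign (i + j) = parSign i * parSign j := by
  have h : (1 + 1 : ZMod 2) = 0 := rfl
  rcases zmod_two_cases i with rfl | rfl <;> rcases zmod_two_cases j with rfl | rfl <;> simp [h]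

@[simp] lemma parSign_mul_self (i : ZMod 2) : parSign i * parSign i = 1 := by
  rcases zmod_two_cases i with rfl | rfl <;> simp

lemma neg_one_pow_val_mul_val (p q : ZMod 2) :
    (-1 : ℝ) ^ (p.val * q.val) = parSign (p * q) := by
  rcases zmod_two_cases p with rfl | rfl <;> rcases zmod_two_cases q with rfl | rfl <;>
    simp [ZMod.val_one]

section Parity

variable {S N : Type*} [CommRing S] [Algebra ℝ S] [AddCommGroup N] [Module S N] [Module ℝ N]
  [IsScalarTower ℝ S N]

lemma sgn_zero_apply (a : ExteriorAlgebra S N) : sgn S N 0 a = a := by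
  simp [sgn]

lemma sgn_one_apply (a : ExteriorAlgebra S N) :
    sgn S N 1 a = CliffordAlgebra.involute a := by
  simp [sgn]

lemma sgn_ι (p : ZMod 2) (n : N) :
    sgn S N p (ExteriorAlgebra.ι S n) = parSign p • ExteriorAlgebra.ι S n := by
  rcases zmod_two_cases p with rfl | rfl
  · simp [sgn_zero_apply]
  · rw [sgn_one_apply, parSign_one, neg_one_smul]
    exact CliffordAlgebra.involute_ι n

lemma sgn_algebraMap (p : ZMod 2) (s : S) :
    sgn S N p (algebraMap S _ s) = algebraMap S (ExteriorAlgebra S N) s :=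
  AlgHom.commutes _ _

lemma sgn_sgn (p q : ZMod 2) (a : ExteriorAlgebra S N) :
    sgn S N p (sgn S N q a) = sgn S N (p + q) a := by
  have h : (1 + 1 : ZMod 2) = 0 := rfl
  rcases zmod_two_cases p with rfl | rfl <;> rcases zmod_two_cases q with rfl | rfl <;>
    simp [sgn_zero_apply, sgn_one_apply, h]

lemma sgn_of_mem (p : ZMod 2) {i : ZMod 2} {a : ExteriorAlgebra S N}
    (ha : a ∈ parityPart S N i) : sgn S N p a = parSign (p * i) • a := by
  rcases zmod_two_cases p with rfl | rfl
  · simp [sgn_zero_apply]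
  · rw [sgn_one_apply, one_mul]
    rcases zmod_two_cases i with rfl | rfl
    · rw [parSign_zero, one_smul]
      exact CliffordAlgebra.involute_eq_of_mem_even ha
    · rw [parSign_one, neg_one_smul]
      exact CliffordAlgebra.involute_eq_of_mem_odd ha

lemma exists_even_add_odd (a : ExteriorAlgebra S N) :
    ∃ b ∈ parityPart S N 0, ∃ c ∈ parityPart S N 1, b + c = a :=
  Submodule.mem_sup.1 ((CliffordAlgebra.evenOdd_isCompl
    (0 : QuadraticForm S N)).sup_eq_top.symm ▸ Submodule.mem_top)

/-- Since `2` is invertible, the parts of the two parities are the eigenspaces of the grading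
involution. -/
lemma mem_parityPart_iff {i : ZMod 2} {a : ExteriorAlgebra S N} :
    a ∈ parityPart S N i ↔ sgn S N 1 a = parSign i • a := by
  refine ⟨fun h => by simpa using sgn_of_mem 1 h, fun h => ?_⟩
  obtain ⟨b, hb, c, hc, rfl⟩ := exists_even_add_odd a
  rw [map_add, sgn_of_mem 1 hb, sgn_of_mem 1 hc] at h
  have half : ∀ x : ExteriorAlgebra S N, x + x = 0 → x = 0 := fun x hx => by
    have : x = (1 / 2 : ℝ) • (x + x) := by
      rw [← two_smul ℝ x, smul_smul]; norm_num
    rw [this, hx, smul_zero]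
  rcases zmod_two_cases i with rfl | rfl
  · have : c = 0 := half c (by
      simp only [one_mul, mul_zero, parSign_zero, parSign_one, one_smul, neg_smul] at h
      exact neg_eq_iff_add_eq_zero.1 (add_left_cancel h))
    simpa [this] using hb
  · have : b = 0 := half b (by
      simp only [mul_zero, parSign_zero, parSign_one, one_smul, neg_smul, mul_one, neg_add] at h
      exact neg_eq_iff_add_eq_zero.1 (add_right_cancel h).symm)
    simpa [this] using hc

lemma algebraMap_mem_parityPart (s : S) :
    algebraMap S (ExteriorAlgebra S N) s ∈ parityPart S N 0 :=
  SetLike.algebraMap_mem_graded _ _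

lemma ι_mem_parityPart (n : N) : ExteriorAlgebra.ι S n ∈ parityPart S N 1 :=
  CliffordAlgebra.ι_mem_evenOdd_one _ n

lemma mul_mem_parityPart {i j : ZMod 2} {a b : ExteriorAlgebra S N}
    (ha : a ∈ parityPart S N i) (hb : b ∈ parityPart S N j) : a * b ∈ parityPart S N (i + j) :=
  SetLike.mul_mem_graded ha hb

lemma smul_mem_parityPart {i : ZMod 2} (c : ℝ) {a : ExteriorAlgebra S N}
    (ha : a ∈ parityPart S N i) : c • a ∈ parityPart S N i := by
  rw [← algebraMap_smul S c a]
  exact Submodule.smul_mem _ _ ha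

lemma ι_mul_eq (n : N) (b : ExteriorAlgebra S N) :
    ExteriorAlgebra.ι S n * b = sgn S N 1 b * ExteriorAlgebra.ι S n := by
  induction b using ExteriorAlgebra.induction with
  | algebraMap r => rw [sgn_algebraMap, Algebra.commutes]
  | ι m =>
    rw [sgn_ι, parSign_one, neg_one_smul, neg_mul]
    exact eq_neg_of_add_eq_zero_left (ExteriorAlgebra.ι_add_mul_swap n m)
  | mul a b ha hb => rw [map_mul, ← mul_assoc, ha, mul_assoc, hb, mul_assoc]
  | add a b ha hb => rw [map_add, mul_add, add_mul, ha, hb]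

/-- Supercommutativity, with the sign carried by the grading involution. -/
lemma mul_eq_mul_sgn (a : ExteriorAlgebra S N) {j : ZMod 2} {b : ExteriorAlgebra S N}
    (hb : b ∈ parityPart S N j) : a * b = b * sgn S N j a := by
  induction a using ExteriorAlgebra.induction with
  | algebraMap r => rw [sgn_algebraMap, Algebra.commutes]
  | ι m =>
    rw [sgn_ι, ι_mul_eq, sgn_of_mem 1 hb, one_mul, smul_mul_assoc, mul_smul_comm]
  | mul x y hx hy => rw [map_mul, mul_assoc, hy, ← mul_assoc, hx, mul_assoc]
  | add x y hx hy => rw [map_add, mul_add, add_mul, hx, hy]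

lemma mul_swap {i j : ZMod 2} {a b : ExteriorAlgebra S N}
    (ha : a ∈ parityPart S N i) (hb : b ∈ parityPart S N j) :
    a * b = parSign (j * i) • (b * a) := by
  rw [mul_eq_mul_sgn a hb, sgn_of_mem j ha, mul_smul_comm]

end Parity

/-! ### Superderivations on generators -/

section Generators

variable {R M : Type*} [CommRing R] [AddCommGroup M] [Module R M]

/-- A map satisfying a twisted Leibniz rule is determined by its values on generators. -/
lemma eq_of_leibniz {B : Type*} [Ring B] (σ τ : ExteriorAlgebra R M →+* B)
    (D D' : ExteriorAlgebra R M →+ B)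
    (hD : ∀ a b, D (a * b) = D a * σ b + τ a * D b)
    (hD' : ∀ a b, D' (a * b) = D' a * σ b + τ a * D' b)
    (h₀ : ∀ r, D (algebraMap R _ r) = D' (algebraMap R _ r))
    (h₁ : ∀ m, D (ExteriorAlgebra.ι R m) = D' (ExteriorAlgebra.ι R m)) :
    ∀ a, D a = D' a := by
  intro a
  induction a using ExteriorAlgebra.induction with
  | algebraMap r => exact h₀ r
  | ι m => exact h₁ m
  | mul a b ha hb => rw [hD, hD', ha, hb]
  | add a b ha hb => rw [map_add, map_add, ha, hb]

end Generators

section Super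

variable {R M S N : Type*} [CommRing R] [Algebra ℝ R] [AddCommGroup M] [Module R M] [Module ℝ M]
  [IsScalarTower ℝ R M] [CommRing S] [Algebra ℝ S] [AddCommGroup N] [Module S N] [Module ℝ N]
  [IsScalarTower ℝ S N] {j : ExteriorAlgebra R M →+* ExteriorAlgebra S N} {p : ZMod 2}

lemma SuperDer.mem (D : SuperDer j p) {i : ZMod 2} {a : ExteriorAlgebra R M}
    (ha : a ∈ parityPart R M i) : D.1 a ∈ parityPart S N (i + p) := D.2.1 i a ha

lemma SuperDer.leibniz (D : SuperDer j p) (a b : ExteriorAlgebra R M) :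
    D.1 (a * b) = D.1 a * j b + sgn S N p (j a) * D.1 b := D.2.2 a b

lemma SuperDer.sgn_apply (D : SuperDer j p) (a : ExteriorAlgebra R M) :
    sgn S N 1 (D.1 a) = parSign p • D.1 (sgn R M 1 a) := by
  obtain ⟨b, hb, c, hc, rfl⟩ := exists_even_add_odd a
  simp only [map_add, smul_add]
  rw [sgn_of_mem 1 hb, sgn_of_mem 1 hc, sgn_of_mem 1 (D.mem hb), sgn_of_mem 1 (D.mem hc)]
  simp [parSign_add, mul_comm]

/-- A superderivation may be prescribed on the even and the odd generators, subject to the Leibniz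
rules. The pair of `j` and the prescribed values is a homomorphism to the infinitesimal
thickening `Λ[t] / t²`, which exists by the universal property of the exterior algebra; the Leibniz
rules say that it is linear over the even generators. -/
theorem exists_superDer (p : ZMod 2) (hjs : ∀ a, j (sgn R M 1 a) = sgn S N 1 (j a))
    (hjc : ∀ c : ℝ, j (algebraMap R _ (algebraMap ℝ R c)) = algebraMap S _ (algebraMap ℝ S c))
    (δ : R → ExteriorAlgebra S N) (η : M → ExteriorAlgebra S N)
    (hδp : ∀ r, δ r ∈ parityPart S N p) (hηp : ∀ m, η m ∈ parityPart S N (p + 1))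
    (hδc : ∀ c : ℝ, δ (algebraMap ℝ R c) = 0)
    (hδa : ∀ r s, δ (r + s) = δ r + δ s)
    (hδm : ∀ r s, δ (r * s) = δ r * j (algebraMap R _ s) + j (algebraMap R _ r) * δ s)
    (hηa : ∀ m n, η (m + n) = η m + η n)
    (hηm : ∀ (r : R) (m : M),
      η (r • m) = δ r * j (ExteriorAlgebra.ι R m) + j (algebraMap R _ r) * η m) :
    ∃ D : SuperDer j p, (∀ r, D.1 (algebraMap R _ r) = δ r) ∧
      ∀ m, D.1 (ExteriorAlgebra.ι R m) = η m := by
  have hsj : ∀ r, sgn S N p (j (algebraMap R _ r)) = j (algebraMap R _ r) := fun r => by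
    have h1 : sgn S N 1 (j (algebraMap R _ r)) = j (algebraMap R _ r) := by
      rw [← hjs, sgn_algebraMap]
    rcases zmod_two_cases p with rfl | rfl
    · rw [sgn_zero_apply]
    · exact h1
  have hjr : ∀ r, j (algebraMap R _ r) ∈ parityPart S N 0 := fun r => by
    rw [mem_parityPart_iff, ← hjs, sgn_algebraMap]; simp
  have hjι : ∀ m, j (ExteriorAlgebra.ι R m) ∈ parityPart S N 1 := fun m => by
    rw [mem_parityPart_iff, ← hjs, sgn_ι, parSign_one]; simp
  have hδ1 : δ 1 = 0 := by simpa using hδc 1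
  have hδ0 : δ 0 = 0 := by simpa using hδc 0
  let f : R →+* Thick S N p :=
    { toFun := fun r => (j (algebraMap R _ r), δ r)
      map_one' := TrivSqZeroExt.ext (by simp; rfl) (by simpa using! hδ1)
      map_zero' := TrivSqZeroExt.ext (by simp; rfl) (by simpa using! hδ0)
      map_add' := fun r s => TrivSqZeroExt.ext
        (by rw [map_add, map_add]; rfl) (hδa r s)
      map_mul' := fun r s => TrivSqZeroExt.ext
        (by rw [map_mul, map_mul]; rfl) (by
          refine (hδm r s).trans ((add_comm _ _).trans ?_)
          change _ = sgn S N p (j (algebraMap R _ r)) * δ s + δ r * j (algebraMap R _ s)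
          rw [hsj]) }
  -- the image of `R` is central, by supercommutativity
  have hf : ∀ r (x : Thick S N p), f r * x = x * f r := fun r x => by
    refine TrivSqZeroExt.ext ?_ ?_
    · change j (algebraMap R _ r) * x.fst = x.fst * j (algebraMap R _ r)
      rw [mul_eq_mul_sgn x.fst (hjr r), sgn_zero_apply]
    · change sgn S N p (j (algebraMap R _ r)) * (show ExteriorAlgebra S N from x.snd)
          + δ r * x.fst
        = sgn S N p x.fst * δ r
          + (show ExteriorAlgebra S N from x.snd) * j (algebraMap R _ r)
      rw [hsj, mul_eq_mul_sgn _ (hjr r), sgn_zero_apply,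
        mul_eq_mul_sgn (sgn S N p x.fst) (hδp r), sgn_sgn,
        show p + p = 0 from CharTwo.add_self_eq_zero p, sgn_zero_apply, add_comm]
  let _ : Algebra R (Thick S N p) := f.toAlgebra' hf
  let l : M →ₗ[R] Thick S N p :=
    { toFun := fun m => (j (ExteriorAlgebra.ι R m), η m)
      map_add' := fun m n => TrivSqZeroExt.ext (by rw [map_add, map_add]; rfl) (hηa m n)
      map_smul' := fun r m => TrivSqZeroExt.ext
        (by rw [map_smul, Algebra.smul_def, map_mul]; rfl) (by
          refine (hηm r m).trans ((add_comm _ _).trans ?_)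
          change _ = sgn S N p (j (algebraMap R _ r)) * η m + δ r * j (ExteriorAlgebra.ι R m)
          rw [hsj]) }
  have hl : ∀ m, l m * l m = 0 := fun m => by
    refine TrivSqZeroExt.ext ?_ ?_
    · change j (ExteriorAlgebra.ι R m) * j (ExteriorAlgebra.ι R m) = 0
      rw [← map_mul, ExteriorAlgebra.ι_sq_zero, map_zero]
    · change sgn S N p (j (ExteriorAlgebra.ι R m)) * η m + η m * j (ExteriorAlgebra.ι R m) = 0
      rw [sgn_of_mem p (hjι m), mul_swap (hηp m) (hjι m), smul_mul_assoc, ← add_smul,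
        mul_one, one_mul, parSign_add, parSign_one]
      simp
  let F : ExteriorAlgebra R M →ₐ[R] Thick S N p := ExteriorAlgebra.lift R ⟨l, hl⟩
  have hFr : ∀ r, F (algebraMap R _ r) = f r := fun r => F.commutes r
  have hFι : ∀ m, F (ExteriorAlgebra.ι R m) = l m := fun m => ExteriorAlgebra.lift_ι_apply R l hl m
  have hF1 : ∀ a, (F a).fst = j a := fun a => by
    induction a using ExteriorAlgebra.induction with
    | algebraMap r => rw [hFr]; rfl
    | ι m => rw [hFι]; rfl
    | mul a b ha hb => rw [map_mul, TrivSqZeroExt.fst_mul, ha, hb, map_mul]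
    | add a b ha hb => rw [map_add, TrivSqZeroExt.fst_add, ha, hb, map_add]
  let d : ExteriorAlgebra R M → ExteriorAlgebra S N := fun a => (F a).snd
  have hdm : ∀ a b, d (a * b) = d a * j b + sgn S N p (j a) * d b := fun a b => by
    change (F (a * b)).snd = _
    rw [map_mul, TrivSqZeroExt.snd_mul, hF1, hF1, add_comm]
    rfl
  have hda : ∀ a b, d (a + b) = d a + d b := fun a b => by
    change (F (a + b)).snd = _
    rw [map_add]; rfl
  have hdr : ∀ r, d (algebraMap R _ r) = δ r := fun r => by
    change (F _).snd = _
    rw [hFr]; rfl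
  have hdι : ∀ m, d (ExteriorAlgebra.ι R m) = η m := fun m => by
    change (F _).snd = _
    rw [hFι]; rfl
  let D : ExteriorAlgebra R M →ₗ[ℝ] ExteriorAlgebra S N :=
    { toFun := d
      map_add' := hda
      map_smul' := fun c a => by
        have hc : c • a = algebraMap R _ (algebraMap ℝ R c) * a := by
          rw [← Algebra.smul_def, algebraMap_smul]
        rw [hc, hdm, hdr, hδc, zero_mul, zero_add, hjc, sgn_algebraMap, ← Algebra.smul_def,
          algebraMap_smul]
        rfl }
  have hsd : ∀ a, sgn S N 1 (d a) = parSign p • d (sgn R M 1 a) := fun a => by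
    induction a using ExteriorAlgebra.induction with
    | algebraMap r => rw [sgn_algebraMap, hdr]; simpa using sgn_of_mem 1 (hδp r)
    | ι m =>
      have h : d (sgn R M 1 (ExteriorAlgebra.ι R m)) = -η m := by
        rw [sgn_ι, parSign_one]
        exact (D.map_smul (-1) _).trans (by rw [neg_one_smul]; exact congrArg _ (hdι m))
      rw [h, hdι, sgn_of_mem 1 (hηp m), one_mul, parSign_add, parSign_one]
      simp
    | mul a b ha hb =>
      have h : sgn S N p (sgn S N 1 (j a)) = sgn S N 1 (sgn S N p (j a)) := by
        rw [sgn_sgn, sgn_sgn, add_comm]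
      rw [hdm, map_add, map_mul, map_mul, ha, hb, map_mul, hdm, hjs, hjs, h, smul_add,
        smul_mul_assoc, mul_smul_comm]
    | add a b ha hb => rw [hda, map_add, map_add, hda, ha, hb, smul_add]
  refine ⟨⟨D, fun i a ha => ?_, hdm⟩, hdr, hdι⟩
  change d a ∈ _
  rw [mem_parityPart_iff, hsd, sgn_of_mem 1 ha, one_mul, add_comm, parSign_add, mul_smul]
  exact congrArg _ (D.map_smul _ _)

end Super

/-! ### Contractions, and the nondegeneracy of their iterated values -/

section Contraction

variable {S N : Type*} [CommRing S] [Algebra ℝ S] [AddCommGroup N] [Module S N] [Module ℝ N]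
  [IsScalarTower ℝ S N]

/-- Contraction of an element of the exterior algebra with a functional. -/
def contr (f : Module.Dual S N) : ExteriorAlgebra S N →ₗ[S] ExteriorAlgebra S N :=
  CliffordAlgebra.contractLeft (Q := (0 : QuadraticForm S N)) f

@[simp] lemma contr_algebraMap (f : Module.Dual S N) (s : S) :
    contr f (algebraMap S _ s) = 0 :=
  CliffordAlgebra.contractLeft_algebraMap _ _ s

@[simp] lemma contr_ι (f : Module.Dual S N) (n : N) :
    contr f (ExteriorAlgebra.ι S n) = algebraMap S _ (f n) :=
  CliffordAlgebra.contractLeft_ι _ _ n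

lemma contr_ι_mul (f : Module.Dual S N) (n : N) (b : ExteriorAlgebra S N) :
    contr f (ExteriorAlgebra.ι S n * b) = f n • b - ExteriorAlgebra.ι S n * contr f b :=
  CliffordAlgebra.contractLeft_ι_mul _ n b

lemma contr_comm (f g : Module.Dual S N) (x : ExteriorAlgebra S N) :
    contr f (contr g x) = -contr g (contr f x) :=
  CliffordAlgebra.contractLeft_comm _ _ x

lemma contr_mul (f : Module.Dual S N) (a b : ExteriorAlgebra S N) :
    contr f (a * b) = contr f a * b + sgn S N 1 a * contr f b := by
  have h : ∀ a : CliffordAlgebra (0 : QuadraticForm S N), ∀ b : ExteriorAlgebra S N,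
      contr f (a * b) = contr f a * b + sgn S N 1 a * contr f b := by
    intro a
    induction a using CliffordAlgebra.left_induction with
    | algebraMap r =>
      intro b
      have h1 : contr f (algebraMap S (ExteriorAlgebra S N) r) = 0 := contr_algebraMap f r
      have h2 : sgn S N 1 (algebraMap S (ExteriorAlgebra S N) r) = algebraMap S _ r :=
        sgn_algebraMap 1 r
      erw [h1, h2]
      rw [zero_mul, zero_add, ← Algebra.smul_def]
      exact (congrArg (contr f) (Algebra.smul_def r b).symm).trans (map_smul _ _ _)
    | add x y hx hy =>
      intro b
      rw [add_mul, map_add, hx, hy, map_add, map_add, add_mul, add_mul]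
      abel
    | ι_mul x m hx =>
      intro b
      have h1 := contr_ι_mul f m x
      have h2 := contr_ι_mul f m (x * b)
      have h3 : sgn S N 1 (ExteriorAlgebra.ι S m) = -ExteriorAlgebra.ι S m := by
        rw [sgn_ι, parSign_one, neg_one_smul]
      change contr f (ExteriorAlgebra.ι S m * x * b) = contr f (ExteriorAlgebra.ι S m * x) * b +
        sgn S N 1 (ExteriorAlgebra.ι S m * x) * contr f b
      rw [mul_assoc, h2, h1, map_mul (sgn S N 1), h3, hx b]
      simp only [sub_mul, mul_add, smul_mul_assoc, neg_mul, mul_assoc]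
      abel
  exact h a b

lemma contr_sgn (f : Module.Dual S N) (a : ExteriorAlgebra S N) :
    contr f (sgn S N 1 a) = -sgn S N 1 (contr f a) := by
  induction a using ExteriorAlgebra.induction with
  | algebraMap r => rw [sgn_algebraMap, contr_algebraMap, map_zero, neg_zero]
  | ι m => rw [sgn_ι, parSign_one, neg_one_smul, map_neg, contr_ι, sgn_algebraMap]
  | mul a b ha hb =>
    rw [map_mul, contr_mul, contr_mul, ha, hb, map_add, map_mul, map_mul]
    noncomm_ring
  | add a b ha hb => rw [map_add, map_add, ha, hb, map_add, map_add, neg_add]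

lemma contr_smul_real (f : Module.Dual S N) (c : ℝ) (a : ExteriorAlgebra S N) :
    contr f (c • a) = c • contr f a := by
  rw [← algebraMap_smul S c a, map_smul, algebraMap_smul]

/-- Contraction with a functional, as an odd vector field. -/
def contrField (f : Module.Dual S N) : SuperVec S N 1 :=
  ⟨(contr f).restrictScalars ℝ, fun i a ha => by
    rw [mem_parityPart_iff] at ha ⊢
    change sgn S N 1 (contr f a) = _ • contr f a
    rw [← neg_inj, ← contr_sgn, ha, contr_smul_real, parSign_add, parSign_one]
    simp, fun a b => contr_mul f a b⟩

@[simp] lemma contrField_apply (f : Module.Dual S N) (a : ExteriorAlgebra S N) :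
    (contrField f).1 a = contr f a := rfl

/-- A finite system of generators of a module together with coordinate functionals: a dual basis,
as it exists for finitely generated projective modules. -/
structure DualFrame (κ S N : Type*) [CommRing S] [AddCommGroup N] [Module S N] where
  vec : κ → N
  coord : κ → Module.Dual S N

variable {κ : Type*} [Fintype κ]

/-- The defining property of a dual basis. -/
def DualFrame.Expands (b : DualFrame κ S N) : Prop :=
  ∀ n, ∑ k, b.coord k n • b.vec k = n

/-- The iterated contraction with functionals, followed by projection to the scalars. -/
def evalContr : {l : ℕ} → (Fin l → Module.Dual S N) → ExteriorAlgebra S N →ₗ[S] S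
  | 0, _ => (ExteriorAlgebra.algebraMapInv : ExteriorAlgebra S N →ₐ[S] S).toLinearMap
  | _ + 1, f => evalContr (Fin.tail f) ∘ₗ contr (f 0)

lemma contr_mem_pow (f : Module.Dual S N) (n : ℕ) :
    ∀ x ∈ ⋀[S]^(n + 1) N, contr f x ∈ ⋀[S]^n N := by
  induction n with
  | zero =>
    intro x hx
    rw [ExteriorAlgebra.exteriorPower, zero_add, pow_one] at hx
    obtain ⟨m, rfl⟩ := hx
    rw [contr_ι]
    exact SetLike.algebraMap_mem_graded (fun i => ⋀[S]^i N) _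
  | succ n ih =>
    intro x hx
    rw [ExteriorAlgebra.exteriorPower, pow_succ'] at hx
    induction hx using Submodule.mul_induction_on' with
    | mem_mul_mem a ha y hy =>
      obtain ⟨m, rfl⟩ := ha
      rw [contr_ι_mul]
      refine sub_mem (Submodule.smul_mem _ _ hy) ?_
      rw [ExteriorAlgebra.exteriorPower, pow_succ']
      exact Submodule.mul_mem_mul ⟨m, rfl⟩ (ih y hy)
    | add x _ y _ hx hy => rw [map_add]; exact add_mem hx hy

lemma contr_of_mem_pow_zero (f : Module.Dual S N) {x : ExteriorAlgebra S N}
    (hx : x ∈ ⋀[S]^0 N) : contr f x = 0 := by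
  rw [ExteriorAlgebra.exteriorPower, pow_zero] at hx
  obtain ⟨s, rfl⟩ := Submodule.mem_one.1 hx
  exact contr_algebraMap f s

/-- The Euler vector field `∑ bₖ ∧ ι_{bᵏ}` multiplies elements of degree `n` by `n`. -/
lemma DualFrame.Expands.euler {b : DualFrame κ S N} (hb : b.Expands) (n : ℕ) :
    ∀ x ∈ ⋀[S]^n N, ∑ k, ExteriorAlgebra.ι S (b.vec k) * contr (b.coord k) x = (n : S) • x := by
  induction n with
  | zero =>
    intro x hx
    simp [contr_of_mem_pow_zero _ hx]
  | succ n ih =>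
    intro x hx
    rw [ExteriorAlgebra.exteriorPower, pow_succ'] at hx
    induction hx using Submodule.mul_induction_on' with
    | mem_mul_mem a ha y hy =>
      obtain ⟨m, rfl⟩ := ha
      have h : ∀ k, ExteriorAlgebra.ι S (b.vec k) *
            contr (b.coord k) (ExteriorAlgebra.ι S m * y) =
          ExteriorAlgebra.ι S (b.coord k m • b.vec k) * y +
            ExteriorAlgebra.ι S m * (ExteriorAlgebra.ι S (b.vec k) * contr (b.coord k) y) := by
        intro k
        have h1 : ExteriorAlgebra.ι S (b.vec k) * ExteriorAlgebra.ι S m =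
            -(ExteriorAlgebra.ι S m * ExteriorAlgebra.ι S (b.vec k)) :=
          eq_neg_of_add_eq_zero_left (ExteriorAlgebra.ι_add_mul_swap _ _)
        rw [contr_ι_mul, mul_sub, ← mul_assoc, h1, map_smul, smul_mul_assoc, mul_smul_comm,
          neg_mul, sub_neg_eq_add, mul_assoc]
      rw [Finset.sum_congr rfl fun k _ => h k, Finset.sum_add_distrib, ← Finset.sum_mul,
        ← map_sum, hb m, ← Finset.mul_sum, ih y hy, mul_smul_comm, Nat.cast_succ, add_smul,
        one_smul, add_comm]
    | add x _ y _ hx hy =>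
      rw [smul_add, ← hx, ← hy, ← Finset.sum_add_distrib]
      exact Finset.sum_congr rfl fun k _ => by rw [map_add, mul_add]

lemma decompose_contr_aux {b : DualFrame κ S N} (hb : b.Expands) (n : ℕ)
    (x : ExteriorAlgebra S N) :
    ((n + 1 : ℕ) : S) • (DirectSum.decompose (fun i => ⋀[S]^i N) x (n + 1) : ExteriorAlgebra S N)
      = ∑ k, ExteriorAlgebra.ι S (b.vec k) *
        (DirectSum.decompose (fun i => ⋀[S]^i N) (contr (b.coord k) x) n :
          ExteriorAlgebra S N) := by
  induction x using DirectSum.Decomposition.inductionOn (fun i => ⋀[S]^i N) with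
  | zero => simp
  | add x y hx hy =>
    simp only [DirectSum.decompose_add, DirectSum.add_apply, Submodule.coe_add, smul_add, hx, hy,
      map_add, mul_add, Finset.sum_add_distrib]
  | @homogeneous i x =>
    rcases i with _ | i
    · rw [DirectSum.decompose_of_mem_ne (fun i => ⋀[S]^i N) x.2 (by omega)]
      simp [contr_of_mem_pow_zero _ x.2]
    · by_cases h : i = n
      · subst h
        rw [DirectSum.decompose_of_mem_same (fun i => ⋀[S]^i N) x.2, ← hb.euler (i + 1) _ x.2]
        refine Finset.sum_congr rfl fun k _ => ?_
        rw [DirectSum.decompose_of_mem_same (fun i => ⋀[S]^i N) (contr_mem_pow _ _ _ x.2)]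
      · rw [DirectSum.decompose_of_mem_ne (fun i => ⋀[S]^i N) x.2 (by omega), smul_zero]
        refine (Finset.sum_eq_zero fun k _ => ?_).symm
        rw [DirectSum.decompose_of_mem_ne (fun i => ⋀[S]^i N) (contr_mem_pow _ _ _ x.2) h, mul_zero]

/-- An element of the exterior algebra of a finitely generated projective module whose components
vanish on all families of functionals is zero. -/
theorem DualFrame.Expands.eq_zero_of_evalContr {b : DualFrame κ S N} (hb : b.Expands)
    {x : ExteriorAlgebra S N} (hx : ∀ (l : ℕ) (f : Fin l → Module.Dual S N), evalContr f x = 0) :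
    x = 0 := by
  have key : ∀ n : ℕ, ∀ x : ExteriorAlgebra S N,
      (∀ (l : ℕ) (f : Fin l → Module.Dual S N), evalContr f x = 0) →
      (DirectSum.decompose (fun i => ⋀[S]^i N) x n : ExteriorAlgebra S N) = 0 := by
    intro n
    induction n with
    | zero =>
      intro x hx
      have h0 : ExteriorAlgebra.algebraMapInv x = 0 := hx 0 Fin.elim0
      have h1 : ∀ y : ExteriorAlgebra S N,
          (DirectSum.decompose (fun i => ⋀[S]^i N) y 0 : ExteriorAlgebra S N) =
            algebraMap S _ (ExteriorAlgebra.algebraMapInv y) := by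
        intro y
        induction y using DirectSum.Decomposition.inductionOn (fun i => ⋀[S]^i N) with
        | zero => simp
        | add x y hx hy =>
          simp only [DirectSum.decompose_add, DirectSum.add_apply, Submodule.coe_add, hx, hy,
            map_add]
        | @homogeneous i x =>
          rcases i with _ | i
          · rw [DirectSum.decompose_of_mem_same (fun i => ⋀[S]^i N) x.2]
            have : (x : ExteriorAlgebra S N) ∈
                LinearMap.range (ExteriorAlgebra.ι S : N →ₗ[S] ExteriorAlgebra S N) ^ 0 := x.2
            rw [pow_zero] at this
            obtain ⟨s, hs⟩ := Submodule.mem_one.1 this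
            rw [← hs, ExteriorAlgebra.algebraMap_leftInverse]
          · rw [DirectSum.decompose_of_mem_ne (fun i => ⋀[S]^i N) x.2 (by omega)]
            have : (x : ExteriorAlgebra S N) ∈
                LinearMap.range (ExteriorAlgebra.ι S : N →ₗ[S] ExteriorAlgebra S N) ^ (i + 1) := x.2
            rw [pow_succ'] at this
            have h2 : ExteriorAlgebra.algebraMapInv (x : ExteriorAlgebra S N) = 0 := by
              generalize (x : ExteriorAlgebra S N) = x at this
              induction this using Submodule.mul_induction_on' with
              | mem_mul_mem a ha y hy =>
                obtain ⟨m, rfl⟩ := ha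
                rw [map_mul]
                simp [ExteriorAlgebra.algebraMapInv]
              | add x _ y _ hx hy => rw [map_add, hx, hy, add_zero]
            rw [h2, map_zero]
      rw [h1, h0, map_zero]
    | succ n ih =>
      intro x hx
      have h := decompose_contr_aux hb n x
      rw [Finset.sum_eq_zero fun k _ => by
        rw [ih _ fun l f => hx (l + 1) (Fin.cons (b.coord k) f), mul_zero]] at h
      -- `n + 1` is invertible in the real algebra `S`
      have hu : (algebraMap ℝ S ((n + 1 : ℝ)⁻¹)) * ((n + 1 : ℕ) : S) = 1 := by
        rw [← map_natCast (algebraMap ℝ S), ← map_mul]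
        rw [Nat.cast_succ, inv_mul_cancel₀ (by positivity), map_one]
      have := congrArg (fun z => algebraMap ℝ S ((n + 1 : ℝ)⁻¹) • z) h
      simpa only [smul_smul, hu, one_smul, smul_zero] using this
  classical
  rw [← DirectSum.sum_support_decompose (fun i => ⋀[S]^i N) x]
  exact Finset.sum_eq_zero fun n _ => key n x hx

/-- Linear functionals separate the elements of the exterior algebra, so that derivations with
values in it may be studied through scalar-valued ones. -/
theorem DualFrame.Expands.eq_of_forall_dual {b : DualFrame κ S N} (hb : b.Expands)
    {x y : ExteriorAlgebra S N} (h : ∀ f : Module.Dual S (ExteriorAlgebra S N), f x = f y) :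
    x = y :=
  sub_eq_zero.1 (hb.eq_zero_of_evalContr fun l f => by
    rw [map_sub, sub_eq_zero]; exact h (evalContr f))

end Contraction

/-! ### The de Rham differential -/

/-- The differential of a function. -/
def differential {S : Type*} [CommRing S] [Algebra ℝ S] (s : S) : OneForm S where
  toFun V := V s
  map_add' _ _ := rfl
  map_smul' _ _ := rfl

/-- Functions and vector fields that play the role of a global coordinate system:
`V = ∑ V(uₖ) Eₖ` for every vector field `V`. -/
structure VecFrame (κ S : Type*) [CommRing S] [Algebra ℝ S] where
  coord : κ → S
  field : κ → Vec S

section Forms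

variable {S : Type*} [CommRing S] [Algebra ℝ S] {κ : Type*} [Fintype κ]

@[simp] lemma differential_apply (s : S) (V : Vec S) : differential s V = V s := rfl

lemma differential_mul (s t : S) :
    differential (s * t) = s • differential t + t • differential s := by
  ext V
  simp

lemma differential_add (s t : S) : differential (s + t) = differential s + differential t := by
  ext V
  simp

lemma differential_algebraMap (c : ℝ) : differential (algebraMap ℝ S c) = 0 := by
  ext V
  simp

/-- The defining property of a global substitute for coordinates. -/
def VecFrame.Expands (F : VecFrame κ S) : Prop :=
  ∀ (V : Vec S) (s : S), V s = ∑ k, V (F.coord k) * F.field k s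

lemma VecFrame.Expands.sum_smul {F : VecFrame κ S} (hF : F.Expands) (V : Vec S) :
    ∑ k, V (F.coord k) • F.field k = V := by
  ext s
  rw [hF V s, ← Derivation.coeFnAddMonoidHom_apply, map_sum, Finset.sum_apply]
  rfl

/-- The dual basis of the module of 1-forms given by the differentials of the coordinates. -/
def VecFrame.formFrame (F : VecFrame κ S) : DualFrame κ S (OneForm S) where
  vec k := differential (F.coord k)
  coord k := Module.Dual.eval S (Vec S) (F.field k)

lemma VecFrame.Expands.formFrame {F : VecFrame κ S} (hF : F.Expands) : F.formFrame.Expands := by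
  intro α
  ext V
  conv_rhs => rw [← hF.sum_smul V, map_sum]
  rw [LinearMap.sum_apply]
  refine Finset.sum_congr rfl fun k _ => ?_
  rw [map_smul]
  exact mul_comm _ _

/-- Contraction of forms with a vector field. -/
abbrev ins (V : Vec S) : Forms S →ₗ[S] Forms S := contr (Module.Dual.eval S (Vec S) V)

lemma evalForm_zero (V : Fin 0 → Vec S) (α : Forms S) :
    evalForm V α = ExteriorAlgebra.algebraMapInv α := rfl

lemma evalForm_succ {l : ℕ} (V : Fin (l + 1) → Vec S) (α : Forms S) :
    evalForm V α = evalForm (Fin.tail V) (ins (V 0) α) := rfl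

/-- The de Rham differential, characterised by its values on functions and exact 1-forms. -/
structure IsDeRham (d : SuperVec S (OneForm S) 1) : Prop where
  apply_fn : ∀ s, d.1 (algebraMap S _ s) = ExteriorAlgebra.ι S (differential s)
  apply_exact : ∀ s, d.1 (ExteriorAlgebra.ι S (differential s)) = 0

/-- A double sum of anticommuting products only sees the antisymmetric part of the
coefficients. -/
lemma two_smul_sum_mul_swap {B : Type*} [Ring B] [Algebra S B] (x : κ → B)
    (hx : ∀ a b, x a * x b = -(x b * x a)) (c : κ → κ → S) :
    (2 : S) • ∑ a, ∑ b, c a b • (x a * x b) = ∑ a, ∑ b, (c a b - c b a) • (x a * x b) := by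
  have h : ∑ a, ∑ b, c b a • (x a * x b) = -∑ a, ∑ b, c a b • (x a * x b) := by
    rw [Finset.sum_comm, ← Finset.sum_neg_distrib]
    refine Finset.sum_congr rfl fun a _ => ?_
    rw [← Finset.sum_neg_distrib]
    refine Finset.sum_congr rfl fun b _ => ?_
    rw [hx b a, smul_neg]
  simp only [sub_smul, Finset.sum_sub_distrib, h, two_smul, sub_neg_eq_add]

lemma ι_mul_ι_swap {N : Type*} [AddCommGroup N] [Module S N] (m n : N) :
    ExteriorAlgebra.ι S m * ExteriorAlgebra.ι S n =
      -(ExteriorAlgebra.ι S n * ExteriorAlgebra.ι S m) :=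
  eq_neg_of_add_eq_zero_left (ExteriorAlgebra.ι_add_mul_swap _ _)

/-- On 1-forms the differential is the antisymmetrized derivative of the coordinates of the form,
corrected by the torsion `[E_a, E_b](u_c)` of the connection for which the `E_a` are parallel. -/
theorem VecFrame.Expands.exists_isDeRham {F : VecFrame κ S} (hF : F.Expands) :
    ∃ d : SuperVec S (OneForm S) 1, IsDeRham d := by
  let x : κ → Forms S := fun k => ExteriorAlgebra.ι S (differential (F.coord k))
  have hx : ∀ a b, x a * x b = -(x b * x a) := fun a b => ι_mul_ι_swap _ _
  let δ : S → Forms S := fun s => ExteriorAlgebra.ι S (differential s)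
  have hδm : ∀ s t, δ (s * t) = δ s * algebraMap S _ t + algebraMap S _ s * δ t := fun s t => by
    change ExteriorAlgebra.ι S _ = _
    rw [differential_mul, map_add, map_smul, map_smul, ← Algebra.commutes, ← Algebra.smul_def,
      ← Algebra.smul_def, add_comm]
  have hδa : ∀ s t, δ (s + t) = δ s + δ t := fun s t => by
    change ExteriorAlgebra.ι S _ = _
    rw [differential_add, map_add]
  have hδx : ∀ s, δ s = ∑ k, F.field k s • x k := fun s => by
    change ExteriorAlgebra.ι S _ = _
    rw [← hF.formFrame (differential s), map_sum]
    exact Finset.sum_congr rfl fun k _ => map_smul _ _ _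
  let τ : OneForm S → Forms S := fun α =>
    ∑ a, ∑ b, (∑ c, α (F.field c) * ⁅F.field a, F.field b⁆ (F.coord c)) • (x a * x b)
  let h2 : ℝ := 1 / 2
  let η : OneForm S → Forms S := fun α => ∑ b, δ (α (F.field b)) * x b - h2 • τ α
  have hτa : ∀ α β, τ (α + β) = τ α + τ β := fun α β => by
    simp only [τ, LinearMap.add_apply, add_mul, Finset.sum_add_distrib, add_smul]
  have hτm : ∀ (s : S) α, τ (s • α) = s • τ α := fun s α => by
    simp only [τ, LinearMap.smul_apply, smul_eq_mul, mul_assoc, ← Finset.mul_sum,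
      mul_smul, ← Finset.smul_sum]
  have hp2 : ∀ m n : OneForm S, ExteriorAlgebra.ι S m * ExteriorAlgebra.ι S n ∈
      parityPart S (OneForm S) (1 + 1) := fun m n =>
    mul_mem_parityPart (ι_mem_parityPart m) (ι_mem_parityPart n)
  obtain ⟨d, hd0, hd1⟩ := exists_superDer (j := RingHom.id (Forms S)) 1 (fun _ => rfl)
    (fun _ => rfl) δ η (fun s => ι_mem_parityPart _)
    (fun α => by
      refine sub_mem (sum_mem fun b _ => hp2 _ _) (smul_mem_parityPart _ ?_)
      exact sum_mem fun a _ => sum_mem fun b _ => Submodule.smul_mem _ _ (hp2 _ _))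
    (fun c => by
      change ExteriorAlgebra.ι S _ = 0
      rw [differential_algebraMap, map_zero]) hδa hδm
    (fun α β => by
      simp only [η, LinearMap.add_apply, hδa, add_mul, Finset.sum_add_distrib, hτa, smul_add]
      abel)
    (fun s α => by
      have h1 : ∑ b, α (F.field b) • x b = ExteriorAlgebra.ι S α := by
        conv_rhs => rw [← hF.formFrame α, map_sum]
        exact Finset.sum_congr rfl fun k _ => (map_smul _ _ _).symm
      simp only [η, LinearMap.smul_apply, smul_eq_mul, hδm, hτm, add_mul, mul_assoc,
        ← Algebra.smul_def, Finset.sum_add_distrib, ← Finset.mul_sum,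
        RingHom.id_apply, h1, smul_sub]
      rw [smul_comm h2 s]
      simp only [smul_mul_assoc, ← Finset.smul_sum]
      abel)
  refine ⟨d, hd0, fun s => ?_⟩
  rw [hd1]
  have h1 : ∑ b, δ (F.field b s) * x b =
      ∑ a, ∑ b, (F.field a (F.field b s)) • (x a * x b) := by
    rw [Finset.sum_comm]
    refine Finset.sum_congr rfl fun b _ => ?_
    rw [hδx, Finset.sum_mul]
    exact Finset.sum_congr rfl fun a _ => smul_mul_assoc _ _ _
  have h3 : (2 : S) • ∑ b, δ (F.field b s) * x b = τ (differential s) := by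
    rw [h1, two_smul_sum_mul_swap x hx]
    refine Finset.sum_congr rfl fun a _ => Finset.sum_congr rfl fun b _ => ?_
    congr 1
    have := hF ⁅F.field a, F.field b⁆ s
    rw [Derivation.commutator_apply] at this
    rw [this]
    exact Finset.sum_congr rfl fun k _ => mul_comm _ _
  change ∑ b, δ (F.field b s) * x b - h2 • τ (differential s) = 0
  have h4 : (2 : S) = algebraMap ℝ S 2 := (map_ofNat (algebraMap ℝ S) 2).symm
  rw [← h3, h4, algebraMap_smul, smul_smul]
  norm_num [h2]

/-! ### Cartan's formula and the invariant formula for the differential -/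

/-- The algebra of forms is generated by functions and their differentials. -/
lemma VecFrame.Expands.forms_induction {F : VecFrame κ S} (hF : F.Expands) {P : Forms S → Prop}
    (fn : ∀ s, P (algebraMap S _ s)) (exact : ∀ s, P (ExteriorAlgebra.ι S (differential s)))
    (mul : ∀ a b, P a → P b → P (a * b)) (add : ∀ a b, P a → P b → P (a + b)) (α : Forms S) :
    P α := by
  induction α using ExteriorAlgebra.induction with
  | algebraMap r => exact fn r
  | ι m =>
    rw [← hF.formFrame m, map_sum]
    refine Finset.sum_induction _ P add (by simpa using fn 0) fun k _ => ?_
    rw [map_smul, Algebra.smul_def]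
    exact mul _ _ (fn _) (exact _)
  | mul a b ha hb => exact mul a b ha hb
  | add a b ha hb => exact add a b ha hb

/-- The Lie derivative, by Cartan's formula. -/
def lieD (d : SuperVec S (OneForm S) 1) (V : Vec S) (α : Forms S) : Forms S :=
  d.1 (ins V α) + ins V (d.1 α)

variable {d : SuperVec S (OneForm S) 1} {F : VecFrame κ S}

lemma lieD_add (V : Vec S) (α β : Forms S) : lieD d V (α + β) = lieD d V α + lieD d V β := by
  simp only [lieD, map_add]
  abel

lemma lieD_fn (hd : IsDeRham d) (V : Vec S) (s : S) :
    lieD d V (algebraMap S _ s) = algebraMap S _ (V s) := by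
  rw [lieD, contr_algebraMap, map_zero, zero_add, hd.apply_fn, contr_ι]
  rfl

lemma lieD_exact (hd : IsDeRham d) (V : Vec S) (s : S) :
    lieD d V (ExteriorAlgebra.ι S (differential s)) =
      ExteriorAlgebra.ι S (differential (V s)) := by
  rw [lieD, hd.apply_exact, map_zero, add_zero, contr_ι]
  exact hd.apply_fn _

lemma lieD_mul (V : Vec S) (α β : Forms S) :
    lieD d V (α * β) = lieD d V α * β + α * lieD d V β := by
  have h1 : ∀ α β, d.1 (α * β) = d.1 α * β + sgn S (OneForm S) 1 α * d.1 β := d.leibniz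
  have h2 : ∀ α, sgn S (OneForm S) 1 (d.1 α) = -d.1 (sgn S (OneForm S) 1 α) := fun α => by
    rw [d.sgn_apply, parSign_one, neg_one_smul]
  have h3 : ∀ α, sgn S (OneForm S) 1 (ins V α) = -ins V (sgn S (OneForm S) 1 α) := fun α => by
    rw [contr_sgn, neg_neg]
  have h4 : (1 + 1 : ZMod 2) = 0 := rfl
  simp only [lieD, contr_mul, h1, map_add, h2, h3, sgn_sgn, h4, sgn_zero_apply]
  noncomm_ring

lemma lieD_ins (hF : F.Expands) (hd : IsDeRham d) (V W : Vec S) (α : Forms S) :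
    lieD d V (ins W α) = ins W (lieD d V α) + ins ⁅V, W⁆ α := by
  induction α using hF.forms_induction with
  | fn s =>
    simp only [lieD_fn hd, contr_algebraMap]
    simp [lieD]
  | exact s =>
    rw [lieD_exact hd, contr_ι, contr_ι, contr_ι]
    refine (lieD_fn hd _ _).trans ?_
    rw [← map_add]
    congr 1
    simp [Derivation.commutator_apply]
  | mul a b ha hb =>
    have h : ∀ α, lieD d V (sgn S (OneForm S) 1 α) = sgn S (OneForm S) 1 (lieD d V α) := by
      intro α
      have h2 : ∀ α, d.1 (sgn S (OneForm S) 1 α) = -sgn S (OneForm S) 1 (d.1 α) := fun α => by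
        rw [d.sgn_apply, parSign_one, neg_one_smul, neg_neg]
      simp only [lieD, map_add, h2, contr_sgn, map_neg, neg_neg]
    rw [contr_mul, lieD_add, lieD_mul, lieD_mul, lieD_mul, map_add, contr_mul, contr_mul,
      contr_mul, h, ha, hb]
    noncomm_ring
  | add a b ha hb =>
    simp only [map_add, lieD_add, ha, hb]
    abel

lemma algebraMapInv_d (hd : IsDeRham d) (hF : F.Expands) (α : Forms S) :
    ExteriorAlgebra.algebraMapInv (d.1 α) = 0 := by
  have hι : ∀ n : OneForm S, ExteriorAlgebra.algebraMapInv (ExteriorAlgebra.ι S n) = 0 :=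
    fun n => by simp [ExteriorAlgebra.algebraMapInv]
  have h1 : ∀ α β, d.1 (α * β) = d.1 α * β + sgn S (OneForm S) 1 α * d.1 β := d.leibniz
  induction α using hF.forms_induction with
  | fn s => rw [hd.apply_fn, hι]
  | exact s => rw [hd.apply_exact, map_zero]
  | mul a b ha hb => rw [h1, map_add, map_mul, map_mul, ha, hb, zero_mul, mul_zero, add_zero]
  | add a b ha hb => rw [map_add, map_add, ha, hb, add_zero]

lemma algebraMapInv_lieD (hd : IsDeRham d) (hF : F.Expands) (V : Vec S) (α : Forms S) :
    ExteriorAlgebra.algebraMapInv (lieD d V α) = V (ExteriorAlgebra.algebraMapInv α) := by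
  have hι : ∀ n : OneForm S, ExteriorAlgebra.algebraMapInv (ExteriorAlgebra.ι S n) = 0 :=
    fun n => by simp [ExteriorAlgebra.algebraMapInv]
  induction α using hF.forms_induction with
  | fn s =>
    rw [lieD_fn hd, ExteriorAlgebra.algebraMap_leftInverse, ExteriorAlgebra.algebraMap_leftInverse]
  | exact s => rw [lieD_exact hd, hι, hι, map_zero]
  | mul a b ha hb =>
    rw [lieD_mul, map_add, map_mul, map_mul, map_mul, ha, hb, Derivation.leibniz, smul_eq_mul,
      smul_eq_mul]
    ring
  | add a b ha hb => rw [lieD_add, map_add, map_add, map_add, ha, hb]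

lemma evalForm_lieD (hd : IsDeRham d) (hF : F.Expands) (V : Vec S) :
    ∀ {l : ℕ} (W : Fin l → Vec S) (α : Forms S),
      evalForm W (lieD d V α) =
        V (evalForm W α) - ∑ k, evalForm (Function.update W k ⁅V, W k⁆) α := by
  intro l
  induction l with
  | zero =>
    intro W α
    simp only [evalForm_zero, Finset.univ_eq_empty, Finset.sum_empty, sub_zero]
    exact algebraMapInv_lieD hd hF V α
  | succ l ih =>
    intro W α
    have h : ins (W 0) (lieD d V α) = lieD d V (ins (W 0) α) - ins ⁅V, W 0⁆ α := by
      rw [lieD_ins hF hd, add_sub_cancel_right]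
    rw [evalForm_succ, h, map_sub, ih, Fin.sum_univ_succ, evalForm_succ W]
    have h0 : evalForm (Function.update W 0 ⁅V, W 0⁆) α
        = evalForm (Fin.tail W) (ins ⁅V, W 0⁆ α) := by
      rw [evalForm_succ, Function.update_self, Fin.tail_update_zero]
    have h1 : ∀ k : Fin l, evalForm (Function.update W k.succ ⁅V, W k.succ⁆) α =
        evalForm (Function.update (Fin.tail W) k ⁅V, Fin.tail W k⁆) (ins (W 0) α) := fun k => by
      rw [evalForm_succ, Fin.tail_update_succ, Function.update_of_ne (Fin.succ_ne_zero k).symm]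
      rfl
    rw [h0, Finset.sum_congr rfl fun k _ => h1 k]
    ring

lemma evalForm_update :
    ∀ {l : ℕ} (W : Fin (l + 1) → Vec S) (k : Fin (l + 1)) (Z : Vec S) (α : Forms S),
      evalForm (Function.update W k Z) α =
        (-1 : ℝ) ^ (k : ℕ) • evalForm (Matrix.vecCons Z (k.removeNth W)) α := by
  intro l
  induction l with
  | zero =>
    intro W k Z α
    obtain rfl : k = 0 := Fin.fin_one_eq_zero k
    rw [Fin.val_zero, pow_zero, one_smul, evalForm_succ, evalForm_succ, Function.update_self]
    rfl
  | succ l ih =>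
    intro W k Z α
    induction k using Fin.cases with
    | zero =>
      rw [Fin.val_zero, pow_zero, one_smul, evalForm_succ, evalForm_succ, Function.update_self,
        Fin.tail_update_zero]
      rfl
    | succ k =>
      rw [evalForm_succ, Fin.tail_update_succ, Function.update_of_ne (Fin.succ_ne_zero k).symm, ih,
        evalForm_succ, evalForm_succ (Matrix.vecCons _ _)]
      have h : Fin.tail (Matrix.vecCons Z (k.succ.removeNth W)) =
          Matrix.vecCons (W 0) (k.removeNth (Fin.tail W)) := by
        funext i
        induction i using Fin.cases with
        | zero => rfl
        | succ i => simp [Fin.tail, Fin.removeNth, Matrix.vecCons]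
      rw [h, evalForm_succ (Matrix.vecCons _ _), Fin.val_succ, pow_succ, mul_neg_one, neg_smul,
        ← smul_neg]
      change _ • evalForm (k.removeNth (Fin.tail W)) (ins Z (ins (W 0) α)) =
        _ • -evalForm (k.removeNth (Fin.tail W)) (ins (W 0) (ins Z α))
      rw [contr_comm, map_neg]

end Forms

section Forms

variable {S : Type*} [CommRing S] [Algebra ℝ S] {κ : Type*} [Fintype κ]
  {d : SuperVec S (OneForm S) 1} {F : VecFrame κ S}

/-- The part of the invariant formula for the differential in which a vector field
differentiates a value. -/
def evalDer {l : ℕ} (V : Fin (l + 1) → Vec S) (α : Forms S) : S :=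
  ∑ i : Fin (l + 1), (-1 : ℝ) ^ (i : ℕ) • V i (evalForm (i.removeNth V) α)

/-- The part of the invariant formula for the differential that involves brackets. -/
def evalBracket : {l : ℕ} → (Fin (l + 1) → Vec S) → Forms S → S
  | 0, _, _ => 0
  | l + 1, V, α => ∑ i : Fin (l + 1), ∑ j ∈ Finset.Ici i, (-1 : ℝ) ^ (i + j : ℕ) •
      evalForm (Matrix.vecCons ⁅V i.castSucc, V j.succ⁆
        (j.removeNth (i.castSucc.removeNth V))) α

lemma evalD_eq {l : ℕ} (V : Fin (l + 1) → Vec S) (α : Forms S) :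
    evalD l V α = evalDer V α - evalBracket V α := by
  cases l with
  | zero =>
    rw [evalDer, evalBracket, sub_zero, Fin.sum_univ_one, Fin.val_zero, pow_zero, one_smul]
    rfl
  | succ l =>
    simp only [evalD, LinearMap.sub_apply, LinearMap.sum_apply, LinearMap.smul_apply]
    rfl

lemma removeNth_succ_eq {l : ℕ} {B : Type*} (V : Fin (l + 2) → B) (k : Fin (l + 1)) :
    k.succ.removeNth V = (Fin.cons (V 0) (k.removeNth (Fin.tail V)) : Fin (l + 1) → B) := by
  funext i
  induction i using Fin.cases with
  | zero => rfl
  | succ i => simp [Fin.tail, Fin.removeNth]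

lemma evalForm_cons {l : ℕ} (Z : Vec S) (V : Fin l → Vec S) (α : Forms S) :
    evalForm (Fin.cons Z V : Fin (l + 1) → Vec S) α = evalForm V (ins Z α) := rfl

lemma evalForm_vecCons {l : ℕ} (Z : Vec S) (V : Fin l → Vec S) (α : Forms S) :
    evalForm (Matrix.vecCons Z V) α = evalForm V (ins Z α) := rfl

lemma evalDer_succ {l : ℕ} (V : Fin (l + 2) → Vec S) (α : Forms S) :
    evalDer V α = V 0 (evalForm (Fin.tail V) α) - evalDer (Fin.tail V) (ins (V 0) α) := by
  rw [evalDer, Fin.sum_univ_succ, Fin.val_zero, pow_zero, one_smul, evalDer, sub_eq_add_neg,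
    ← Finset.sum_neg_distrib]
  refine congrArg₂ (· + ·) rfl (Finset.sum_congr rfl fun k _ => ?_)
  rw [removeNth_succ_eq, evalForm_cons, Fin.val_succ, pow_succ, mul_neg_one, neg_smul]
  rfl

lemma sum_Ici_succ {l : ℕ} (i : Fin l) (f : Fin (l + 1) → S) :
    ∑ j ∈ Finset.Ici i.succ, f j = ∑ j ∈ Finset.Ici i, f j.succ := by
  rw [← Finset.filter_le_eq_Ici, ← Finset.filter_le_eq_Ici, Finset.sum_filter, Finset.sum_filter,
    Fin.sum_univ_succ, if_neg (by simp), zero_add]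
  exact Finset.sum_congr rfl fun j _ => by simp only [Fin.succ_le_succ_iff]

lemma evalBracket_succ {l : ℕ} (V : Fin (l + 2) → Vec S) (α : Forms S) :
    evalBracket V α =
      ∑ k, evalForm (Function.update (Fin.tail V) k ⁅V 0, Fin.tail V k⁆) α
        - evalBracket (Fin.tail V) (ins (V 0) α) := by
  rw [evalBracket, Fin.sum_univ_succ, sub_eq_add_neg]
  refine congrArg₂ (· + ·) ?_ ?_
  · have : Finset.Ici (0 : Fin (l + 1)) = Finset.univ := by
      ext; simp
    rw [this]
    refine Finset.sum_congr rfl fun k _ => ?_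
    rw [evalForm_update, Fin.val_zero, zero_add]
    rfl
  · cases l with
    | zero => simp [evalBracket]
    | succ l =>
      rw [evalBracket, ← Finset.sum_neg_distrib]
      refine Finset.sum_congr rfl fun i _ => ?_
      rw [sum_Ici_succ, ← Finset.sum_neg_distrib]
      refine Finset.sum_congr rfl fun j _ => ?_
      have h : i.succ.castSucc.removeNth V =
          (Fin.cons (V 0) (i.castSucc.removeNth (Fin.tail V)) : Fin (l + 2) → Vec S) :=
        removeNth_succ_eq V i.castSucc
      have hs : ((i.succ : Fin (l + 2)) : ℕ) + ((j.succ : Fin (l + 2)) : ℕ) =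
          (i : ℕ) + (j : ℕ) + 2 := by
        simp only [Fin.val_succ]; omega
      rw [h, removeNth_succ_eq, Fin.cons_zero, Fin.tail_cons, hs, pow_add, neg_one_sq, mul_one,
        ← smul_neg, evalForm_vecCons, evalForm_vecCons, evalForm_cons, contr_comm, map_neg]
      rfl

/-- The invariant formula computes the values of the exterior derivative. -/
theorem evalForm_d (hF : F.Expands) (hd : IsDeRham d) :
    ∀ {l : ℕ} (V : Fin (l + 1) → Vec S) (α : Forms S), evalForm V (d.1 α) = evalD l V α := by
  have cartan : ∀ (V : Vec S) (α : Forms S), ins V (d.1 α) = lieD d V α - d.1 (ins V α) :=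
    fun V α => by rw [lieD, add_sub_cancel_left]
  intro l
  induction l with
  | zero =>
    intro V α
    rw [evalForm_succ, cartan, map_sub, evalForm_zero, evalForm_zero, algebraMapInv_d hd hF,
      sub_zero, algebraMapInv_lieD hd hF]
    rfl
  | succ l ih =>
    intro V α
    rw [evalForm_succ, cartan, map_sub, ih, evalForm_lieD hd hF, evalD_eq, evalD_eq, evalDer_succ,
      evalBracket_succ]
    ring

lemma evalForm_eq_evalContr : ∀ {l : ℕ} (V : Fin l → Vec S) (α : Forms S),
    evalForm V α = evalContr (fun k => Module.Dual.eval S (Vec S) (V k)) α := by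
  intro l
  induction l with
  | zero => intro V α; rfl
  | succ l ih => intro V α; rw [evalForm_succ, ih]; rfl

/-- The module of vector fields is reflexive. -/
lemma VecFrame.Expands.exists_eval_eq (hF : F.Expands) (f : Module.Dual S (OneForm S)) :
    ∃ V : Vec S, Module.Dual.eval S (Vec S) V = f := by
  refine ⟨∑ k, f (differential (F.coord k)) • F.field k, ?_⟩
  ext α
  conv_rhs => rw [← hF.formFrame α, map_sum]
  rw [Module.Dual.eval_apply, map_sum]
  refine Finset.sum_congr rfl fun k _ => ?_
  rw [map_smul, map_smul, smul_eq_mul, smul_eq_mul, mul_comm]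
  rfl

/-- Closedness, which is defined by the invariant formula, means `d α = 0`. -/
theorem mem_closedForms_iff (hF : F.Expands) (hd : IsDeRham d) {q : ZMod 2} {α : Forms S} :
    α ∈ closedForms S q ↔ α ∈ parityPart S (OneForm S) q ∧ d.1 α = 0 := by
  rw [closedForms, Submodule.mem_inf]
  refine and_congr Iff.rfl ?_
  simp only [Submodule.mem_iInf, LinearMap.mem_ker]
  constructor
  · intro h
    refine hF.formFrame.eq_zero_of_evalContr fun l f => ?_
    choose V hV using fun k => hF.exists_eval_eq (f k)
    have hf : evalContr f (d.1 α) = evalForm V (d.1 α) := by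
      rw [evalForm_eq_evalContr]
      simp only [hV]
    rw [hf]
    cases l with
    | zero => exact algebraMapInv_d hd hF α
    | succ l => rw [evalForm_d hF hd, h]
  · intro h l V
    rw [← evalForm_d hF hd, h, map_zero]

end Forms

/-! ### Exterior algebras of isomorphic modules -/

section Transport

variable {S N N' : Type*} [CommRing S] [Algebra ℝ S] [AddCommGroup N] [Module S N] [Module ℝ N]
  [IsScalarTower ℝ S N] [AddCommGroup N'] [Module S N'] [Module ℝ N'] [IsScalarTower ℝ S N']

lemma map_sgn (f : N →ₗ[S] N') (a : ExteriorAlgebra S N) :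
    ExteriorAlgebra.map f (sgn S N 1 a) = sgn S N' 1 (ExteriorAlgebra.map f a) := by
  induction a using ExteriorAlgebra.induction with
  | algebraMap r => rw [sgn_algebraMap, AlgHom.commutes, sgn_algebraMap]
  | ι m =>
    rw [sgn_ι, ExteriorAlgebra.map_apply_ι, sgn_ι, parSign_one, neg_one_smul, neg_one_smul,
      map_neg, ExteriorAlgebra.map_apply_ι]
  | mul a b ha hb => simp only [map_mul, ha, hb]
  | add a b ha hb => simp only [map_add, ha, hb]

lemma map_smul_real (f : N →ₗ[S] N') (c : ℝ) (a : ExteriorAlgebra S N) :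
    ExteriorAlgebra.map f (c • a) = c • ExteriorAlgebra.map f a := by
  rw [← algebraMap_smul S c a, map_smul, algebraMap_smul]

lemma map_mem_parityPart (f : N →ₗ[S] N') {i : ZMod 2} {a : ExteriorAlgebra S N}
    (ha : a ∈ parityPart S N i) : ExteriorAlgebra.map f a ∈ parityPart S N' i := by
  rw [mem_parityPart_iff] at ha ⊢
  rw [← map_sgn, ha, map_smul_real]

lemma map_symm_map (Φ : N ≃ₗ[S] N') (a : ExteriorAlgebra S N) :
    ExteriorAlgebra.map (Φ.symm : N' →ₗ[S] N) (ExteriorAlgebra.map (Φ : N →ₗ[S] N') a) = a := by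
  rw [← AlgHom.comp_apply, ExteriorAlgebra.map_comp_map]
  simp

lemma map_map_symm (Φ : N ≃ₗ[S] N') (a : ExteriorAlgebra S N') :
    ExteriorAlgebra.map (Φ : N →ₗ[S] N') (ExteriorAlgebra.map (Φ.symm : N' →ₗ[S] N) a) = a :=
  map_symm_map Φ.symm a

/-- Odd vector fields may be transported along an isomorphism of modules. -/
lemma exists_transport (Φ : N ≃ₗ[S] N') (d : SuperVec S N' 1) :
    ∃ d' : SuperVec S N 1, ∀ a, ExteriorAlgebra.map (Φ : N →ₗ[S] N') (d'.1 a) =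
      d.1 (ExteriorAlgebra.map (Φ : N →ₗ[S] N') a) := by
  let g : ExteriorAlgebra S N → ExteriorAlgebra S N := fun a =>
    ExteriorAlgebra.map (Φ.symm : N' →ₗ[S] N) (d.1 (ExteriorAlgebra.map (Φ : N →ₗ[S] N') a))
  have h1 : ∀ a b, d.1 (a * b) = d.1 a * b + sgn S N' 1 a * d.1 b := d.leibniz
  refine ⟨⟨{ toFun := g, map_add' := fun a b => ?_, map_smul' := fun c a => ?_ },
    fun i a ha => map_mem_parityPart _ (d.mem (map_mem_parityPart _ ha)), fun a b => ?_⟩,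
    fun a => map_map_symm Φ _⟩
  · simp only [g, map_add]
  · simp only [g]
    rw [map_smul_real, map_smul, map_smul_real]
    rfl
  · change g (a * b) = g a * b + sgn S N 1 a * g b
    simp only [g]
    rw [map_mul, h1, map_add, map_mul, map_mul, ← map_sgn, map_symm_map, map_symm_map]

end Transport

/-! ### Functions on the ambient supermanifold -/

section Ambient

variable {R S : Type*} [CommRing R] [Algebra ℝ R] [CommRing S] [Algebra ℝ S] {φ : R →ₐ[ℝ] S}

lemma normalPart_eq_mk (D : Vec R) :
    normalPart φ D = Submodule.Quotient.mk (restrictField φ D) := rfl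

lemma restrictField_apply (D : Vec R) (f : R) : restrictField φ D f = φ (D f) := rfl

lemma extMap_algebraMap {M N : Type*} [AddCommGroup M] [Module R M] [Module ℝ M]
    [IsScalarTower ℝ R M] [AddCommGroup N] [Module S N] [Module ℝ N] [IsScalarTower ℝ S N]
    {φ : R →+* S} (l : M →ₛₗ[φ] N) (r : R) :
    extMap l (algebraMap R _ r) = algebraMap S _ (φ r) := by
  let _ : Algebra R (ExteriorAlgebra S N) :=
    ((algebraMap S (ExteriorAlgebra S N)).comp φ).toAlgebra'
      fun c x => Algebra.commutes (φ c) x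
  exact AlgHom.commutes (ExteriorAlgebra.lift R _) r

lemma extMap_ι {M N : Type*} [AddCommGroup M] [Module R M] [Module ℝ M]
    [IsScalarTower ℝ R M] [AddCommGroup N] [Module S N] [Module ℝ N] [IsScalarTower ℝ S N]
    {φ : R →+* S} (l : M →ₛₗ[φ] N) (m : M) :
    extMap l (ExteriorAlgebra.ι R m) = ExteriorAlgebra.ι S (l m) := by
  let _ : Algebra R (ExteriorAlgebra S N) :=
    ((algebraMap S (ExteriorAlgebra S N)).comp φ).toAlgebra'
      fun c x => Algebra.commutes (φ c) x
  exact ExteriorAlgebra.lift_ι_apply R _ _ m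

@[simp] lemma incl_algebraMap (f : R) :
    incl φ (algebraMap R _ f) = algebraMap S _ (φ f) := extMap_algebraMap _ f

lemma incl_fn (f : R) : incl φ (fn f) = algebraMap S _ (φ f) := extMap_algebraMap _ f

@[simp] lemma incl_ι (v : Vec R × R) :
    incl φ (ExteriorAlgebra.ι R v) = ExteriorAlgebra.ι S (normalPart φ v.1) := extMap_ι _ v

lemma incl_psi (v : Vec R) : incl φ (psi v) = ExteriorAlgebra.ι S (normalPart φ v) := incl_ι _

lemma incl_eps : incl φ (eps R) = 0 := by
  rw [eps, incl_ι, map_zero, map_zero]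

lemma incl_sgn (a : Ambient R) :
    incl φ (sgn R (Vec R × R) 1 a) = sgn S (Normal φ) 1 (incl φ a) := by
  induction a using ExteriorAlgebra.induction with
  | algebraMap r => rw [sgn_algebraMap, incl_algebraMap, sgn_algebraMap]
  | ι m => rw [sgn_ι, incl_ι, sgn_ι, parSign_one, neg_one_smul, neg_one_smul, map_neg, incl_ι]
  | mul a b ha hb => simp only [map_mul, ha, hb]
  | add a b ha hb => simp only [map_add, ha, hb]

lemma psi_add (v v' : Vec R) : psi (v + v') = psi v + psi v' := by
  rw [psi, psi, psi, ← map_add, Prod.mk_add_mk, add_zero]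

lemma psi_smul (r : R) (v : Vec R) : psi (r • v) = fn r * psi v := by
  rw [psi, psi, fn, ← Algebra.smul_def, ← map_smul, Prod.smul_mk, smul_zero]

lemma psi_zero : psi (0 : Vec R) = 0 := by
  rw [psi, Prod.mk_zero_zero, map_zero]

lemma psi_sum {ι : Type*} (s : Finset ι) (v : ι → Vec R) :
    psi (∑ a ∈ s, v a) = ∑ a ∈ s, psi (v a) := by
  classical
  induction s using Finset.induction_on with
  | empty => simp [psi_zero]
  | insert a s ha ih => rw [Finset.sum_insert ha, Finset.sum_insert ha, psi_add, ih]

lemma psi_mem (v : Vec R) : psi v ∈ parityPart R (Vec R × R) 1 := ι_mem_parityPart _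

lemma eps_mem : eps R ∈ parityPart R (Vec R × R) 1 := ι_mem_parityPart _

lemma fn_mem (f : R) : fn f ∈ parityPart R (Vec R × R) 0 := algebraMap_mem_parityPart _

lemma ι_eq_psi_add_eps (v : Vec R × R) :
    ExteriorAlgebra.ι R v = psi v.1 + fn v.2 * eps R := by
  rw [psi, fn, eps, ← Algebra.smul_def, ← map_smul, ← map_add]
  congr 1
  ext <;> simp

variable {p : ZMod 2}

lemma der_fn_mul (D : SuperDer (incl φ) p) (f g : R) :
    D.1 (fn (f * g)) = φ g • D.1 (fn f) + φ f • D.1 (fn g) := by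
  rw [fn, map_mul, D.leibniz, incl_algebraMap, incl_algebraMap, sgn_algebraMap,
    ← Algebra.commutes, ← Algebra.smul_def, ← Algebra.smul_def]
  rfl

lemma der_fn_add (D : SuperDer (incl φ) p) (f g : R) :
    D.1 (fn (f + g)) = D.1 (fn f) + D.1 (fn g) := by
  rw [fn, map_add, map_add]; rfl

lemma der_one {R M S N : Type*} [CommRing R] [Algebra ℝ R] [AddCommGroup M] [Module R M]
    [Module ℝ M] [IsScalarTower ℝ R M] [CommRing S] [Algebra ℝ S] [AddCommGroup N] [Module S N]
    [Module ℝ N] [IsScalarTower ℝ S N] {j : ExteriorAlgebra R M →+* ExteriorAlgebra S N}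
    {p : ZMod 2} (D : SuperDer j p) : D.1 1 = 0 := by
  have h := D.leibniz 1 1
  simpa using h

lemma der_const {R M S N : Type*} [CommRing R] [Algebra ℝ R] [AddCommGroup M] [Module R M]
    [Module ℝ M] [IsScalarTower ℝ R M] [CommRing S] [Algebra ℝ S] [AddCommGroup N] [Module S N]
    [Module ℝ N] [IsScalarTower ℝ S N] {j : ExteriorAlgebra R M →+* ExteriorAlgebra S N}
    {p : ZMod 2} (D : SuperDer j p) (c : ℝ) :
    D.1 (algebraMap R _ (algebraMap ℝ R c)) = 0 := by
  have h : algebraMap R (ExteriorAlgebra R M) (algebraMap ℝ R c) = c • 1 := by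
    rw [← algebraMap_smul R c, Algebra.smul_def, mul_one]
  rw [h, map_smul, der_one, smul_zero]

lemma der_psi_smul (D : SuperDer (incl φ) p) (r : R) (v : Vec R) :
    D.1 (psi (r • v)) =
      D.1 (fn r) * ExteriorAlgebra.ι S (normalPart φ v) + φ r • D.1 (psi v) := by
  rw [psi_smul, D.leibniz, incl_psi, incl_fn, sgn_algebraMap, ← Algebra.smul_def]

lemma der_psi_add (D : SuperDer (incl φ) p) (v v' : Vec R) :
    D.1 (psi (v + v')) = D.1 (psi v) + D.1 (psi v') := by
  rw [psi_add, map_add]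

lemma der_psi_sum (D : SuperDer (incl φ) p) {ι : Type*} (s : Finset ι) (v : ι → Vec R) :
    D.1 (psi (∑ a ∈ s, v a)) = ∑ a ∈ s, D.1 (psi (v a)) := by
  rw [psi_sum, map_sum]

/-- The restriction of a vector field on an exterior algebra to the scalars, as a derivation. -/
def SuperDer.onScalars {N : Type*} [AddCommGroup N] [Module S N] [Module ℝ N]
    [IsScalarTower ℝ S N] {q : ZMod 2} (V : SuperVec S N q) :
    Derivation ℝ S (ExteriorAlgebra S N) :=
  Derivation.mk' (V.1 ∘ₗ (Algebra.ofId S (ExteriorAlgebra S N)).toLinearMap.restrictScalars ℝ) (by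
    intro s t
    change V.1 (algebraMap S _ (s * t)) = s • V.1 (algebraMap S _ t) + t • V.1 (algebraMap S _ s)
    have h : ∀ a b, V.1 (a * b) = V.1 a * b + sgn S N q a * V.1 b := V.leibniz
    rw [map_mul, h, sgn_algebraMap, ← Algebra.commutes, ← Algebra.smul_def, ← Algebra.smul_def,
      add_comm])

lemma SuperDer.onScalars_apply {N : Type*} [AddCommGroup N] [Module S N] [Module ℝ N]
    [IsScalarTower ℝ S N] {q : ZMod 2} (V : SuperVec S N q) (s : S) :
    V.onScalars s = V.1 (algebraMap S _ s) := rfl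

lemma SuperDer.smul {N : Type*} [AddCommGroup N] [Module S N] [Module ℝ N]
    [IsScalarTower ℝ S N] {q : ZMod 2} (V : SuperVec S N q) (s : S) (a : ExteriorAlgebra S N) :
    V.1 (s • a) = V.1 (algebraMap S _ s) * a + s • V.1 a := by
  have h : ∀ a b, V.1 (a * b) = V.1 a * b + sgn S N q a * V.1 b := V.leibniz
  rw [Algebra.smul_def, h, sgn_algebraMap, ← Algebra.smul_def]

end Ambient

/-! ### Frames along a Lagrangian submanifold -/

section Setting

variable {R S : Type*} [CommRing R] [Algebra ℝ R] [CommRing S] [Algebra ℝ S]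

lemma SymplecticForm.form_ham (w : SymplecticForm R) (f : R) (D : Vec R) :
    w.form (w.ham f) D = D f := by
  have h : w.form (w.ham f) = differential f :=
    (LinearEquiv.ofBijective w.form w.nondegenerate).apply_symm_apply (differential f)
  rw [h]; rfl

lemma SymplecticForm.form_swap (w : SymplecticForm R) (D D' : Vec R) :
    w.form D D' = -w.form D' D := by
  have h := w.alt (D + D')
  simp only [map_add, LinearMap.add_apply, w.alt, zero_add, add_zero] at h
  exact eq_neg_of_add_eq_zero_right h

/-- The value of a section of `TY|_X` on a function, as a function on `X`. -/
def alongVal {φ : R →ₐ[ℝ] S} (δ : AlongField φ) (f : R) : S := δ f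

/-- The data attached to a Lagrangian submanifold on which the algebraic part of the argument rests:
a frame of the ambient manifold near the submanifold (nearness being expressed by the function
`bump`, which is `1` on the submanifold), a frame of the submanifold, a projection of
`TY|_X` onto `TX`, and the identification of the normal bundle with the cotangent bundle. -/
structure LagrangianFrame (w : SymplecticForm R) (φ : R →ₐ[ℝ] S) (ι κ : Type*)
    [Fintype ι] [Fintype κ] where
  x : ι → R
  e : ι → Vec R
  bump : R
  map_bump : φ bump = 1
  expand : ∀ (D : Vec R) (f : R), bump * (D f - ∑ a, D (x a) * e a f) = 0
  frame : VecFrame κ S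
  expands : frame.Expands
  surj : Function.Surjective φ
  lift : ∀ δ : AlongField φ, ∃ D : Vec R, restrictField φ D = δ
  proj : AlongField φ →ₗ[S] Vec S
  proj_push : ∀ V, proj (pushField φ V) = V
  equiv : Normal φ ≃ₗ[S] OneForm S
  canonical : IsCanonical w φ equiv

namespace LagrangianFrame

variable {w : SymplecticForm R} {φ : R →ₐ[ℝ] S} {ι κ : Type*} [Fintype ι] [Fintype κ]
  (L : LagrangianFrame w φ ι κ) {p : ZMod 2}

/-- A derivation of `R` does not see, along the submanifold, a function that vanishes near it. -/
lemma map_der_eq {f g : R} (h : L.bump * f = L.bump * g) (D : Vec R) : φ (D f) = φ (D g) := by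
  have h0 : L.bump * (f - g) = 0 := by rw [mul_sub, h, sub_self]
  have h1 : φ (f - g) = 0 := by
    have := congrArg φ h0
    rwa [map_mul, L.map_bump, one_mul, map_zero] at this
  have h2 := congrArg (fun z => φ (D z)) h0
  simp only [Derivation.leibniz, smul_eq_mul, map_add, map_mul, L.map_bump, h1, one_mul, zero_mul,
    add_zero, map_zero, map_sub] at h2
  exact sub_eq_zero.1 h2

lemma map_eq {f g : R} (h : L.bump * f = L.bump * g) : φ f = φ g := by
  have := congrArg φ h
  rwa [map_mul, map_mul, L.map_bump, one_mul, one_mul] at this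

lemma exists_extends (L : LagrangianFrame w φ ι κ) (V : Vec S) : ∃ D : Vec R, Extends φ D V := by
  obtain ⟨D, hD⟩ := L.lift (pushField φ V)
  exact ⟨D, fun f => congrArg (fun δ : AlongField φ => alongVal δ f) hD⟩

lemma along_expand (δ : AlongField φ) (f : R) :
    alongVal δ f = ∑ a, alongVal δ (L.x a) * φ (L.e a f) := by
  obtain ⟨D, rfl⟩ := L.lift δ
  have h := L.map_eq (f := D f) (g := ∑ a, D (L.x a) * L.e a f)
    (by rw [← sub_eq_zero, ← mul_sub, L.expand])
  rw [map_sum] at h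
  simp only [map_mul] at h
  exact h

lemma along_sum (δ : AlongField φ) :
    ∑ a, alongVal δ (L.x a) • restrictField φ (L.e a) = δ := by
  ext f
  rw [← Derivation.coeFnAddMonoidHom_apply, map_sum, Finset.sum_apply]
  exact (L.along_expand δ f).symm

lemma restrict_sum (v : Vec R) :
    ∑ a, φ (v (L.x a)) • restrictField φ (L.e a) = restrictField φ v :=
  L.along_sum (restrictField φ v)

lemma normal_sum (v : Vec R) :
    ∑ a, φ (v (L.x a)) • normalPart φ (L.e a) = normalPart φ v := by
  conv_rhs => rw [normalPart_eq_mk, ← L.restrict_sum v, ← Submodule.mkQ_apply, map_sum]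
  rfl

lemma tangent_sum (E : Vec S) : ∑ a, E (φ (L.x a)) • normalPart φ (L.e a) = 0 := by
  have h : (Submodule.Quotient.mk (pushField φ E) : Normal φ) = 0 :=
    (Submodule.Quotient.mk_eq_zero _).2 ⟨E, rfl⟩
  rw [← L.along_sum (pushField φ E), ← Submodule.mkQ_apply, map_sum] at h
  exact h

lemma normalPart_surjective (L : LagrangianFrame w φ ι κ) : Function.Surjective (normalPart φ) := by
  intro n
  obtain ⟨δ, rfl⟩ := Submodule.Quotient.mk_surjective _ n
  obtain ⟨D, rfl⟩ := L.lift δ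
  exact ⟨D, rfl⟩

lemma equiv_ham (f : R) : L.equiv (normalPart φ (w.ham f)) = differential (φ f) := by
  ext V
  obtain ⟨D, hD⟩ := L.exists_extends V
  rw [L.canonical _ D V hD, w.form_ham, hD]
  rfl

lemma normalPart_ham (f : R) : normalPart φ (w.ham f) = L.equiv.symm (differential (φ f)) := by
  rw [← L.equiv_ham, LinearEquiv.symm_apply_apply]

/-- The dual basis of the normal bundle obtained from the coordinates of the submanifold. -/
def normalFrame : DualFrame κ S (Normal φ) where
  vec k := L.equiv.symm (differential (L.frame.coord k))
  coord k := Module.Dual.eval S (Vec S) (L.frame.field k) ∘ₗ (L.equiv : Normal φ →ₗ[S] OneForm S)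

lemma normalFrame_expands : L.normalFrame.Expands := by
  intro n
  apply L.equiv.injective
  rw [map_sum]
  conv_rhs => rw [← L.expands.formFrame (L.equiv n)]
  refine Finset.sum_congr rfl fun k _ => ?_
  rw [map_smul]
  change _ • L.equiv (L.equiv.symm _) = _
  rw [LinearEquiv.apply_symm_apply]
  rfl

/-- The vector `eₐ` of the frame, as an odd function on `ΠN*`. -/
def theta (a : ι) : Sub φ := ExteriorAlgebra.ι S (normalPart φ (L.e a))

lemma theta_mem (a : ι) : L.theta a ∈ parityPart S (Normal φ) 1 := ι_mem_parityPart _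

lemma sum_theta (v : Vec R) :
    ∑ a, φ (v (L.x a)) • L.theta a = ExteriorAlgebra.ι S (normalPart φ v) := by
  rw [← L.normal_sum v, map_sum]
  exact Finset.sum_congr rfl fun a _ => (map_smul _ _ _).symm

/-- A derivation with values in functions on `ΠN*` is determined by the coordinates. -/
lemma der_expand (δ : Derivation ℝ S (Sub φ)) (s : S) :
    δ s = ∑ k, L.frame.field k s • δ (L.frame.coord k) := by
  refine L.normalFrame_expands.eq_of_forall_dual fun f => ?_
  have h := L.expands (f.compDer δ) s
  rw [map_sum]
  refine h.trans (Finset.sum_congr rfl fun k _ => ?_)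
  rw [map_smul, smul_eq_mul, mul_comm]
  rfl

/-- The contact form vanishes on `ΠN*`. -/
lemma sum_der_theta (δ : Derivation ℝ S (Sub φ)) : ∑ a, δ (φ (L.x a)) * L.theta a = 0 := by
  have h : ∀ a, δ (φ (L.x a)) * L.theta a =
      ∑ k, δ (L.frame.coord k) * (L.frame.field k (φ (L.x a)) • L.theta a) := fun a => by
    rw [L.der_expand δ, Finset.sum_mul]
    exact Finset.sum_congr rfl fun k _ => by rw [smul_mul_assoc, mul_smul_comm]
  rw [Finset.sum_congr rfl fun a _ => h a, Finset.sum_comm]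
  refine Finset.sum_eq_zero fun k _ => ?_
  rw [← Finset.mul_sum]
  have h2 : ∑ a, L.frame.field k (φ (L.x a)) • L.theta a = 0 := by
    have := congrArg (ExteriorAlgebra.ι S) (L.tangent_sum (L.frame.field k))
    rw [map_sum, map_zero] at this
    simpa only [map_smul, theta] using this
  rw [h2, mul_zero]

lemma der_fn_expand (D : SuperDer (incl φ) p) (f : R) :
    D.1 (fn f) = ∑ a, φ (L.e a f) • D.1 (fn (L.x a)) := by
  refine L.normalFrame_expands.eq_of_forall_dual fun g => ?_
  let δ : AlongField φ := Derivation.mk' (M := Restr φ)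
    { toFun := fun f => g (D.1 (fn f))
      map_add' := fun f f' => by rw [der_fn_add, map_add]; rfl
      map_smul' := fun c f => by
        have h : fn (c • f) = c • fn f := by
          rw [fn, fn, ← algebraMap_smul R c f, smul_eq_mul, map_mul, ← Algebra.smul_def,
            algebraMap_smul]
        rw [h, map_smul, ← algebraMap_smul S c, map_smul]
        exact algebraMap_smul S c _ }
    (by
      intro f f'
      change g (D.1 (fn (f * f'))) = φ f * g (D.1 (fn f')) + φ f' * g (D.1 (fn f))
      rw [der_fn_mul, map_add, map_smul, map_smul, add_comm]
      rfl)
  rw [map_sum]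
  refine (L.along_expand δ f).trans (Finset.sum_congr rfl fun a _ => ?_)
  rw [map_smul, smul_eq_mul, mul_comm]
  rfl

lemma der_psi_eq_zero (D : SuperDer (incl φ) p) {v : Vec R} (h : L.bump • v = 0) :
    D.1 (psi v) = 0 := by
  have h1 : normalPart φ v = 0 := by
    have := congrArg (normalPart φ) h
    rw [map_smulₛₗ, map_zero] at this
    simpa [L.map_bump] using this
  have h2 := der_psi_smul D L.bump v
  rw [h, psi_zero, map_zero, h1, map_zero, mul_zero, zero_add, L.map_bump, one_smul] at h2
  exact h2.symm

lemma der_psi_eq (D : SuperDer (incl φ) p) {v v' : Vec R} (h : L.bump • v = L.bump • v') :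
    D.1 (psi v) = D.1 (psi v') := by
  have h1 : D.1 (psi (v + (-1 : R) • v')) = 0 :=
    L.der_psi_eq_zero D (by rw [smul_add, h]; simp)
  have h2 : D.1 (fn (-1)) = 0 := by
    have := der_const D (-1 : ℝ)
    rwa [map_neg, map_one] at this
  rw [der_psi_add, der_psi_smul, h2, zero_mul, zero_add, map_neg, map_one, neg_one_smul,
    ← sub_eq_add_neg, sub_eq_zero] at h1
  exact h1

lemma bump_smul_eq_sum (v : Vec R) :
    L.bump • v = L.bump • ∑ a, v (L.x a) • L.e a := by
  ext f
  have h := L.expand v f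
  rw [mul_sub, sub_eq_zero] at h
  rw [Derivation.smul_apply, Derivation.smul_apply, ← Derivation.coeFnAddMonoidHom_apply (∑ a, _),
    map_sum, Finset.sum_apply]
  exact h

lemma der_psi_expand (D : SuperDer (incl φ) p) (v : Vec R) :
    D.1 (psi v) =
      ∑ a, (D.1 (fn (v (L.x a))) * L.theta a + φ (v (L.x a)) • D.1 (psi (L.e a))) := by
  rw [L.der_psi_eq D (L.bump_smul_eq_sum v), der_psi_sum]
  exact Finset.sum_congr rfl fun a _ => der_psi_smul D _ _

/-! ### The contraction of the contact form and the Legendrian condition -/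

/-- The contact Hamiltonian `D ⌟ θ̂`. -/
def hamiltonian (D : SuperDer (incl φ) p) : Sub φ :=
  D.1 (eps R) + ∑ a, D.1 (fn (L.x a)) * L.theta a

/-- The first-order term, with respect to the parameter of a family with velocity `D`, of the
contraction of the contact form with a vector field `V` on `ΠN*`. -/
def legendrian (D : SuperDer (incl φ) p) {q : ZMod 2} (V : SuperVec S (Normal φ) q) : Sub φ :=
  V.1 (D.1 (eps R)) + ∑ a, (V.1 (algebraMap S _ (φ (L.x a))) * D.1 (psi (L.e a))
    + V.1 (D.1 (fn (L.x a))) * L.theta a)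

lemma der_fn_mem (D : SuperDer (incl φ) p) (f : R) : D.1 (fn f) ∈ parityPart S (Normal φ) p := by
  have := D.mem (fn_mem f)
  rwa [zero_add] at this

lemma der_psi_mem (D : SuperDer (incl φ) p) (v : Vec R) :
    D.1 (psi v) ∈ parityPart S (Normal φ) (1 + p) := D.mem (psi_mem v)

lemma hamiltonian_mem (D : SuperDer (incl φ) p) :
    L.hamiltonian D ∈ parityPart S (Normal φ) (p + 1) := by
  refine add_mem ?_ (sum_mem fun a _ => mul_mem_parityPart (der_fn_mem D _) (L.theta_mem a))
  have := D.mem eps_mem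
  rwa [add_comm] at this

/-- The Legendrian condition for contractions determines the normal component of the underlying
deformation by the vertical derivatives of the Hamiltonian. -/
lemma legendrian_contrField (D : SuperDer (incl φ) p) (f : Module.Dual S (Normal φ)) :
    L.legendrian D (contrField f) = contr f (L.hamiltonian D)
      - parSign p • ∑ a, f (normalPart φ (L.e a)) • D.1 (fn (L.x a)) := by
  simp only [legendrian, hamiltonian, contrField_apply, contr_algebraMap, zero_mul, zero_add,
    map_add, map_sum, contr_mul]
  have h : ∀ a, sgn S (Normal φ) 1 (D.1 (fn (L.x a))) * contr f (L.theta a) =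
      parSign p • f (normalPart φ (L.e a)) • D.1 (fn (L.x a)) := fun a => by
    rw [sgn_of_mem 1 (der_fn_mem D _), one_mul, theta, contr_ι, smul_mul_assoc,
      ← Algebra.commutes, ← Algebra.smul_def]
  simp only [h, Finset.sum_add_distrib, ← Finset.smul_sum]
  abel

end LagrangianFrame

end Setting

/-! ### The isotropy condition and the differential of the contact Hamiltonian -/

section SignedSums

variable {S N ι : Type*} [CommRing S] [Algebra ℝ S] [AddCommGroup N] [Module S N] [Module ℝ N]
  [IsScalarTower ℝ S N] [Fintype ι] {p : ZMod 2}

/-- The derivative of `∑ w_{ab} dx_b dx_a`, where `θ_a = ∑ w_{ab} dx_b` has derivative `P_a` and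
`dx_b` has derivative `Q_b`, brought into a form that no longer contains the `Q_b`. -/
lemma sum_mul_add_sum_mul_eq (θ dx P Q : ι → ExteriorAlgebra S N)
    (W : ι → ι → ExteriorAlgebra S N) (w : ι → ι → S)
    (hw : ∀ a b, w a b = -w b a) (hdx : ∀ a, dx a ∈ parityPart S N 1)
    (hQ : ∀ a, Q a ∈ parityPart S N (1 + p))
    (hθ : ∀ a, θ a = ∑ b, w a b • dx b)
    (hPQ : ∀ a, P a = ∑ b, (W a b * dx b + w a b • Q b)) :
    ∑ a, (P a * dx a + parSign p • (θ a * Q a)) =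
      (2 : ℝ) • ∑ a, P a * dx a + ∑ a, ∑ b, W a b * (dx a * dx b) := by
  have h1 : ∀ a, parSign p • (θ a * Q a) = ∑ b, w b a • (Q a * dx b) := fun a => by
    rw [hθ, Finset.sum_mul, Finset.smul_sum]
    refine Finset.sum_congr rfl fun b _ => ?_
    rw [smul_mul_assoc, mul_swap (hdx b) (hQ a), mul_one, parSign_add, parSign_one, hw b a,
      smul_comm (parSign p), smul_smul, mul_left_comm, parSign_mul_self]
    simp
  have h2 : ∀ b, ∑ a, w b a • (Q a * dx b) = P b * dx b + ∑ a, W b a * (dx b * dx a) := fun b => by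
    rw [hPQ b, Finset.sum_mul, ← Finset.sum_add_distrib]
    refine Finset.sum_congr rfl fun a _ => ?_
    have h3 : dx b * dx a = -(dx a * dx b) := by
      rw [mul_swap (hdx b) (hdx a), mul_one, parSign_one, neg_one_smul]
    rw [h3, add_mul, smul_mul_assoc, mul_neg, mul_assoc]
    abel
  rw [Finset.sum_add_distrib, Finset.sum_congr rfl fun a _ => h1 a, Finset.sum_comm,
    Finset.sum_congr rfl fun b _ => h2 b, Finset.sum_add_distrib, two_smul, add_assoc]

end SignedSums

section Setting

variable {R S : Type*} [CommRing R] [Algebra ℝ R] [CommRing S] [Algebra ℝ S]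

lemma sum_antisymm {ι : Type*} [Fintype ι] (W : ι → ι → R) (hW : ∀ a b, W a b = -W b a)
    (p q : ι → R) : ∑ a, ∑ b, W a b * (p a * q b) + ∑ a, ∑ b, W a b * (q a * p b) = 0 := by
  have h : ∑ a, ∑ b, W a b * (q a * p b) = -∑ a, ∑ b, W a b * (p a * q b) := by
    rw [Finset.sum_comm, ← Finset.sum_neg_distrib]
    refine Finset.sum_congr rfl fun a _ => ?_
    rw [← Finset.sum_neg_distrib]
    refine Finset.sum_congr rfl fun b _ => ?_
    rw [hW b a]; ring
  rw [h, add_neg_cancel]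

namespace LagrangianFrame

variable {w : SymplecticForm R} {φ : R →ₐ[ℝ] S} {ι κ : Type*} [Fintype ι] [Fintype κ]
  (L : LagrangianFrame w φ ι κ) {p : ZMod 2}

/-- The coefficients of the symplectic form. -/
def coeff (a b : ι) : R := w.form (L.e a) (L.e b)

lemma coeff_swap (a b : ι) : L.coeff a b = -L.coeff b a := w.form_swap _ _

lemma bump_mul_form (D D' : Vec R) :
    L.bump * w.form D D' = L.bump * ∑ b, D' (L.x b) * w.form D (L.e b) := by
  have h := congrArg (w.form D) (L.bump_smul_eq_sum D')
  simpa only [map_smul, map_sum, smul_eq_mul] using h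

lemma bump_mul_form_eq (D D' : Vec R) :
    L.bump * w.form D D' =
      L.bump * ∑ a, ∑ b, L.coeff a b * (D (L.x a) * D' (L.x b)) := by
  have h1 : ∀ b, L.bump * w.form D (L.e b) = L.bump * ∑ a, D (L.x a) * L.coeff a b := fun b => by
    rw [w.form_swap, mul_neg, L.bump_mul_form, ← mul_neg, ← Finset.sum_neg_distrib]
    refine congrArg _ (Finset.sum_congr rfl fun a _ => ?_)
    rw [← mul_neg, ← w.form_swap]; rfl
  rw [L.bump_mul_form, Finset.mul_sum, Finset.sum_comm, Finset.mul_sum]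
  refine Finset.sum_congr rfl fun b _ => ?_
  rw [mul_left_comm, h1, mul_left_comm, Finset.mul_sum]
  exact congrArg _ (Finset.sum_congr rfl fun a _ => by ring)

/-- The vectors of the frame in terms of Hamiltonian vector fields, near the submanifold. -/
lemma bump_smul_e (a : ι) :
    L.bump • L.e a = L.bump • ∑ b, L.coeff a b • w.ham (L.x b) := by
  apply w.nondegenerate.injective
  ext D
  simp only [map_smul, map_sum, LinearMap.smul_apply, LinearMap.sum_apply, w.form_ham, smul_eq_mul]
  rw [L.bump_mul_form]
  exact congrArg _ (Finset.sum_congr rfl fun b _ => mul_comm _ _)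

/-- The closedness of the symplectic form, in coordinates. -/
lemma closed_coord (D₀ D₁ D₂ : Vec R) :
    φ (∑ a, ∑ b, D₀ (L.coeff a b) * (D₁ (L.x a) * D₂ (L.x b)))
      - φ (∑ a, ∑ b, D₁ (L.coeff a b) * (D₀ (L.x a) * D₂ (L.x b)))
      + φ (∑ a, ∑ b, D₂ (L.coeff a b) * (D₀ (L.x a) * D₁ (L.x b))) = 0 := by
  -- the symplectic form, as a bilinear form in the derivatives of the coordinates
  let B : (ι → R) → (ι → R) → R := fun p q => ∑ a, ∑ b, L.coeff a b * (p a * q b)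
  have hB : ∀ D D' : Vec R, L.bump * w.form D D' =
      L.bump * B (fun a => D (L.x a)) (fun a => D' (L.x a)) := L.bump_mul_form_eq
  have hD : ∀ (D : Vec R) (p q : ι → R), D (B p q) =
      ∑ a, ∑ b, D (L.coeff a b) * (p a * q b) + B (fun a => D (p a)) q
        + B p (fun a => D (q a)) := fun D p q => by
    simp only [B, ← Derivation.coeFnAddMonoidHom_apply, map_sum]
    simp only [Derivation.coeFnAddMonoidHom_apply, ← Finset.sum_add_distrib]
    refine Finset.sum_congr rfl fun a _ => Finset.sum_congr rfl fun b _ => ?_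
    simp only [Derivation.leibniz, smul_eq_mul]
    ring
  have hs : ∀ p q, B p q + B q p = 0 := sum_antisymm L.coeff L.coeff_swap
  have hl : ∀ p p' q, B (fun a => p a - p' a) q = B p q - B p' q := fun p p' q => by
    simp only [B, ← Finset.sum_sub_distrib]
    exact Finset.sum_congr rfl fun a _ => Finset.sum_congr rfl fun b _ => by ring
  have h := congrArg φ (w.closed D₀ D₁ D₂)
  rw [map_sub, map_add, map_sub, map_add, map_sub, map_zero, L.map_der_eq (hB D₁ D₂) D₀,
    L.map_der_eq (hB D₀ D₂) D₁, L.map_der_eq (hB D₀ D₁) D₂, L.map_eq (hB ⁅D₀, D₁⁆ D₂),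
    L.map_eq (hB ⁅D₀, D₂⁆ D₁), L.map_eq (hB ⁅D₁, D₂⁆ D₀), hD, hD, hD] at h
  simp only [Derivation.commutator_apply] at h
  rw [hl (fun a => D₀ (D₁ (L.x a))), hl (fun a => D₀ (D₂ (L.x a))),
    hl (fun a => D₁ (D₂ (L.x a)))] at h
  -- the second derivatives of the coordinates cancel by antisymmetry
  have h1 := congrArg φ (hs (fun a => D₀ (D₂ (L.x a))) (fun a => D₁ (L.x a)))
  have h2 := congrArg φ (hs (fun a => D₁ (D₂ (L.x a))) (fun a => D₀ (L.x a)))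
  have h3 := congrArg φ (hs (fun a => D₂ (D₁ (L.x a))) (fun a => D₀ (L.x a)))
  simp only [map_add, map_sub, map_zero] at h h1 h2 h3
  linear_combination h - h1 + h2 - h3

variable {d : SuperVec S (Normal φ) 1}

/-- The de Rham differential on functions on `ΠN*`, which are forms by the identification of the
normal bundle with the cotangent bundle: it maps `f|_X` to the Hamiltonian vector field of `f`. -/
structure IsDeRham (L : LagrangianFrame w φ ι κ) (d : SuperVec S (Normal φ) 1) : Prop where
  apply_fn : ∀ f, d.1 (algebraMap S _ (φ f)) = ExteriorAlgebra.ι S (normalPart φ (w.ham f))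
  apply_ham : ∀ f, d.1 (ExteriorAlgebra.ι S (normalPart φ (w.ham f))) = 0

/-- The function `dx_a` on `ΠN*`. -/
def dx (a : ι) : Sub φ := ExteriorAlgebra.ι S (normalPart φ (w.ham (L.x a)))

lemma dx_mem (a : ι) : L.dx a ∈ parityPart S (Normal φ) 1 := ι_mem_parityPart _

lemma theta_eq_sum (a : ι) : L.theta a = ∑ b, φ (L.coeff a b) • L.dx b := by
  have h := congrArg (normalPart φ) (L.bump_smul_e a)
  rw [map_smulₛₗ, map_smulₛₗ, map_sum] at h
  simp only [map_smulₛₗ] at h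
  change φ L.bump • _ = φ L.bump • _ at h
  rw [L.map_bump, one_smul, one_smul] at h
  rw [theta, h, map_sum]
  exact Finset.sum_congr rfl fun b _ => map_smul _ _ _

lemma der_psi_e (D : SuperDer (incl φ) p) (a : ι) :
    D.1 (psi (L.e a)) = ∑ b, (D.1 (fn (L.coeff a b)) * L.dx b
      + φ (L.coeff a b) • D.1 (psi (w.ham (L.x b)))) := by
  rw [L.der_psi_eq D (L.bump_smul_e a), der_psi_sum]
  exact Finset.sum_congr rfl fun a _ => der_psi_smul D _ _

lemma d_eq_sum (d : SuperVec S (Normal φ) 1) (s : S) : d.1 (algebraMap S _ s) =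
    ∑ k, L.frame.field k s • d.1 (algebraMap S _ (L.frame.coord k)) :=
  L.der_expand d.onScalars s

/-- The closedness of the symplectic form, as an identity between functions on `ΠN*`. -/
lemma two_smul_sum_d_theta (hd : L.IsDeRham d) (v : Vec R) :
    (2 : S) • ∑ a, φ (v (L.x a)) • d.1 (L.theta a) =
      ∑ a, ∑ b, φ (v (L.coeff a b)) • (L.dx a * L.dx b) := by
  let y : κ → Sub φ := fun k => d.1 (algebraMap S _ (L.frame.coord k))
  have hdx : ∀ a, L.dx a = ∑ k, L.frame.field k (φ (L.x a)) • y k := fun a => by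
    rw [dx, ← hd.apply_fn, L.d_eq_sum d]
  have hy : ∀ k l, y k * y l = -(y l * y k) := fun k l => by
    have h : ∀ k, y k ∈ parityPart S (Normal φ) 1 := fun k => by
      have := d.mem (algebraMap_mem_parityPart (N := Normal φ) (L.frame.coord k))
      rwa [zero_add] at this
    rw [mul_swap (h k) (h l), mul_one, parSign_one, neg_one_smul]
  have hdθ : ∀ a, d.1 (L.theta a) = ∑ b, d.1 (algebraMap S _ (φ (L.coeff a b))) * L.dx b :=
    fun a => by
    rw [L.theta_eq_sum, map_sum]
    refine Finset.sum_congr rfl fun b _ => ?_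
    rw [d.smul, dx, hd.apply_ham, smul_zero, add_zero]
  have hprod : ∀ (s : S) (b : ι), d.1 (algebraMap S _ s) * L.dx b =
      ∑ k, ∑ l, (L.frame.field k s * L.frame.field l (φ (L.x b))) • (y k * y l) := fun s b => by
    rw [L.d_eq_sum d, hdx, Finset.sum_mul]
    refine Finset.sum_congr rfl fun k _ => ?_
    rw [Finset.mul_sum]
    refine Finset.sum_congr rfl fun l _ => ?_
    rw [smul_mul_smul_comm]
  -- `F` antisymmetrized and `G` are the coefficients of the two sides at the products `y k * y l`
  let F : κ → κ → S := fun k l => ∑ a, ∑ b, φ (v (L.x a)) *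
    (L.frame.field k (φ (L.coeff a b)) * L.frame.field l (φ (L.x b)))
  let G : κ → κ → S := fun k l => ∑ a, ∑ b, φ (v (L.coeff a b)) *
    (L.frame.field k (φ (L.x a)) * L.frame.field l (φ (L.x b)))
  have swap : ∀ (f : ι → ι → κ → κ → Sub φ), ∑ a, ∑ b, ∑ k, ∑ l, f a b k l =
      ∑ k, ∑ l, ∑ a, ∑ b, f a b k l := fun f => by
    rw [Finset.sum_congr rfl fun a _ => Finset.sum_comm, Finset.sum_comm]
    refine Finset.sum_congr rfl fun k _ => ?_
    rw [Finset.sum_congr rfl fun a _ => Finset.sum_comm, Finset.sum_comm]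
  have hl : ∑ a, φ (v (L.x a)) • d.1 (L.theta a) = ∑ k, ∑ l, F k l • (y k * y l) := by
    simp only [F, Finset.sum_smul]
    rw [← swap]
    refine Finset.sum_congr rfl fun a _ => ?_
    rw [hdθ, Finset.smul_sum]
    refine Finset.sum_congr rfl fun b _ => ?_
    simp only [hprod, Finset.smul_sum, smul_smul]
  have hr : ∑ a, ∑ b, φ (v (L.coeff a b)) • (L.dx a * L.dx b) =
      ∑ k, ∑ l, G k l • (y k * y l) := by
    simp only [G, Finset.sum_smul]
    rw [← swap]
    refine Finset.sum_congr rfl fun a _ => Finset.sum_congr rfl fun b _ => ?_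
    have : L.dx a = d.1 (algebraMap S _ (φ (L.x a))) := (hd.apply_fn _).symm
    rw [this]
    simp only [hprod, Finset.smul_sum, smul_smul]
  have hFG : ∀ k l, F k l - F l k = G k l := fun k l => by
    -- closedness, evaluated on `v` and on extensions of two fields of the frame of `X`
    obtain ⟨D₁, h₁⟩ := L.exists_extends (L.frame.field k)
    obtain ⟨D₂, h₂⟩ := L.exists_extends (L.frame.field l)
    have h := L.closed_coord v D₁ D₂
    simp only [map_sum, map_mul] at h
    simp only [F, G, ← h₁ _, ← h₂ _]
    have e1 : ∀ D D' : Vec R, ∑ a, ∑ b, φ (D (L.coeff a b)) * (φ (v (L.x a)) * φ (D' (L.x b))) =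
        ∑ a, ∑ b, φ (v (L.x a)) * (φ (D (L.coeff a b)) * φ (D' (L.x b))) := fun D D' =>
      Finset.sum_congr rfl fun a _ => Finset.sum_congr rfl fun b _ => by ring
    rw [e1, e1] at h
    linear_combination -h
  rw [hl, hr, two_smul_sum_mul_swap y hy]
  exact Finset.sum_congr rfl fun k _ => Finset.sum_congr rfl fun l _ => by rw [hFG]

/-- The even function `ω̂`. -/
def omega : Ambient R := ∑ a, psi (L.e a) * psi (w.ham (L.x a))

/-- The submanifold `ΠN*` is `ω`-isotropic. -/
lemma incl_omega (hd : L.IsDeRham d) : incl φ L.omega = 0 := by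
  have h : incl φ L.omega = ∑ a, L.theta a * L.dx a := by
    rw [omega, map_sum]
    refine Finset.sum_congr rfl fun a _ => ?_
    rw [map_mul, incl_psi, incl_psi]; rfl
  have h2 : ∀ a, L.theta a * L.dx a = -(d.onScalars (φ (L.x a)) * L.theta a) := fun a => by
    rw [mul_swap (L.theta_mem a) (L.dx_mem a), mul_one, parSign_one, neg_one_smul,
      SuperDer.onScalars_apply, hd.apply_fn]
    rfl
  rw [h, Finset.sum_congr rfl fun a _ => h2 a, Finset.sum_neg_distrib, L.sum_der_theta, neg_zero]

lemma two_smul_sum_der_mul_d_theta (hd : L.IsDeRham d) (D : SuperDer (incl φ) p) :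
    (2 : ℝ) • ∑ a, D.1 (fn (L.x a)) * d.1 (L.theta a) =
      ∑ a, ∑ b, D.1 (fn (L.coeff a b)) * (L.dx a * L.dx b) := by
  have h6 : ∑ a, D.1 (fn (L.x a)) * d.1 (L.theta a) =
      ∑ c, D.1 (fn (L.x c)) * ∑ a, φ (L.e c (L.x a)) • d.1 (L.theta a) := by
    have : ∀ a, D.1 (fn (L.x a)) * d.1 (L.theta a) =
        ∑ c, D.1 (fn (L.x c)) * (φ (L.e c (L.x a)) • d.1 (L.theta a)) := fun a => by
      conv_lhs => rw [L.der_fn_expand D (L.x a), Finset.sum_mul]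
      exact Finset.sum_congr rfl fun c _ => by rw [smul_mul_assoc, mul_smul_comm]
    rw [Finset.sum_congr rfl fun a _ => this a, Finset.sum_comm]
    exact Finset.sum_congr rfl fun c _ => (Finset.mul_sum _ _ _).symm
  have h7 : ∑ a, ∑ b, D.1 (fn (L.coeff a b)) * (L.dx a * L.dx b) =
      ∑ c, D.1 (fn (L.x c)) * ∑ a, ∑ b, φ (L.e c (L.coeff a b)) • (L.dx a * L.dx b) := by
    have : ∀ a b, D.1 (fn (L.coeff a b)) * (L.dx a * L.dx b) =
        ∑ c, D.1 (fn (L.x c)) * (φ (L.e c (L.coeff a b)) • (L.dx a * L.dx b)) := fun a b => by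
      conv_lhs => rw [L.der_fn_expand D (L.coeff a b), Finset.sum_mul]
      exact Finset.sum_congr rfl fun c _ => by rw [smul_mul_assoc, mul_smul_comm]
    simp only [this, Finset.mul_sum]
    rw [Finset.sum_congr rfl fun a _ => Finset.sum_comm, Finset.sum_comm]
  have h8 : (2 : S) = algebraMap ℝ S 2 := (map_ofNat (algebraMap ℝ S) 2).symm
  rw [h6, h7, Finset.smul_sum]
  refine Finset.sum_congr rfl fun c _ => ?_
  rw [← L.two_smul_sum_d_theta hd (L.e c), h8, algebraMap_smul, mul_smul_comm]

set_option maxHeartbeats 1000000 in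
lemma d_hamiltonian (d : SuperVec S (Normal φ) 1) (D : SuperDer (incl φ) p) :
    d.1 (L.hamiltonian D) = d.1 (D.1 (eps R)) + ∑ a, d.1 (D.1 (fn (L.x a))) * L.theta a
      + parSign p • ∑ a, D.1 (fn (L.x a)) * d.1 (L.theta a) := by
  have hl : ∀ a, d.1 (D.1 (fn (L.x a)) * L.theta a) = d.1 (D.1 (fn (L.x a))) * L.theta a
      + parSign p • (D.1 (fn (L.x a)) * d.1 (L.theta a)) := fun a => by
    have h : ∀ a b : Sub φ, d.1 (a * b) = d.1 a * b + sgn S (Normal φ) 1 a * d.1 b := d.leibniz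
    rw [h, sgn_of_mem 1 (der_fn_mem D _), one_mul, smul_mul_assoc]
  rw [hamiltonian, map_add, map_sum, Finset.sum_congr rfl fun a _ => hl a,
    Finset.sum_add_distrib, ← Finset.smul_sum, ← add_assoc]

/-- The Legendrian condition for the de Rham differential, as an odd vector field on `ΠN*`. -/
lemma sum_der_psi_mul_dx (hd : L.IsDeRham d) (D : SuperDer (incl φ) p)
    (hD : L.legendrian D d = 0) :
    ∑ a, D.1 (psi (L.e a)) * L.dx a =
      parSign p • (d.1 (D.1 (eps R)) + ∑ a, d.1 (D.1 (fn (L.x a))) * L.theta a) := by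
  have h : ∀ a, D.1 (psi (L.e a)) * L.dx a = -(parSign p • (L.dx a * D.1 (psi (L.e a)))) :=
    fun a => by
    rw [mul_swap (der_psi_mem D _) (L.dx_mem a), one_mul, parSign_add, parSign_one, neg_one_mul,
      neg_smul]
  have hdx : ∀ a, d.1 (algebraMap S _ (φ (L.x a))) = L.dx a := fun a => hd.apply_fn _
  rw [legendrian, Finset.sum_add_distrib, Finset.sum_congr rfl fun a _ => by rw [hdx a]] at hD
  rw [Finset.sum_congr rfl fun a _ => h a, Finset.sum_neg_distrib, ← Finset.smul_sum, ← smul_neg]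
  refine congrArg _ (neg_eq_of_add_eq_zero_right ?_)
  rw [← hD]
  abel

lemma der_psi_mul_psi (D : SuperDer (incl φ) p) (v v' : Vec R) :
    D.1 (psi v * psi v') = D.1 (psi v) * ExteriorAlgebra.ι S (normalPart φ v')
      + parSign p • (ExteriorAlgebra.ι S (normalPart φ v) * D.1 (psi v')) := by
  have h : sgn S (Normal φ) p (ExteriorAlgebra.ι S (normalPart φ v)) * D.1 (psi v') =
      parSign p • (ExteriorAlgebra.ι S (normalPart φ v) * D.1 (psi v')) := by
    rw [sgn_ι]
    exact smul_mul_assoc _ _ _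
  rw [← h, D.leibniz, incl_psi, incl_psi]

set_option maxHeartbeats 1000000 in
/-- The derivative of `ω̂` along a Legendrian deformation is, up to a nonzero factor, the
differential of the contact Hamiltonian. -/
theorem der_omega (hd : L.IsDeRham d) (D : SuperDer (incl φ) p) (hD : L.legendrian D d = 0) :
    D.1 L.omega = (2 * parSign p) • d.1 (L.hamiltonian D) := by
  have h1 : D.1 L.omega = ∑ a, (D.1 (psi (L.e a)) * L.dx a
      + parSign p • (L.theta a * D.1 (psi (w.ham (L.x a))))) := by
    rw [omega, map_sum]
    exact Finset.sum_congr rfl fun a _ => der_psi_mul_psi D _ _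
  -- this eliminates the derivatives of `psi (w.ham (L.x a))`, which do not occur in the Legendrian
  -- condition, in favour of those of `psi (L.e a)`
  have h2 := sum_mul_add_sum_mul_eq (p := p) L.theta L.dx (fun a => D.1 (psi (L.e a)))
    (fun a => D.1 (psi (w.ham (L.x a)))) (fun a b => D.1 (fn (L.coeff a b)))
    (fun a b => φ (L.coeff a b)) (fun a b => by rw [L.coeff_swap, map_neg]) L.dx_mem
    (fun a => der_psi_mem D _) L.theta_eq_sum (L.der_psi_e D)
  rw [h1, h2, L.sum_der_psi_mul_dx hd D hD, ← L.two_smul_sum_der_mul_d_theta hd D,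
    L.d_hamiltonian d D, smul_add (2 * parSign p), smul_smul 2, smul_smul (2 * parSign p),
    mul_assoc, parSign_mul_self, mul_one]

end LagrangianFrame

end Setting

/-! ### Deformations with given contact Hamiltonian -/

section Lift

variable {S N κ l : Type*} [CommRing S] [Algebra ℝ S] [AddCommGroup N] [Module S N] [Module ℝ N]
  [IsScalarTower ℝ S N] [Fintype κ] [Fintype l] {p q : ZMod 2}

lemma derivation_mul (δ : Derivation ℝ S (ExteriorAlgebra S N)) (r s : S) :
    δ (r * s) = δ r * algebraMap S _ s + algebraMap S _ r * δ s := by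
  rw [Derivation.leibniz, add_comm, Algebra.smul_def, Algebra.smul_def, Algebra.commutes s (δ r)]

/-- A vector field on `ΠN*` may be prescribed on functions on `X` and on the odd functions that are
linear on the fibres. -/
lemma exists_superVec (δ : Derivation ℝ S (ExteriorAlgebra S N)) (η : N → ExteriorAlgebra S N)
    (hδ : ∀ s, δ s ∈ parityPart S N p) (hη : ∀ n, η n ∈ parityPart S N (p + 1))
    (hηa : ∀ m n, η (m + n) = η m + η n)
    (hηm : ∀ s n, η (s • n) = δ s * ExteriorAlgebra.ι S n + s • η n) :
    ∃ V : SuperVec S N p, (∀ s, V.1 (algebraMap S _ s) = δ s) ∧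
      ∀ n, V.1 (ExteriorAlgebra.ι S n) = η n :=
  exists_superDer (j := RingHom.id (ExteriorAlgebra S N)) p (fun _ => rfl)
    (fun _ => rfl) δ η hδ hη (fun c => δ.map_algebraMap c) (fun r s => map_add δ r s)
    (derivation_mul δ) hηa (fun s n => by rw [hηm, Algebra.smul_def s (η n)]; rfl)

/-- A vector field along the projection `ΠN* → X` lifts to `ΠN*`, by means of the connection for
which the dual basis is parallel. -/
lemma DualFrame.Expands.exists_lift {b : DualFrame κ S N} (hb : b.Expands)
    (δ : Derivation ℝ S (ExteriorAlgebra S N)) (hδ : ∀ s, δ s ∈ parityPart S N p) :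
    ∃ V : SuperVec S N p, ∀ s, V.1 (algebraMap S _ s) = δ s := by
  obtain ⟨V, hV, -⟩ := exists_superVec δ
    (fun n => ∑ k, δ (b.coord k n) * ExteriorAlgebra.ι S (b.vec k)) hδ
    (fun m => sum_mem fun k _ => mul_mem_parityPart (hδ _) (ι_mem_parityPart _))
    (fun m n => by
      rw [← Finset.sum_add_distrib]
      exact Finset.sum_congr rfl fun k _ => by rw [map_add, map_add, add_mul])
    (fun r m => by
      conv_rhs => rw [← hb m, map_sum, Finset.mul_sum, hb m, Finset.smul_sum,
        ← Finset.sum_add_distrib]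
      refine Finset.sum_congr rfl fun k _ => ?_
      rw [map_smul (b.coord k), map_smul (ExteriorAlgebra.ι S), smul_eq_mul, Derivation.leibniz,
        add_comm, add_mul, smul_mul_assoc, smul_mul_assoc, mul_smul_comm])
  exact ⟨V, hV⟩

/-- The vector field `E` on `X`, as a vector field along the projection `ΠN* → X`. -/
def scalarDer (N : Type*) [AddCommGroup N] [Module S N] [Module ℝ N] [IsScalarTower ℝ S N]
    (E : Vec S) : Derivation ℝ S (ExteriorAlgebra S N) :=
  (Algebra.linearMap S (ExteriorAlgebra S N)).compDer E

/-- The vector field along the projection `ΠN* → X` that is `∑ cₐ Xₐ`. -/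
def sumDer (X : κ → Vec S) (c : κ → ExteriorAlgebra S N) :
    Derivation ℝ S (ExteriorAlgebra S N) :=
  ∑ a, (LinearMap.toSpanSingleton S _ (c a)).compDer (X a)

lemma sumDer_apply (X : κ → Vec S) (c : κ → ExteriorAlgebra S N) (s : S) :
    sumDer X c s = ∑ a, X a s • c a := by
  rw [sumDer, ← Derivation.coeFnAddMonoidHom_apply, map_sum, Finset.sum_apply]
  rfl

lemma VecFrame.Expands.derivation_eq {F : VecFrame κ S} (hF : F.Expands) {b : DualFrame l S N}
    (hb : b.Expands) (δ : Derivation ℝ S (ExteriorAlgebra S N)) (s : S) :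
    δ s = ∑ k, F.field k s • δ (F.coord k) := by
  refine hb.eq_of_forall_dual fun f => ?_
  have h := hF (f.compDer δ) s
  rw [map_sum]
  refine h.trans (Finset.sum_congr rfl fun k _ => ?_)
  rw [map_smul, smul_eq_mul, mul_comm]
  rfl

/-- Vector fields on `ΠN*` are generated by lifts of vector fields on `X` and by contractions. -/
lemma VecFrame.Expands.exists_decomposition {F : VecFrame κ S} (hF : F.Expands)
    {b : DualFrame l S N} (hb : b.Expands) (D : κ → SuperVec S N 0)
    (hD : ∀ k s, (D k).1 (algebraMap S _ s) = algebraMap S _ (F.field k s)) (V : SuperVec S N q) :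
    ∃ c : l → ExteriorAlgebra S N, ∀ a, V.1 a =
      ∑ k, V.1 (algebraMap S _ (F.coord k)) * (D k).1 a + ∑ m, c m * contr (b.coord m) a := by
  let v : κ → ExteriorAlgebra S N := fun k => V.1 (algebraMap S _ (F.coord k))
  -- the lifts account for the values on functions on `X`, and the contractions for what remains of
  -- the values on the frame of `N`
  let c : l → ExteriorAlgebra S N := fun m =>
    V.1 (ExteriorAlgebra.ι S (b.vec m)) - ∑ k, v k * (D k).1 (ExteriorAlgebra.ι S (b.vec m))
  have hVl : ∀ a b, V.1 (a * b) = V.1 a * b + sgn S N q a * V.1 b := V.leibniz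
  have hDl : ∀ k a b, (D k).1 (a * b) = (D k).1 a * b + a * (D k).1 b := fun k a b => by
    have := (D k).leibniz a b
    rwa [sgn_zero_apply] at this
  have hv : ∀ k, v k ∈ parityPart S N q := fun k => by
    have := V.mem (algebraMap_mem_parityPart (N := N) (F.coord k))
    rwa [zero_add] at this
  have hc : ∀ m, c m ∈ parityPart S N (q + 1) := fun m => by
    refine sub_mem ?_ (sum_mem fun k _ => mul_mem_parityPart (hv k) ?_)
    · rw [add_comm]; exact V.mem (ι_mem_parityPart _)
    · have := (D k).mem (ι_mem_parityPart (S := S) (b.vec m))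
      rwa [add_zero] at this
  have hswap : ∀ k a, v k * a = sgn S N q a * v k := fun k a => by
    rw [mul_eq_mul_sgn _ (hv k), sgn_sgn, CharTwo.add_self_eq_zero, sgn_zero_apply]
  have hswap' : ∀ m a, c m * sgn S N 1 a = sgn S N q a * c m := fun m a => by
    rw [mul_eq_mul_sgn _ (hc m), sgn_sgn, add_right_comm, CharTwo.add_self_eq_zero, zero_add]
  have hVs : ∀ s, V.1 (algebraMap S _ s) = ∑ k, v k * (D k).1 (algebraMap S _ s) := fun s => by
    refine (hF.derivation_eq hb V.onScalars s).trans (Finset.sum_congr rfl fun k _ => ?_)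
    rw [hD, ← Algebra.commutes, ← Algebra.smul_def]
    rfl
  -- both sides satisfy the same Leibniz rule, so that it suffices to compare them on generators
  let G : ExteriorAlgebra S N →+ ExteriorAlgebra S N :=
    AddMonoidHom.mk' (fun a => ∑ k, v k * (D k).1 a + ∑ m, c m * contr (b.coord m) a)
      (fun a a' => by
        simp only [map_add, mul_add, Finset.sum_add_distrib]
        abel)
  have hG : ∀ a a', G (a * a') = G a * a' + sgn S N q a * G a' := fun a a' => by
    have e1 : ∀ k, v k * (D k).1 (a * a') =
        v k * (D k).1 a * a' + sgn S N q a * (v k * (D k).1 a') := fun k => by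
      rw [hDl, mul_add, ← mul_assoc, ← mul_assoc (v k) a, hswap k a, mul_assoc (sgn S N q a)]
    have e2 : ∀ m, c m * contr (b.coord m) (a * a') =
        c m * contr (b.coord m) a * a' + sgn S N q a * (c m * contr (b.coord m) a') := fun m => by
      rw [contr_mul, mul_add, ← mul_assoc, ← mul_assoc (c m) (sgn S N 1 a), hswap' m a,
        mul_assoc (sgn S N q a)]
    change ∑ k, v k * (D k).1 (a * a') + ∑ m, c m * contr (b.coord m) (a * a') =
      (∑ k, v k * (D k).1 a + ∑ m, c m * contr (b.coord m) a) * a' +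
        sgn S N q a * (∑ k, v k * (D k).1 a' + ∑ m, c m * contr (b.coord m) a')
    rw [Finset.sum_congr rfl fun k _ => e1 k, Finset.sum_congr rfl fun m _ => e2 m,
      Finset.sum_add_distrib, Finset.sum_add_distrib, add_mul, mul_add, Finset.sum_mul,
      Finset.sum_mul, Finset.mul_sum, Finset.mul_sum]
    abel
  have hG₀ : ∀ s, V.1 (algebraMap S _ s) = G (algebraMap S _ s) := fun s => by
    refine (hVs s).trans ?_
    change _ = ∑ k, v k * (D k).1 (algebraMap S _ s) +
      ∑ m, c m * contr (b.coord m) (algebraMap S _ s)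
    simp only [contr_algebraMap, mul_zero, Finset.sum_const_zero, add_zero]
  have hn : ∀ {r : ZMod 2} (U : SuperVec S N r) (n : N), U.1 (ExteriorAlgebra.ι S n) =
      ∑ m, (U.1 (algebraMap S _ (b.coord m n)) * ExteriorAlgebra.ι S (b.vec m)
        + b.coord m n • U.1 (ExteriorAlgebra.ι S (b.vec m))) := fun U n => by
    conv_lhs => rw [← hb n, map_sum, map_sum]
    exact Finset.sum_congr rfl fun m _ => by rw [map_smul, U.smul]
  have hG₁ : ∀ n, V.1 (ExteriorAlgebra.ι S n) = G (ExteriorAlgebra.ι S n) := fun n => by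
    have e1 : ∀ m, V.1 (algebraMap S _ (b.coord m n)) * ExteriorAlgebra.ι S (b.vec m)
        + b.coord m n • V.1 (ExteriorAlgebra.ι S (b.vec m)) =
        ∑ k, v k * ((D k).1 (algebraMap S _ (b.coord m n)) * ExteriorAlgebra.ι S (b.vec m)
          + b.coord m n • (D k).1 (ExteriorAlgebra.ι S (b.vec m)))
        + c m * contr (b.coord m) (ExteriorAlgebra.ι S n) := fun m => by
      rw [hVs, contr_ι, ← Algebra.commutes, ← Algebra.smul_def, smul_sub, Finset.smul_sum,
        Finset.sum_mul]
      simp only [mul_add, Finset.sum_add_distrib, mul_smul_comm, mul_assoc]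
      abel
    change _ = ∑ k, v k * (D k).1 (ExteriorAlgebra.ι S n) +
      ∑ m, c m * contr (b.coord m) (ExteriorAlgebra.ι S n)
    rw [hn V, Finset.sum_congr rfl fun m _ => e1 m, Finset.sum_add_distrib, Finset.sum_comm]
    exact congrArg (· + _) (Finset.sum_congr rfl fun k _ => by rw [hn (D k), Finset.mul_sum])
  exact ⟨c, eq_of_leibniz (RingHom.id _) (sgn S N q).toRingHom V.1.toAddMonoidHom G hVl hG hG₀ hG₁⟩

end Lift

lemma sum_pairing_decomposition {B κ l ι : Type*} [Ring B] [Fintype κ] [Fintype l] [Fintype ι]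
    {T : B → B} {U : κ → B → B} {W : l → B → B} {v : κ → B} {c : l → B}
    (h : ∀ a, T a = ∑ k, v k * U k a + ∑ m, c m * W m a) (x : B) (y P z θ : ι → B) :
    T x + ∑ a, (T (y a) * P a + T (z a) * θ a) =
      ∑ k, v k * (U k x + ∑ a, (U k (y a) * P a + U k (z a) * θ a)) +
        ∑ m, c m * (W m x + ∑ a, (W m (y a) * P a + W m (z a) * θ a)) := by
  simp only [h, add_mul, Finset.sum_mul, mul_add, Finset.mul_sum, Finset.sum_add_distrib,
    ← mul_assoc]
  simp only [Finset.sum_comm (s := (Finset.univ : Finset ι))]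
  abel

section Setting

variable {R S : Type*} [CommRing R] [Algebra ℝ R] [CommRing S] [Algebra ℝ S]

/-- A vector field along the inclusion of `ΠN*` may be prescribed on functions on `Y`, on the
odd functions that are linear on the fibres, and on the additional coordinate. -/
lemma exists_superDer_incl (φ : R →ₐ[ℝ] S) (p : ZMod 2) (δ : R → Sub φ) (η : Vec R → Sub φ)
    (z : Sub φ) (hδp : ∀ f, δ f ∈ parityPart S (Normal φ) p)
    (hηp : ∀ v, η v ∈ parityPart S (Normal φ) (p + 1)) (hz : z ∈ parityPart S (Normal φ) (p + 1))
    (hδc : ∀ c : ℝ, δ (algebraMap ℝ R c) = 0) (hδa : ∀ f g, δ (f + g) = δ f + δ g)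
    (hδm : ∀ f g, δ (f * g) = φ g • δ f + φ f • δ g) (hηa : ∀ v v', η (v + v') = η v + η v')
    (hηm : ∀ f v, η (f • v) = δ f * ExteriorAlgebra.ι S (normalPart φ v) + φ f • η v) :
    ∃ D : SuperDer (incl φ) p, (∀ f, D.1 (fn f) = δ f) ∧ (∀ v, D.1 (psi v) = η v) ∧
      D.1 (eps R) = z := by
  have hδ0 : δ 0 = 0 := by simpa using hδc 0
  have hδ1 : δ 1 = 0 := by simpa using hδc 1
  have hη0 : η 0 = 0 := by simpa using hηa 0 0
  obtain ⟨D, h₀, h₁⟩ := exists_superDer (j := incl φ) p incl_sgn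
    (fun c => by
      rw [incl_algebraMap]
      exact congrArg _ (φ.commutes c))
    δ (fun v => η v.1 + φ v.2 • z) hδp
    (fun v => add_mem (hηp _) (Submodule.smul_mem _ _ hz)) hδc hδa
    (fun f g => by
      rw [hδm, incl_algebraMap, incl_algebraMap, ← Algebra.commutes, ← Algebra.smul_def,
        ← Algebra.smul_def])
    (fun v v' => by
      rw [Prod.fst_add, Prod.snd_add, hηa, map_add, add_smul]
      abel)
    (fun f v => by
      rw [incl_algebraMap, incl_ι, ← Algebra.smul_def, Prod.smul_fst, Prod.smul_snd, hηm,
        smul_eq_mul, map_mul, mul_smul, smul_add, add_assoc])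
  refine ⟨D, h₀, fun v => ?_, ?_⟩
  · rw [psi, h₁]
    change η v + φ 0 • z = η v
    rw [map_zero, zero_smul, add_zero]
  · rw [eps, h₁]
    change η 0 + φ 1 • z = z
    rw [hη0, map_one, one_smul, zero_add]

namespace LagrangianFrame

variable {w : SymplecticForm R} {φ : R →ₐ[ℝ] S} {ι κ : Type*} [Fintype ι] [Fintype κ]
  (L : LagrangianFrame w φ ι κ) {p : ZMod 2}

/-- The Hamiltonian of a reparametrization of the submanifold vanishes. -/
lemma hamiltonian_of_tangent (D : SuperDer (incl φ) p) (V : SuperVec S (Normal φ) p)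
    (h : ∀ a, D.1 a = V.1 (incl φ a)) : L.hamiltonian D = 0 := by
  have h1 : ∀ a, D.1 (fn (L.x a)) * L.theta a = V.onScalars (φ (L.x a)) * L.theta a := fun a => by
    rw [h, incl_fn]; rfl
  rw [hamiltonian, h, incl_eps, map_zero, zero_add, Finset.sum_congr rfl fun a _ => h1 a,
    L.sum_der_theta]

lemma exists_nabla (L : LagrangianFrame w φ ι κ) (E : Vec S) : ∃ V : SuperVec S (Normal φ) 0,
    ∀ s, V.1 (algebraMap S _ s) = algebraMap S _ (E s) :=
  L.normalFrame_expands.exists_lift (scalarDer _ E) fun _ => algebraMap_mem_parityPart _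

/-- If the contact Hamiltonian of a Legendrian deformation vanishes, then the underlying
deformation in `Y` is tangent to `X`. -/
lemma sum_dual_smul_der (D : SuperDer (incl φ) p)
    (hD : ∀ (q : ZMod 2) (V : SuperVec S (Normal φ) q), L.legendrian D V = 0)
    (hH : L.hamiltonian D = 0) (f : Module.Dual S (Normal φ)) :
    ∑ a, f (normalPart φ (L.e a)) • D.1 (fn (L.x a)) = 0 := by
  have h := L.legendrian_contrField D f
  rw [hD, hH, map_zero, zero_sub, eq_comm, neg_eq_zero] at h
  have h2 := congrArg (fun z => parSign p • z) h
  simpa only [smul_smul, parSign_mul_self, one_smul, smul_zero] using h2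

/-- The vector field along the projection `ΠN* → X` given by the tangential part of a
deformation. -/
def tangential (D : SuperDer (incl φ) p) : Derivation ℝ S (Sub φ) :=
  sumDer (fun a => L.proj (restrictField φ (L.e a))) (fun a => D.1 (fn (L.x a)))

/-- If the contact Hamiltonian of a Legendrian deformation vanishes, then its values on functions on
`Y` depend only on their restrictions to `X`. -/
lemma tangential_apply (D : SuperDer (incl φ) p)
    (hD : ∀ (q : ZMod 2) (V : SuperVec S (Normal φ) q), L.legendrian D V = 0)
    (hH : L.hamiltonian D = 0) (f : R) : D.1 (fn f) = L.tangential D (φ f) := by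
  -- what the projection to `TX` omits depends on the normal part only
  let g : AlongField φ →ₗ[S] S :=
    { toFun := fun δ => alongVal δ f - L.proj δ (φ f)
      map_add' := fun δ δ' => by
        rw [map_add]
        change alongVal δ f + alongVal δ' f - (L.proj δ (φ f) + L.proj δ' (φ f)) = _
        ring
      map_smul' := fun s δ => by
        rw [map_smul]
        change s * alongVal δ f - s * L.proj δ (φ f) = s * (alongVal δ f - L.proj δ (φ f))
        ring }
  have hg : LinearMap.range (pushField φ) ≤ LinearMap.ker g := by
    rintro _ ⟨E, rfl⟩
    change alongVal (pushField φ E) f - L.proj (pushField φ E) (φ f) = 0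
    rw [L.proj_push]
    exact sub_self _
  have h := L.sum_dual_smul_der D hD hH ((LinearMap.range (pushField φ)).liftQ g hg)
  have h1 : ∀ a, (LinearMap.range (pushField φ)).liftQ g hg (normalPart φ (L.e a)) =
      φ (L.e a f) - L.proj (restrictField φ (L.e a)) (φ f) := fun a => rfl
  simp only [h1, sub_smul, Finset.sum_sub_distrib] at h
  rw [L.der_fn_expand D f, tangential, sumDer_apply]
  exact sub_eq_zero.1 h

end LagrangianFrame

end Setting

section Lift

variable {S N : Type*} [CommRing S] [Algebra ℝ S] [AddCommGroup N] [Module S N] [Module ℝ N]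
  [IsScalarTower ℝ S N]

/-- A vector field `V` of parity `0` on `ΠN*` satisfies the Leibniz rule without signs. -/
lemma SuperDer.leibniz_even (V : SuperVec S N 0) (a b : ExteriorAlgebra S N) :
    V.1 (a * b) = V.1 a * b + a * V.1 b := by
  have h := V.leibniz a b
  rwa [sgn_zero_apply] at h

/-- The commutator of vector fields along the projection, for a lift `U` of the vector field `E`. -/
def commDer (δ : Derivation ℝ S (ExteriorAlgebra S N)) (E : Vec S)
    (U : SuperVec S N 0) (hU : ∀ s, U.1 (algebraMap S _ s) = algebraMap S _ (E s)) :
    Derivation ℝ S (ExteriorAlgebra S N) :=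
  Derivation.mk' ((δ : S →ₗ[ℝ] ExteriorAlgebra S N) ∘ₗ (E : S →ₗ[ℝ] S) -
    U.1 ∘ₗ (δ : S →ₗ[ℝ] ExteriorAlgebra S N)) (by
    intro s t
    change δ (E (s * t)) - U.1 (δ (s * t)) =
      s • (δ (E t) - U.1 (δ t)) + t • (δ (E s) - U.1 (δ s))
    rw [Derivation.leibniz, Derivation.leibniz, map_add, map_add, U.smul, U.smul, hU, hU,
      smul_eq_mul, smul_eq_mul, Derivation.leibniz, Derivation.leibniz, ← Algebra.smul_def,
      ← Algebra.smul_def, smul_sub, smul_sub]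
    abel)

lemma commDer_apply (δ : Derivation ℝ S (ExteriorAlgebra S N)) (E : Vec S)
    (U : SuperVec S N 0) (hU : ∀ s, U.1 (algebraMap S _ s) = algebraMap S _ (E s)) (s : S) :
    commDer δ E U hU s = δ (E s) - U.1 (δ s) := rfl

end Lift

section Setting

variable {R S : Type*} [CommRing R] [Algebra ℝ R] [CommRing S] [Algebra ℝ S]

namespace LagrangianFrame

variable {w : SymplecticForm R} {φ : R →ₐ[ℝ] S} {ι κ : Type*} [Fintype ι] [Fintype κ]
  (L : LagrangianFrame w φ ι κ) {p : ZMod 2}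

lemma tangential_mem (D : SuperDer (incl φ) p) (s : S) :
    L.tangential D s ∈ parityPart S (Normal φ) p := by
  rw [tangential, sumDer_apply]
  exact sum_mem fun a _ => Submodule.smul_mem _ _ (der_fn_mem D _)

/-- The Legendrian condition for lifts of vector fields on `X`: the values of the deformation on the
odd functions `psi v` depend only on the normal part of `v`. -/
lemma der_psi_eq_zero_of_tangent (D : SuperDer (incl φ) p)
    (hD : ∀ (q : ZMod 2) (V : SuperVec S (Normal φ) q), L.legendrian D V = 0)
    (hH : L.hamiltonian D = 0) {v : Vec R} (hv : normalPart φ v = 0) : D.1 (psi v) = 0 := by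
  obtain ⟨E, hE⟩ := (Submodule.Quotient.mk_eq_zero _).1 hv
  have hE' : ∀ f, φ (v f) = E (φ f) := fun f =>
    (congrArg (fun δ : AlongField φ => alongVal δ f) hE).symm
  obtain ⟨U, hU⟩ := L.exists_nabla E
  let δ := L.tangential D
  have hδ : ∀ f, D.1 (fn f) = δ (φ f) := L.tangential_apply D hD hH
  -- `∑ δ(x_a) θ_a = 0`, as `θ̂` vanishes on `ΠN*`; its derivative along `U`, and the same identity
  -- for the commutator of `δ` and `U`
  have h1 : ∑ a, U.1 (δ (φ (L.x a))) * L.theta a + ∑ a, δ (φ (L.x a)) * U.1 (L.theta a) = 0 := by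
    have := congrArg U.1 (L.sum_der_theta δ)
    rw [map_sum, map_zero, Finset.sum_congr rfl fun a _ => U.leibniz_even _ _,
      Finset.sum_add_distrib] at this
    exact this
  have h2 := L.sum_der_theta (commDer δ E U hU)
  simp only [commDer_apply, sub_mul, Finset.sum_sub_distrib] at h2
  have h3 := hD 0 U
  have h4 : D.1 (eps R) = 0 := by
    have h5 := hH
    rw [hamiltonian, Finset.sum_congr rfl fun a _ => by rw [hδ], L.sum_der_theta, add_zero] at h5
    exact h5
  rw [legendrian, h4, map_zero, zero_add, Finset.sum_add_distrib] at h3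
  have h6 : ∀ a, U.1 (algebraMap S _ (φ (L.x a))) * D.1 (psi (L.e a)) =
      φ (v (L.x a)) • D.1 (psi (L.e a)) := fun a => by
    rw [hU, ← Algebra.smul_def, hE']
  have h7 : ∀ a, U.1 (D.1 (fn (L.x a))) * L.theta a = U.1 (δ (φ (L.x a))) * L.theta a :=
    fun a => by rw [hδ]
  have h8 : ∀ a, D.1 (fn (v (L.x a))) * L.theta a = δ (E (φ (L.x a))) * L.theta a :=
    fun a => by rw [hδ, hE']
  rw [Finset.sum_congr rfl fun a _ => h6 a, Finset.sum_congr rfl fun a _ => h7 a] at h3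
  rw [L.der_psi_expand, Finset.sum_add_distrib, Finset.sum_congr rfl fun a _ => h8 a]
  rw [sub_eq_zero.1 h2, add_comm, h3]

/-- A Legendrian deformation whose contact Hamiltonian vanishes is a reparametrization. -/
theorem tangent_of_hamiltonian (D : SuperDer (incl φ) p)
    (hD : ∀ (q : ZMod 2) (V : SuperVec S (Normal φ) q), L.legendrian D V = 0)
    (hH : L.hamiltonian D = 0) : ∃ V : SuperVec S (Normal φ) p, ∀ a, D.1 a = V.1 (incl φ a) := by
  have hδ : ∀ f, D.1 (fn f) = L.tangential D (φ f) := L.tangential_apply D hD hH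
  choose lift hlift using L.normalPart_surjective
  have hη : ∀ v, D.1 (psi (lift (normalPart φ v))) = D.1 (psi v) := fun v => by
    have h := L.der_psi_eq_zero_of_tangent D hD hH (v := lift (normalPart φ v) - v)
      (by rw [map_sub, hlift, sub_self])
    have h2 := der_psi_add D (lift (normalPart φ v) - v) v
    rw [sub_add_cancel, h, zero_add] at h2
    exact h2
  obtain ⟨V, h₀, h₁⟩ := exists_superVec (L.tangential D) (fun n => D.1 (psi (lift n)))
    (L.tangential_mem D) (fun n => by rw [add_comm]; exact der_psi_mem D _)
    (fun m n => by
      obtain ⟨v, rfl⟩ := L.normalPart_surjective m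
      obtain ⟨v', rfl⟩ := L.normalPart_surjective n
      rw [← map_add, hη, hη, hη, der_psi_add])
    (fun s n => by
      obtain ⟨v, rfl⟩ := L.normalPart_surjective n
      obtain ⟨r, rfl⟩ := L.surj s
      have h : φ r • normalPart φ v = normalPart φ (r • v) := (map_smulₛₗ (normalPart φ) r v).symm
      rw [h, hη, hη, der_psi_smul, hδ])
  have heps : D.1 (eps R) = 0 := by
    have h5 := hH
    rw [hamiltonian, Finset.sum_congr rfl fun a _ => by rw [hδ], L.sum_der_theta, add_zero] at h5
    exact h5
  refine ⟨V, eq_of_leibniz (incl φ) ((sgn S (Normal φ) p).toRingHom.comp (incl φ))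
    D.1.toAddMonoidHom (V.1.toAddMonoidHom.comp (incl φ).toAddMonoidHom) D.leibniz
    (fun a b => ?_) (fun r => ?_) (fun m => ?_)⟩
  · change V.1 (incl φ (a * b)) = V.1 (incl φ a) * incl φ b +
      sgn S (Normal φ) p (incl φ a) * V.1 (incl φ b)
    rw [map_mul]
    exact V.leibniz _ _
  · change D.1 (fn r) = V.1 (incl φ (algebraMap R _ r))
    rw [incl_algebraMap, h₀, hδ]
  · change D.1 (ExteriorAlgebra.ι R m) = V.1 (incl φ (ExteriorAlgebra.ι R m))
    rw [incl_ι, h₁, hη, ι_eq_psi_add_eps, map_add, D.leibniz, heps, incl_eps]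
    simp

end LagrangianFrame

end Setting

lemma sum_pairing_add {B ι : Type*} [Ring B] [Fintype ι] (T : B → B) {x x' : B} (hx : x' = 0)
    (y P : ι → B) {P' z z' : ι → B} (hz : ∀ a, z' a = 0) (θ : ι → B) :
    T (x + x') + ∑ a, (y a * (P a + P' a) + T (z a + z' a) * θ a) =
      (T x + ∑ a, (y a * P a + T (z a) * θ a)) + ∑ a, y a * P' a := by
  simp only [hx, hz, add_zero, mul_add, Finset.sum_add_distrib]
  abel

section Setting

lemma DualFrame.Expands.sum_contr {S N κ : Type*} [CommRing S] [AddCommGroup N] [Module S N]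
    [Fintype κ] {b : DualFrame κ S N} (hb : b.Expands) (f : Module.Dual S N)
    (x : ExteriorAlgebra S N) : ∑ k, f (b.vec k) • contr (b.coord k) x = contr f x := by
  have h : f = ∑ k, f (b.vec k) • b.coord k := by
    ext n
    conv_lhs => rw [← hb n, map_sum]
    simp [mul_comm]
  conv_rhs => rw [h]
  simp only [contr, map_sum, map_smul, LinearMap.sum_apply, LinearMap.smul_apply]

variable {R S : Type*} [CommRing R] [Algebra ℝ R] [CommRing S] [Algebra ℝ S]

lemma restrictField_add (φ : R →ₐ[ℝ] S) (v v' : Vec R) :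
    restrictField φ (v + v') = restrictField φ v + restrictField φ v' := by
  ext f
  exact map_add φ _ _

lemma restrictField_smul (φ : R →ₐ[ℝ] S) (f : R) (v : Vec R) :
    restrictField φ (f • v) = φ f • restrictField φ v := by
  ext g
  exact map_mul φ _ _

/-- A section of the tangent bundle of `Y` along `ΠN*`, as a vector field along the inclusion that
vanishes on functions on `Y`. -/
lemma exists_vertical (φ : R →ₐ[ℝ] S) (p : ZMod 2) (σ : AlongField φ →ₗ[S] Sub φ)
    (hσ : ∀ δ, σ δ ∈ parityPart S (Normal φ) (p + 1)) :
    ∃ D : SuperDer (incl φ) p, (∀ f, D.1 (fn f) = 0) ∧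
      (∀ v, D.1 (psi v) = σ (restrictField φ v)) ∧ D.1 (eps R) = 0 :=
  exists_superDer_incl φ p (fun _ => 0) (fun v => σ (restrictField φ v)) 0 (fun _ => zero_mem _)
    (fun _ => hσ _) (zero_mem _) (fun _ => rfl) (fun _ _ => (add_zero 0).symm)
    (fun _ _ => by rw [smul_zero, smul_zero, add_zero])
    (fun v v' => by rw [restrictField_add, map_add])
    (fun f v => by rw [restrictField_smul, map_smul, zero_mul, zero_add])

namespace LagrangianFrame

variable {w : SymplecticForm R} {φ : R →ₐ[ℝ] S} {ι κ : Type*} [Fintype ι] [Fintype κ]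
  (L : LagrangianFrame w φ ι κ) {p : ZMod 2}

/-- A deformation for which the contraction of the contact form is a given function, and which is
given on functions on `Y` by vector fields with coefficients in functions on `ΠN*`. -/
lemma exists_hamiltonian_eq {l : Type*} [Fintype l] (X : l → Vec R) (c : l → Sub φ)
    (hc : ∀ k, c k ∈ parityPart S (Normal φ) p) {H : Sub φ}
    (hH : H ∈ parityPart S (Normal φ) (p + 1)) :
    ∃ D : SuperDer (incl φ) p, (∀ f, D.1 (fn f) = ∑ k, φ (X k f) • c k) ∧
      L.hamiltonian D = H := by
  let δ : R → Sub φ := fun f => ∑ k, φ (X k f) • c k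
  have hδ : ∀ f, δ f ∈ parityPart S (Normal φ) p := fun f =>
    sum_mem fun k _ => Submodule.smul_mem _ _ (hc k)
  have hδa : ∀ f g, δ (f + g) = δ f + δ g := fun f g => by
    simp only [δ, map_add, add_smul, Finset.sum_add_distrib]
  have hδm : ∀ f g, δ (f * g) = φ g • δ f + φ f • δ g := fun f g => by
    simp only [δ, Derivation.leibniz, smul_eq_mul, map_add, map_mul, add_smul,
      Finset.sum_add_distrib, mul_smul, Finset.smul_sum]
    exact add_comm _ _
  have hz : ∀ g : ι → R, ∑ a, δ (g a) * L.theta a ∈ parityPart S (Normal φ) (p + 1) := fun g =>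
    sum_mem fun a _ => mul_mem_parityPart (hδ _) (L.theta_mem a)
  obtain ⟨D, h₀, -, h₂⟩ := exists_superDer_incl φ p δ
    (fun v => ∑ a, δ (v (L.x a)) * L.theta a) (H - ∑ a, δ (L.x a) * L.theta a) hδ
    (fun v => hz fun a => v (L.x a)) (sub_mem hH (hz L.x))
    (fun c => Finset.sum_eq_zero fun k _ => by
      rw [Derivation.map_algebraMap, map_zero, zero_smul])
    hδa hδm
    (fun v v' => by
      rw [← Finset.sum_add_distrib]
      exact Finset.sum_congr rfl fun a _ => by rw [Derivation.add_apply, hδa, add_mul])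
    (fun f v => by
      rw [← L.sum_theta v, Finset.mul_sum, Finset.smul_sum, ← Finset.sum_add_distrib]
      refine Finset.sum_congr rfl fun a _ => ?_
      rw [Derivation.smul_apply, smul_eq_mul, hδm, add_mul, smul_mul_assoc, smul_mul_assoc,
        mul_smul_comm])
  refine ⟨D, h₀, ?_⟩
  have h : ∀ a, D.1 (fn (L.x a)) * L.theta a = δ (L.x a) * L.theta a := fun a => by rw [h₀]
  rw [hamiltonian, h₂, Finset.sum_congr rfl fun a _ => h a, sub_add_cancel]

/-- The deformation whose values on functions on `Y` are given by the Hamiltonian vector fields of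
extensions of the coordinates of `X`, weighted with the vertical derivatives of `H`, has Hamiltonian
`H` and satisfies the Legendrian condition for contractions. -/
lemma exists_legendrian_contrField {H : Sub φ} (hH : H ∈ parityPart S (Normal φ) (p + 1)) :
    ∃ D : SuperDer (incl φ) p, L.hamiltonian D = H ∧
      ∀ f : Module.Dual S (Normal φ), L.legendrian D (contrField f) = 0 := by
  choose u hu using fun k => L.surj (L.frame.coord k)
  have hc : ∀ k, parSign p • contr (L.normalFrame.coord k) H ∈ parityPart S (Normal φ) p :=
    fun k => by
    refine smul_mem_parityPart _ ?_
    have h := (contrField (L.normalFrame.coord k)).mem hH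
    rwa [add_assoc, CharTwo.add_self_eq_zero, add_zero] at h
  obtain ⟨D, hD, hDH⟩ := L.exists_hamiltonian_eq (fun k => w.ham (u k)) _ hc hH
  refine ⟨D, hDH, fun f => ?_⟩
  have h1 : ∀ k, ∑ a, φ (w.ham (u k) (L.x a)) * f (normalPart φ (L.e a)) =
      f (L.normalFrame.vec k) := fun k => by
    have h := congrArg f (L.normal_sum (w.ham (u k)))
    rw [map_sum, L.normalPart_ham, hu] at h
    simp only [map_smul, smul_eq_mul] at h
    exact h
  have h2 : ∑ a, f (normalPart φ (L.e a)) • D.1 (fn (L.x a)) = parSign p • contr f H := by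
    rw [← L.normalFrame_expands.sum_contr f H, Finset.smul_sum]
    simp only [hD, Finset.smul_sum, smul_smul]
    rw [Finset.sum_comm]
    refine Finset.sum_congr rfl fun k _ => ?_
    rw [← h1 k, ← Finset.sum_smul, smul_comm (parSign p)]
    exact congrArg (· • _) (Finset.sum_congr rfl fun a _ => mul_comm _ _)
  rw [legendrian_contrField, hDH, h2, smul_smul, parSign_mul_self, one_smul, sub_self]

lemma sum_proj_smul (δ : Derivation ℝ S (Sub φ)) (s : S) :
    ∑ a, L.proj (restrictField φ (L.e a)) s • δ (φ (L.x a)) = δ s := by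
  have h : ∀ k, ∑ a, L.proj (restrictField φ (L.e a)) s * L.frame.field k (φ (L.x a)) =
      L.frame.field k s := fun k => by
    have h1 := congrArg L.proj (L.along_sum (pushField φ (L.frame.field k)))
    rw [L.proj_push, map_sum] at h1
    have h2 := congrArg (fun V : Vec S => V s) h1
    simp only [map_smul] at h2
    rw [← Derivation.coeFnAddMonoidHom_apply, map_sum, Finset.sum_apply] at h2
    exact (Finset.sum_congr rfl fun a _ => mul_comm _ _).trans h2
  have h3 : ∀ a, L.proj (restrictField φ (L.e a)) s • δ (φ (L.x a)) =
      ∑ k, (L.proj (restrictField φ (L.e a)) s * L.frame.field k (φ (L.x a))) •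
        δ (L.frame.coord k) := fun a => by
    rw [L.der_expand δ, Finset.smul_sum]
    exact Finset.sum_congr rfl fun k _ => smul_smul _ _ _
  rw [Finset.sum_congr rfl fun a _ => h3 a, Finset.sum_comm, L.der_expand δ s]
  exact Finset.sum_congr rfl fun k _ => by rw [← Finset.sum_smul, h]

lemma legendrian_add (D C : SuperDer (incl φ) p) (h₀ : ∀ f, C.1 (fn f) = 0)
    (h₁ : C.1 (eps R) = 0) {q : ZMod 2} (V : SuperVec S (Normal φ) q) :
    L.legendrian (D + C) V = L.legendrian D V +
      ∑ a, V.onScalars (φ (L.x a)) * C.1 (psi (L.e a)) := by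
  have hadd : ∀ a, (D + C).1 a = D.1 a + C.1 a := fun a => rfl
  rw [legendrian, hadd]
  exact sum_pairing_add V.1 h₁ (fun a => V.1 (algebraMap S _ (φ (L.x a)))) _
    (fun a => h₀ (L.x a)) L.theta

/-- Every function on `ΠN*` of the right parity is the contact Hamiltonian of a Legendrian
deformation. -/
theorem exists_legendrian {H : Sub φ} (hH : H ∈ parityPart S (Normal φ) (p + 1)) :
    ∃ D : SuperDer (incl φ) p, L.hamiltonian D = H ∧
      ∀ (q : ZMod 2) (V : SuperVec S (Normal φ) q), L.legendrian D V = 0 := by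
  obtain ⟨D, hDH, hD⟩ := L.exists_legendrian_contrField hH
  choose U hU using fun k => L.exists_nabla (L.frame.field k)
  -- the defect in the Legendrian condition for the lifts
  let K : κ → Sub φ := fun k => L.legendrian D (U k)
  have hK : ∀ k, K k ∈ parityPart S (Normal φ) (p + 1) := fun k => by
    have hU' : ∀ {i : ZMod 2} {a : Sub φ}, a ∈ parityPart S (Normal φ) i →
        (U k).1 a ∈ parityPart S (Normal φ) i := fun ha => by
      have := (U k).mem ha
      rwa [add_zero] at this
    refine add_mem (hU' ?_) (sum_mem fun a _ => add_mem ?_ ?_)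
    · rw [add_comm]; exact D.mem eps_mem
    · rw [← zero_add (p + 1), add_comm p]
      exact mul_mem_parityPart (hU' (algebraMap_mem_parityPart _)) (der_psi_mem D _)
    · exact mul_mem_parityPart (hU' (der_fn_mem D _)) (L.theta_mem a)
  -- the correction on the odd coordinates, which takes minus the defect as values on `TX`
  let σ : AlongField φ →ₗ[S] Sub φ :=
    -∑ k, (LinearMap.toSpanSingleton S (Sub φ) (K k)) ∘ₗ
      ((differential (L.frame.coord k) : OneForm S) ∘ₗ L.proj)
  have hσ : ∀ δ, σ δ = -∑ k, L.proj δ (L.frame.coord k) • K k := fun δ => by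
    simp only [σ, LinearMap.neg_apply, LinearMap.sum_apply]
    rfl
  obtain ⟨C, hC₀, hC₁, hC₂⟩ := exists_vertical φ p σ fun δ => by
    rw [hσ]
    exact neg_mem (sum_mem fun k _ => Submodule.smul_mem _ _ (hK k))
  have hadd : ∀ a, (D + C).1 a = D.1 a + C.1 a := fun a => rfl
  refine ⟨D + C, ?_, fun q V => ?_⟩
  · simp only [hamiltonian, hadd, hC₀, hC₂, add_zero]
    exact hDH
  obtain ⟨c, hc⟩ := L.expands.exists_decomposition L.normalFrame_expands U hU V
  have h1 : L.legendrian D V = ∑ k, V.onScalars (L.frame.coord k) * K k := by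
    have h := sum_pairing_decomposition hc (D.1 (eps R)) (fun a => algebraMap S _ (φ (L.x a)))
      (fun a => D.1 (psi (L.e a))) (fun a => D.1 (fn (L.x a))) L.theta
    refine h.trans ?_
    have h' : ∀ m, c m * L.legendrian D (contrField (L.normalFrame.coord m)) = 0 := fun m => by
      rw [hD, mul_zero]
    have h'' := Finset.sum_eq_zero (s := Finset.univ) fun m _ => h' m
    exact (congrArg (_ + ·) h'').trans (add_zero _)
  have h2 := L.legendrian_add D C hC₀ hC₂ V
  have h3 : ∀ a, V.onScalars (φ (L.x a)) * C.1 (psi (L.e a)) =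
      -∑ k, (L.proj (restrictField φ (L.e a)) (L.frame.coord k) • V.onScalars (φ (L.x a))) * K k :=
    fun a => by
    rw [hC₁, hσ, mul_neg, Finset.mul_sum]
    exact congrArg _ (Finset.sum_congr rfl fun k _ =>
      (mul_smul_comm _ _ _).trans (smul_mul_assoc _ _ _).symm)
  have h4 : ∑ a, V.onScalars (φ (L.x a)) * C.1 (psi (L.e a)) =
      -∑ k, V.onScalars (L.frame.coord k) * K k := by
    rw [Finset.sum_congr rfl fun a _ => h3 a, Finset.sum_neg_distrib, Finset.sum_comm]
    exact congrArg _ (Finset.sum_congr rfl fun k _ => by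
      rw [← Finset.sum_mul, L.sum_proj_smul])
  rw [h2, h1, h4, add_neg_cancel]

end LagrangianFrame

end Setting

/-! ### The Zariski tangent space -/

section Setting

variable {R S : Type*} [CommRing R] [Algebra ℝ R] [CommRing S] [Algebra ℝ S]

namespace LagrangianFrame

variable {w : SymplecticForm R} {φ : R →ₐ[ℝ] S} {ι κ : Type*} [Fintype ι] [Fintype κ]
  (L : LagrangianFrame w φ ι κ) {p : ZMod 2}

/-- The identification of functions on `ΠN*` with differential forms. -/
def toForms : Sub φ →ₐ[S] Forms S := ExteriorAlgebra.map (L.equiv : Normal φ →ₗ[S] OneForm S)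

lemma toForms_injective : Function.Injective L.toForms :=
  Function.LeftInverse.injective (map_symm_map L.equiv)

lemma toForms_surjective : Function.Surjective L.toForms :=
  Function.RightInverse.surjective (map_map_symm L.equiv)

/-- The de Rham differential of `X`, as an odd vector field on `ΠN*`. -/
lemma exists_d : ∃ d : SuperVec S (Normal φ) 1, L.IsDeRham d ∧
    ∃ d₀ : SuperVec S (OneForm S) 1, _root_.OddContact.IsDeRham d₀ ∧
      ∀ a, L.toForms (d.1 a) = d₀.1 (L.toForms a) := by
  obtain ⟨d₀, h₀⟩ := L.expands.exists_isDeRham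
  obtain ⟨d, hd⟩ := exists_transport L.equiv d₀
  have hι : ∀ f, L.toForms (ExteriorAlgebra.ι S (normalPart φ (w.ham f))) =
      ExteriorAlgebra.ι S (differential (φ f)) := fun f => by
    rw [← L.equiv_ham]
    exact ExteriorAlgebra.map_apply_ι _ _
  refine ⟨d, ⟨fun f => L.toForms_injective ?_, fun f => L.toForms_injective ?_⟩, d₀, h₀, hd⟩
  · rw [hι, ← h₀.apply_fn]
    exact (hd _).trans (congrArg _ (AlgHom.commutes _ _))
  · rw [map_zero]
    refine (hd _).trans ((congrArg d₀.1 (hι f)).trans (h₀.apply_exact _))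

/-- A Legendrian deformation is `ω`-isotropic when its contact Hamiltonian is a closed form. -/
theorem isotropic_iff (D : SuperDer (incl φ) p)
    (hD : ∀ (q : ZMod 2) (V : SuperVec S (Normal φ) q), L.legendrian D V = 0) :
    D.1 L.omega = 0 ↔ L.toForms (L.hamiltonian D) ∈ closedForms S (p + 1) := by
  obtain ⟨d, hd, d₀, h₀, hdd⟩ := L.exists_d
  have hc : (2 * parSign p : ℝ) ≠ 0 := by
    rcases zmod_two_cases p with rfl | rfl <;> simp
  rw [mem_closedForms_iff L.expands h₀, L.der_omega hd D (hD 1 d), smul_eq_zero_iff_right hc,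
    ← hdd, map_eq_zero_iff _ L.toForms_injective]
  exact (and_iff_right (map_mem_parityPart _ (L.hamiltonian_mem D))).symm

/-- The contraction with the contact form, as a linear map. -/
def hamiltonianMap (p : ZMod 2) : SuperDer (incl φ) p →ₗ[ℝ] Sub φ where
  toFun := L.hamiltonian
  map_add' D D' := by
    have h : ∀ a, (D + D').1 a = D.1 a + D'.1 a := fun _ => rfl
    simp only [hamiltonian, h, add_mul, Finset.sum_add_distrib]
    abel
  map_smul' c D := by
    have h : ∀ a, (c • D).1 a = c • D.1 a := fun _ => rfl
    simp only [hamiltonian, h, smul_mul_assoc, ← Finset.smul_sum, ← smul_add]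
    rfl

/-- The first-order term of the Legendrian condition, as a linear map. -/
def legendrianMap {q : ZMod 2} (V : SuperVec S (Normal φ) q) :
    SuperDer (incl φ) p →ₗ[ℝ] Sub φ where
  toFun D := L.legendrian D V
  map_add' D D' := by
    have h : ∀ a, (D + D').1 a = D.1 a + D'.1 a := fun _ => rfl
    simp only [legendrian, h, mul_add, map_add, add_mul, Finset.sum_add_distrib]
    abel
  map_smul' c D := by
    have h : ∀ a, (c • D).1 a = c • D.1 a := fun _ => rfl
    simp only [legendrian, h, map_smul, smul_mul_assoc, mul_smul_comm, ← smul_add,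
      ← Finset.smul_sum]
    rfl

/-- The velocities of Legendrian `ω`-isotropic infinitesimal deformations. -/
def admissible (p : ZMod 2) : Submodule ℝ (SuperDer (incl φ) p) :=
  (⨅ (q : ZMod 2) (V : SuperVec S (Normal φ) q), LinearMap.ker (L.legendrianMap V)) ⊓
    LinearMap.ker ((LinearMap.applyₗ (R := ℝ) L.omega) ∘ₗ (superDer (incl φ) p).subtype)

lemma mem_admissible {D : SuperDer (incl φ) p} : D ∈ L.admissible p ↔
    (∀ (q : ZMod 2) (V : SuperVec S (Normal φ) q), L.legendrian D V = 0) ∧ D.1 L.omega = 0 := by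
  rw [admissible, Submodule.mem_inf, Submodule.mem_iInf]
  refine and_congr (forall_congr' fun q => ?_) Iff.rfl
  rw [Submodule.mem_iInf]
  exact Iff.rfl

/-- The contraction of the contact form with normal sections. -/
def normalHamiltonian (p : ZMod 2) : NormalSections (incl φ) p →ₗ[ℝ] Sub φ :=
  (tangentPart (incl φ) p).liftQ (L.hamiltonianMap p) fun D ⟨V, hV⟩ =>
    L.hamiltonian_of_tangent D V hV

/-- Contraction with the contact form identifies the tangent space with closed forms. -/
theorem exists_equiv (p : ZMod 2) :
    ∃ K : (L.admissible p).map (tangentPart (incl φ) p).mkQ ≃ₗ[ℝ] closedForms S (p + 1),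
      ∀ (D : SuperDer (incl φ) p)
        (hD : Submodule.Quotient.mk D ∈ (L.admissible p).map (tangentPart (incl φ) p).mkQ),
        (K ⟨Submodule.Quotient.mk D, hD⟩ : Forms S) = L.toForms (L.hamiltonian D) := by
  let T := (L.admissible p).map (tangentPart (incl φ) p).mkQ
  let G : NormalSections (incl φ) p →ₗ[ℝ] Forms S :=
    (L.toForms.toLinearMap.restrictScalars ℝ) ∘ₗ L.normalHamiltonian p
  have hG : ∀ D : SuperDer (incl φ) p, G (Submodule.Quotient.mk D) = L.toForms (L.hamiltonian D) :=
    fun D => rfl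
  have hmem : ∀ ν : T, G ν.1 ∈ closedForms S (p + 1) := by
    rintro ⟨_, D, hD, rfl⟩
    have h := L.mem_admissible.1 hD
    exact (L.isotropic_iff D h.1).1 h.2
  let K₀ : T →ₗ[ℝ] closedForms S (p + 1) := (G ∘ₗ T.subtype).codRestrict _ hmem
  have hinj : Function.Injective K₀ := by
    rw [← LinearMap.ker_eq_bot, LinearMap.ker_eq_bot']
    rintro ⟨_, D, hD, rfl⟩ h0
    have h := L.mem_admissible.1 hD
    have h1 : L.toForms (L.hamiltonian D) = 0 := congrArg Subtype.val h0
    rw [map_eq_zero_iff _ L.toForms_injective] at h1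
    obtain ⟨V, hV⟩ := L.tangent_of_hamiltonian D h.1 h1
    exact Subtype.ext ((Submodule.Quotient.mk_eq_zero _).2 ⟨V, hV⟩)
  have hsurj : Function.Surjective K₀ := by
    rintro ⟨α, hα⟩
    obtain ⟨H, rfl⟩ := L.toForms_surjective α
    have hH : H ∈ parityPart S (Normal φ) (p + 1) := by
      have h := map_mem_parityPart (L.equiv.symm : OneForm S →ₗ[S] Normal φ) hα.1
      rwa [toForms, map_symm_map] at h
    obtain ⟨D, rfl, hD⟩ := L.exists_legendrian hH
    exact ⟨⟨_, D, L.mem_admissible.2 ⟨hD, (L.isotropic_iff D hD).2 hα⟩, rfl⟩, rfl⟩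
  exact ⟨LinearEquiv.ofBijective K₀ ⟨hinj, hsurj⟩, fun D hD => rfl⟩

end LagrangianFrame

end Setting

section Families

variable {R M S N ι : Type*} [CommRing R] [Algebra ℝ R] [AddCommGroup M]
  [Module R M] [Module ℝ M] [IsScalarTower ℝ R M] [CommRing S] [Algebra ℝ S] [AddCommGroup N]
  [Module S N] [Module ℝ N] [IsScalarTower ℝ S N] [Fintype ι] {p q : ZMod 2}
  {j : ExteriorAlgebra R M →+* ExteriorAlgebra S N}

/-- The pullback of a differential form along a family of morphisms, expanded in powers of the
parameter of the family. -/
lemma family_pairing_eq_zero_iff (D : SuperDer j p) (V : SuperVec S N q) {z : ExteriorAlgebra R M}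
    {x y : ι → ExteriorAlgebra R M} {x' y' : ι → ExteriorAlgebra S N} (hz : j z = 0)
    (hx : ∀ a, j (x a) = x' a) (hy : ∀ a, j (y a) = y' a) (hx' : ∀ a, x' a ∈ parityPart S N 0)
    (h₀ : ∑ a, V.1 (x' a) * y' a = 0) :
    extendField p V (family D z) + ∑ a, extendField p V (family D (x a)) * family D (y a) = 0 ↔
      V.1 (D.1 z) + ∑ a, (V.1 (x' a) * D.1 (y a) + V.1 (D.1 (x a)) * y' a) = 0 := by
  have hs : ∀ a, parSign (p * q) • (V.1 (x' a) * D.1 (y a) + V.1 (D.1 (x a)) * y' a) =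
      sgn S N p (V.1 (j (x a))) * D.1 (y a) +
        ((-1 : ℝ) ^ (p.val * q.val) • V.1 (D.1 (x a))) * j (y a) := fun a => by
    have h := V.mem (hx' a)
    rw [zero_add] at h
    rw [hx, hy, sgn_of_mem p h, neg_one_pow_val_mul_val, smul_mul_assoc, smul_mul_assoc,
      ← smul_add]
  have hfst : (extendField p V (family D z)
      + ∑ a, extendField p V (family D (x a)) * family D (y a)).fst = 0 := by
    rw [TrivSqZeroExt.fst_add, TrivSqZeroExt.fst_sum]
    change V.1 (j z) + ∑ a, V.1 (j (x a)) * j (y a) = 0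
    rw [hz, map_zero, zero_add, ← h₀]
    exact Finset.sum_congr rfl fun a _ => by rw [hx, hy]
  have hsnd : (extendField p V (family D z)
      + ∑ a, extendField p V (family D (x a)) * family D (y a)).snd =
      parSign (p * q) •
        (V.1 (D.1 z) + ∑ a, (V.1 (x' a) * D.1 (y a) + V.1 (D.1 (x a)) * y' a)) := by
    rw [TrivSqZeroExt.snd_add, TrivSqZeroExt.snd_sum, smul_add, Finset.smul_sum,
      Finset.sum_congr rfl fun a _ => hs a, ← neg_one_pow_val_mul_val]
    rfl
  have hc : parSign (p * q) ≠ 0 := fun h => by simpa [h] using parSign_mul_self (p * q)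
  exact ⟨fun h => (smul_eq_zero_iff_right hc).1 (hsnd.symm.trans (congrArg _ h)),
    fun h => TrivSqZeroExt.ext hfst (hsnd.trans (by rw [h, smul_zero]; rfl))⟩

lemma family_eq_zero_iff (D : SuperDer j p) {a : ExteriorAlgebra R M} (h : j a = 0) :
    family D a = 0 ↔ D.1 a = 0 :=
  ⟨fun h' => congrArg TrivSqZeroExt.snd h', fun h' => TrivSqZeroExt.ext h h'⟩

end Families

section Tangent

variable {R S : Type*} [CommRing R] [Algebra ℝ R] [CommRing S] [Algebra ℝ S]

namespace LagrangianFrame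

variable {w : SymplecticForm R} {φ : R →ₐ[ℝ] S} {ι κ : Type*} [Fintype ι] [Fintype κ]
  (L : LagrangianFrame w φ ι κ) {p : ZMod 2}

lemma isLegendrian_iff {x : ι → R} {e : ι → Vec R} (hx : L.x = x) (he : L.e = e)
    (D : SuperDer (incl φ) p) : (∀ (q : ZMod 2) (V : SuperVec S (Normal φ) q),
      extendField p V (family D (eps R))
        + ∑ a, extendField p V (family D (fn (x a))) * family D (psi (e a)) = 0) ↔
      ∀ (q : ZMod 2) (V : SuperVec S (Normal φ) q), L.legendrian D V = 0 := by
  refine forall_congr' fun q => forall_congr' fun V => ?_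
  rw [← hx, ← he]
  exact family_pairing_eq_zero_iff D V incl_eps (fun a => incl_fn _) (fun a => incl_psi _)
    (fun a => algebraMap_mem_parityPart _) (L.sum_der_theta V.onScalars)

lemma isIsotropic_iff {x : ι → R} {e : ι → Vec R} (hx : L.x = x) (he : L.e = e)
    (D : SuperDer (incl φ) p) :
    family D (∑ a, psi (e a) * psi (w.ham (x a))) = 0 ↔ D.1 L.omega = 0 := by
  obtain ⟨d, hd, -⟩ := L.exists_d
  rw [← hx, ← he]
  exact family_eq_zero_iff D (L.incl_omega hd)

lemma contraction_eq {x : ι → R} {e : ι → Vec R} (hx : L.x = x) (he : L.e = e)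
    (D : SuperDer (incl φ) p) :
    D.1 (eps R) + ∑ a, D.1 (fn (x a)) * incl φ (psi (e a)) = L.hamiltonian D := by
  rw [hamiltonian, ← hx, ← he]
  exact congrArg _ (Finset.sum_congr rfl fun a _ => by rw [incl_psi]; rfl)

/-- The tangent space to the moduli space, with the conditions on families spelled out. -/
theorem exists_tangent_equiv {x : ι → R} {e : ι → Vec R} {Φ : Normal φ ≃ₗ[S] OneForm S}
    (hx : L.x = x) (he : L.e = e) (hΦ : L.equiv = Φ) (p : ZMod 2) :
    ∃ T : Submodule ℝ (NormalSections (incl φ) p),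
      (T : Set (NormalSections (incl φ) p)) = {ν | ∃ D : SuperDer (incl φ) p,
        Submodule.Quotient.mk D = ν ∧
        (∀ (q : ZMod 2) (V : SuperVec S (Normal φ) q), extendField p V (family D (eps R))
          + ∑ a, extendField p V (family D (fn (x a))) * family D (psi (e a)) = 0) ∧
        family D (∑ a, psi (e a) * psi (w.ham (x a))) = 0} ∧
      ∃ K : T ≃ₗ[ℝ] closedForms S (p + 1),
        ∀ (D : SuperDer (incl φ) p) (hD : Submodule.Quotient.mk D ∈ T),
          (K ⟨Submodule.Quotient.mk D, hD⟩ : Forms S) =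
            ExteriorAlgebra.map (Φ : Normal φ →ₗ[S] OneForm S)
              (D.1 (eps R) + ∑ a, D.1 (fn (x a)) * incl φ (psi (e a))) := by
  subst hΦ
  obtain ⟨K, hK⟩ := L.exists_equiv p
  refine ⟨(L.admissible p).map (tangentPart (incl φ) p).mkQ, ?_, K,
    fun D hD => (hK D hD).trans (congrArg L.toForms (L.contraction_eq hx he D).symm)⟩
  ext ν
  constructor
  · rintro ⟨D, hD, rfl⟩
    have h := L.mem_admissible.1 hD
    exact ⟨D, rfl, (L.isLegendrian_iff hx he D).2 h.1, (L.isIsotropic_iff hx he D).2 h.2⟩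
  · rintro ⟨D, rfl, h₁, h₂⟩
    exact ⟨D, L.mem_admissible.2 ⟨(L.isLegendrian_iff hx he D).1 h₁,
      (L.isIsotropic_iff hx he D).1 h₂⟩, rfl⟩

end LagrangianFrame

variable {k n : ℕ} {X Y : Type*}
  [TopologicalSpace X] [ChartedSpace (EuclideanSpace ℝ (Fin k)) X]
  [TopologicalSpace Y] [ChartedSpace (EuclideanSpace ℝ (Fin n)) Y]
  {i : C^∞⟮𝓡 k, X; 𝓡 n, Y⟯} {w : SymplecticForm (Fn n Y)} {κ : Type*} [Fintype κ]

theorem LagrangianFrame.exists_zariskiTangent_equiv {F : Frame i}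
    (L : LagrangianFrame w (pullback i) (Fin F.size) κ) (hx : L.x = F.x) (he : L.e = F.e)
    {Φ : Normal (pullback i) ≃ₗ[Fn k X] OneForm (Fn k X)} (hΦ : L.equiv = Φ) (p : ZMod 2) :
    ∃ T : Submodule ℝ (NormalSections (incl (pullback i)) p),
      (T : Set _) = zariskiTangent F w p ∧
      ∃ K : T ≃ₗ[ℝ] closedForms (Fn k X) (p + 1),
        ∀ (D : SuperDer (incl (pullback i)) p) (hD : Submodule.Quotient.mk D ∈ T),
          (K ⟨Submodule.Quotient.mk D, hD⟩ : Forms (Fn k X)) =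
            ExteriorAlgebra.map (Φ : Normal (pullback i) →ₗ[Fn k X] OneForm (Fn k X))
              (contraction F D) :=
  L.exists_tangent_equiv hx he hΦ p

end Tangent

/-! ### Hadamard's lemma -/

/-- A smooth function differs from its value at a point by a smooth combination of the linear
coordinates that vanish at that point. -/
theorem exists_hadamard {E : Type*} [NormedAddCommGroup E] [NormedSpace ℝ E] {F : E → ℝ}
    (hF : ContDiff ℝ ∞ F) (y : E) : ∃ g : E → E →L[ℝ] ℝ,
      ContDiff ℝ ∞ g ∧ g y = fderiv ℝ F y ∧ ∀ z, F z = F y + g z (z - y) := by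
  have hF' : ContDiff ℝ ∞ (fderiv ℝ F) := hF.fderiv_right le_rfl
  let g : E → E →L[ℝ] ℝ := fun z => ∫ t in (0 : ℝ)..1, fderiv ℝ F (y + t • (z - y))
  -- A cutoff in the integration variable, needed only to have compact support.
  let η : ContDiffBump (0 : ℝ) := ⟨1, 2, one_pos, one_lt_two⟩
  let G : E → ℝ → E →L[ℝ] ℝ := fun z s => η s • fderiv ℝ F (y - s • (z - y))
  have hg : ∀ z, g z = MeasureTheory.convolution (Set.indicator (Set.Ioc (0 : ℝ) 1) 1) (G z)
      (ContinuousLinearMap.lsmul ℝ ℝ) MeasureTheory.volume 0 := fun z => by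
    rw [MeasureTheory.convolution_def]
    simp only [g]
    rw [intervalIntegral.integral_of_le zero_le_one,
      ← MeasureTheory.integral_indicator measurableSet_Ioc]
    congr 1
    ext1 t
    by_cases ht : t ∈ Set.Ioc (0 : ℝ) 1
    · have h1 : η (0 - t) = 1 := η.one_of_mem_closedBall (by
        simp only [zero_sub, Metric.mem_closedBall, dist_zero_right, norm_neg, Real.norm_eq_abs]
        exact abs_le.2 ⟨by linarith [ht.1], ht.2⟩)
      simp only [Set.indicator_of_mem ht, G, h1, ContinuousLinearMap.lsmul_apply, Pi.one_apply,
        one_smul]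
      congr 1
      rw [zero_sub, neg_smul, sub_neg_eq_add]
    · simp only [Set.indicator_of_notMem ht, map_zero, zero_apply]
  have hsmooth : ContDiffOn ℝ ((⊤ : ℕ∞) : ℕ∞ω) (fun q : E × ℝ =>
      MeasureTheory.convolution (Set.indicator (Set.Ioc (0 : ℝ) 1) 1) (G q.1)
        (ContinuousLinearMap.lsmul ℝ ℝ) MeasureTheory.volume q.2) (Set.univ ×ˢ Set.univ) := by
    refine MeasureTheory.contDiffOn_convolution_right_with_param (k := Metric.closedBall 0 2) _
      isOpen_univ (isCompact_closedBall _ _) ?_ ?_ ?_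
    · intro z s _ hs
      have h0 : η s = 0 := η.zero_of_le_dist (not_le.1 hs).le
      simp only [G, h0, zero_smul]
    · refine MeasureTheory.Integrable.locallyIntegrable ?_
      exact (MeasureTheory.integrable_indicator_iff measurableSet_Ioc).2
        (MeasureTheory.integrableOn_const (by simp))
    · refine ContDiff.contDiffOn ?_
      have h1 : ContDiff ℝ ∞ fun q : E × ℝ => η q.2 := η.contDiff.comp contDiff_snd
      have h2 : ContDiff ℝ ∞ fun q : E × ℝ => fderiv ℝ F (y - q.2 • (q.1 - y)) :=
        hF'.comp (contDiff_const.sub (contDiff_snd.smul (contDiff_fst.sub contDiff_const)))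
      exact h1.smul h2
  have hline : ∀ z, Continuous fun t : ℝ => y + t • (z - y) := fun z => by fun_prop
  refine ⟨g, ?_, ?_, fun z => ?_⟩
  · have h := (contDiffOn_univ.1 (Set.univ_prod_univ ▸ hsmooth)).comp
      (contDiff_id.prodMk (contDiff_const (c := (0 : ℝ))))
    have h' : g = (fun q : E × ℝ =>
      MeasureTheory.convolution (Set.indicator (Set.Ioc (0 : ℝ) 1) 1) (G q.1)
        (ContinuousLinearMap.lsmul ℝ ℝ) MeasureTheory.volume q.2) ∘ fun x => (id x, 0) :=
      funext hg
    rw [h']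
    exact h
  · simp [g]
  · have hd : Differentiable ℝ F := hF.differentiable (by simp)
    have h1 : g z (z - y) = ∫ t in (0 : ℝ)..1, fderiv ℝ F (y + t • (z - y)) (z - y) :=
      ContinuousLinearMap.intervalIntegral_apply
        ((hF'.continuous.comp (hline z)).intervalIntegrable _ _) _
    have h2 : ∫ t in (0 : ℝ)..1, fderiv ℝ F (y + t • (z - y)) (z - y) =
        F (y + (1 : ℝ) • (z - y)) - F (y + (0 : ℝ) • (z - y)) := by
      refine intervalIntegral.integral_eq_sub_of_hasDerivAt (f := fun t : ℝ => F (y + t • (z - y)))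
        (fun t _ => ?_) ?_
      · have hl : HasDerivAt (fun t : ℝ => y + t • (z - y)) (z - y) t := by
          simpa using ((hasDerivAt_id t).smul_const (z - y)).const_add y
        exact (hd _).hasFDerivAt.comp_hasDerivAt t hl
      · exact ((hF'.continuous.comp (hline z)).clm_apply continuous_const).intervalIntegrable _ _
    rw [h1, h2]
    simp

/-! ### Coordinates on a manifold, as global functions and vector fields -/

section Charts

variable {n : ℕ} {Y : Type*} [TopologicalSpace Y] [ChartedSpace (EuclideanSpace ℝ (Fin n)) Y]

/-- A tangent vector at the point `z`: a derivation of the algebra of functions at `z`. -/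
def IsPointDerivation (z : Y) (v : Fn n Y →ₗ[ℝ] ℝ) : Prop :=
  ∀ f g, v (f * g) = f z * v g + g z * v f

lemma IsPointDerivation.const {z : Y} {v : Fn n Y →ₗ[ℝ] ℝ} (hv : IsPointDerivation z v) (c : ℝ) :
    v (algebraMap ℝ (Fn n Y) c) = 0 := by
  have h1 := hv 1 1
  have h2 : (1 : Fn n Y) z = 1 := rfl
  rw [h2, mul_one] at h1
  rw [Algebra.algebraMap_eq_smul_one, map_smul]
  have : v 1 = 0 := by linarith
  rw [this, smul_zero]

lemma fn_sum_apply {ι : Type*} (s : Finset ι) (f : ι → Fn n Y) (z : Y) :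
    (∑ a ∈ s, f a) z = ∑ a ∈ s, f a z :=
  map_sum ({ toFun := fun f : Fn n Y => f z, map_zero' := rfl, map_add' := fun _ _ => rfl } :
    Fn n Y →+ ℝ) f s

/-- The value of a vector field at a point. -/
def valueAt (z : Y) (D : Vec (Fn n Y)) : Fn n Y →ₗ[ℝ] ℝ where
  toFun f := D f z
  map_add' f g := by rw [map_add]; rfl
  map_smul' c f := congrArg (fun s : Fn n Y => s z) (D.map_smul c f)

lemma isPointDerivation_valueAt (z : Y) (D : Vec (Fn n Y)) :
    IsPointDerivation z (valueAt z D) := fun f g => by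
  change D (f * g) z = f z * D g z + g z * D f z
  rw [Derivation.leibniz]
  rfl

lemma IsPointDerivation.sum {z : Y} {v : Fn n Y →ₗ[ℝ] ℝ} (hv : IsPointDerivation z v)
    {ι : Type*} [Fintype ι] {χ f : Fn n Y} {y g : ι → Fn n Y} (hχ : χ z ≠ 0)
    (h : ∀ x, χ x * f x = χ x * (f z + ∑ a, (y a x - y a z) * g a x)) :
    v f = ∑ a, v (y a) * g a z := by
  let C : ℝ → Fn n Y := algebraMap ℝ (Fn n Y)
  have hf : χ * f = χ * (C (f z) + ∑ a, (y a - C (y a z)) * g a) := by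
    ext x
    refine (h x).trans ?_
    change _ = χ x * (f z + (∑ a, (y a - C (y a z)) * g a) x)
    rw [fn_sum_apply]
    rfl
  have hval : (∑ a, (y a - C (y a z)) * g a) z = 0 := by
    rw [fn_sum_apply]
    refine Finset.sum_eq_zero fun a _ => ?_
    change (y a z - y a z) * g a z = 0
    rw [sub_self, zero_mul]
  have hsum : v (∑ a, (y a - C (y a z)) * g a) = ∑ a, v (y a) * g a z := by
    rw [map_sum]
    refine Finset.sum_congr rfl fun a _ => ?_
    rw [hv, map_sub, hv.const]
    change (y a z - y a z) * _ + _ = _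
    rw [sub_self, zero_mul, zero_add, sub_zero, mul_comm]
  have h2 := congrArg v hf
  rw [hv, hv, map_add, hv.const, zero_add, hsum] at h2
  have h3 : (C (f z) + ∑ a, (y a - C (y a z)) * g a) z = f z := by
    change f z + (∑ a, (y a - C (y a z)) * g a) z = f z
    rw [hval, add_zero]
  rw [h3] at h2
  exact mul_left_cancel₀ hχ (add_right_cancel h2)

/-- A function in a chart that vanishes off a compact set extends by zero. -/
lemma contMDiff_indicator_chart [T2Space Y]
    {ψ : OpenPartialHomeomorph Y (EuclideanSpace ℝ (Fin n))}
    (hψ : ContMDiffOn (𝓡 n) (𝓡 n) ∞ ψ ψ.source) {K : Set (EuclideanSpace ℝ (Fin n))}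
    (hK : IsCompact K) (hKt : K ⊆ ψ.target) {G : EuclideanSpace ℝ (Fin n) → ℝ}
    (hG : ContDiffOn ℝ ∞ G ψ.target) (h₀ : ∀ p, p ∉ K → G p = 0) :
    ContMDiff (𝓡 n) 𝓘(ℝ) ∞ (ψ.source.indicator (G ∘ ψ)) := by
  intro z
  by_cases hz : z ∈ ψ.source
  · have h1 : ContMDiffAt (𝓡 n) 𝓘(ℝ) ∞ (G ∘ ψ) z :=
      (hG.contDiffAt (ψ.open_target.mem_nhds (ψ.map_source hz))).contMDiffAt.comp z
        (hψ.contMDiffAt (ψ.open_source.mem_nhds hz))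
    refine h1.congr_of_eventuallyEq ?_
    filter_upwards [ψ.open_source.mem_nhds hz] with x hx
    exact Set.indicator_of_mem hx _
  · have hc : IsClosed (ψ.symm '' K) :=
      (hK.image_of_continuousOn (ψ.continuousOn_symm.mono hKt)).isClosed
    have hz' : z ∈ (ψ.symm '' K)ᶜ := by
      rintro ⟨p, hp, rfl⟩
      exact hz (ψ.map_target (hKt hp))
    refine (contMDiffAt_const (c := (0 : ℝ))).congr_of_eventuallyEq ?_
    filter_upwards [hc.isOpen_compl.mem_nhds hz'] with x hx
    by_cases hxs : x ∈ ψ.source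
    · rw [Set.indicator_of_mem hxs]
      exact h₀ _ fun hp => hx ⟨ψ x, hp, ψ.left_inv hxs⟩
    · exact Set.indicator_of_notMem hxs _

/-- Coordinate functions and coordinate vector fields of a chart, cut off outside a ball. -/
theorem exists_cutoff_coordinates [T2Space Y] {J : Type*} [Fintype J] [DecidableEq J]
    {ψ : OpenPartialHomeomorph Y (EuclideanSpace ℝ (Fin n))}
    (hψ : ContMDiffOn (𝓡 n) (𝓡 n) ∞ ψ ψ.source)
    (hψ' : ContMDiffOn (𝓡 n) (𝓡 n) ∞ ψ.symm ψ.target)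
    (bs : Module.Basis J ℝ (EuclideanSpace ℝ (Fin n))) {c : EuclideanSpace ℝ (Fin n)} {r : ℝ}
    (hr : 0 < r) (hsub : Metric.closedBall c (2 * r) ⊆ ψ.target) :
    ∃ (χ : Fn n Y) (y : J → Fn n Y) (e : J → Vec (Fn n Y)),
      (∀ z ∈ ψ.source, ψ z ∈ Metric.ball c (r / 2) → χ z = 1) ∧
      (∀ z, χ z ≠ 0 → z ∈ ψ.source ∧ ∀ a, y a z = bs.repr (ψ z) a) ∧
      (∀ a f z, e a f z ≠ 0 → z ∈ ψ.source ∧ fderiv ℝ (f ∘ ψ.symm) (ψ z) (bs a) ≠ 0) ∧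
      (∀ z, χ z ≠ 0 → ∀ a b, e a (y b) z = if a = b then 1 else 0) ∧
      (∀ z, χ z ≠ 0 → ∀ v : Fn n Y →ₗ[ℝ] ℝ, IsPointDerivation z v →
        ∀ f, v f = ∑ a, v (y a) * e a f z) := by
  let b₀ : ContDiffBump c := ⟨r / 2, r, by linarith, by linarith⟩
  let b₁ : ContDiffBump c := ⟨r, 2 * r, hr, by linarith⟩
  have hK : IsCompact (Metric.closedBall c (2 * r)) := isCompact_closedBall _ _
  have hb₀ : ∀ p, p ∉ Metric.closedBall c (2 * r) → b₀ p = 0 := fun p hp =>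
    b₀.zero_of_le_dist (by
      have := not_le.1 fun h => hp (Metric.mem_closedBall.2 h)
      change r ≤ _
      linarith)
  have hb₁ : ∀ p, p ∉ Metric.closedBall c (2 * r) → b₁ p = 0 := fun p hp =>
    b₁.zero_of_le_dist (not_le.1 fun h => hp (Metric.mem_closedBall.2 h)).le
  have hball : ∀ p, b₀ p ≠ 0 → p ∈ Metric.ball c r := fun p hp => by
    by_contra h
    exact hp (b₀.zero_of_le_dist (not_lt.1 h))
  -- functions in the chart, cut off and extended by zero
  let ext : (G : EuclideanSpace ℝ (Fin n) → ℝ) → ContDiffOn ℝ ∞ G ψ.target → Fn n Y := fun G hG =>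
    ⟨ψ.source.indicator ((fun p => b₁ p * G p) ∘ ψ),
      contMDiff_indicator_chart hψ hK hsub (b₁.contDiff.contDiffOn.mul hG)
        (fun p hp => by rw [hb₁ p hp, zero_mul])⟩
  have ext_apply : ∀ G hG z, z ∈ ψ.source → ext G hG z = b₁ (ψ z) * G (ψ z) :=
    fun G hG z hz => Set.indicator_of_mem hz _
  have ext_apply' : ∀ G hG z, z ∉ ψ.source → ext G hG z = 0 :=
    fun G hG z hz => Set.indicator_of_notMem hz _
  have ext_ball : ∀ G hG z, z ∈ ψ.source → ψ z ∈ Metric.closedBall c r → ext G hG z = G (ψ z) :=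
    fun G hG z hz hzr => by
      rw [ext_apply G hG z hz, b₁.one_of_mem_closedBall hzr, one_mul]
  let χ : Fn n Y := ⟨ψ.source.indicator (b₀ ∘ ψ),
    contMDiff_indicator_chart hψ hK hsub b₀.contDiff.contDiffOn hb₀⟩
  have hχ : ∀ z, χ z ≠ 0 → z ∈ ψ.source ∧ ψ z ∈ Metric.ball c r := fun z hz => by
    have hs : z ∈ ψ.source := by
      by_contra h
      exact hz (Set.indicator_of_notMem h _)
    refine ⟨hs, hball _ ?_⟩
    rwa [show χ z = b₀ (ψ z) from Set.indicator_of_mem hs _] at hz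
  have hlin : ∀ a, ContDiff ℝ ∞ fun p => bs.repr p a := fun a =>
    (LinearMap.toContinuousLinearMap (bs.coord a)).contDiff
  let y : J → Fn n Y := fun a => ext (fun p => bs.repr p a) (hlin a).contDiffOn
  have hf : ∀ f : Fn n Y, ContDiffOn ℝ ∞ (f ∘ ψ.symm) ψ.target := fun f =>
    (f.contMDiff.comp_contMDiffOn hψ').contDiffOn
  have hfd : ∀ (f : Fn n Y), ∀ z ∈ ψ.source, DifferentiableAt ℝ (f ∘ ψ.symm) (ψ z) :=
    fun f z hz => ((hf f).differentiableOn (by simp)).differentiableAt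
      (ψ.open_target.mem_nhds (ψ.map_source hz))
  have hfs : ∀ (f : Fn n Y) a, ContDiffOn ℝ ∞ (fun p => fderiv ℝ (f ∘ ψ.symm) p (bs a)) ψ.target :=
    fun f a => ((hf f).fderiv_of_isOpen ψ.open_target le_rfl).clm_apply contDiffOn_const
  let D : J → Fn n Y → Fn n Y := fun a f =>
    ext (fun p => fderiv ℝ (f ∘ ψ.symm) p (bs a)) (hfs f a)
  have hD : ∀ a f z, z ∈ ψ.source →
      D a f z = b₁ (ψ z) * fderiv ℝ (f ∘ ψ.symm) (ψ z) (bs a) := fun a f z hz =>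
    ext_apply _ (hfs f a) z hz
  have hD' : ∀ a f z, z ∉ ψ.source → D a f z = 0 := fun a f z hz => ext_apply' _ (hfs f a) z hz
  let e : J → Vec (Fn n Y) := fun a => Derivation.mk'
    { toFun := D a
      map_add' := fun f g => by
        ext z
        change D a (f + g) z = D a f z + D a g z
        by_cases hz : z ∈ ψ.source
        · have h : fderiv ℝ ((f + g : Fn n Y) ∘ ψ.symm) (ψ z) = _ :=
            fderiv_add (hfd f z hz) (hfd g z hz)
          rw [hD _ _ z hz, hD _ _ z hz, hD _ _ z hz, h]
          exact mul_add _ _ _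
        · rw [hD' _ _ z hz, hD' _ _ z hz, hD' _ _ z hz, add_zero]
      map_smul' := fun k f => by
        ext z
        change D a (k • f) z = k * D a f z
        by_cases hz : z ∈ ψ.source
        · have h : fderiv ℝ ((k • f : Fn n Y) ∘ ψ.symm) (ψ z) = _ :=
            fderiv_const_smul (hfd f z hz) k
          rw [hD _ _ z hz, hD _ _ z hz, h]
          exact mul_left_comm _ _ _
        · rw [hD' _ _ z hz, hD' _ _ z hz, mul_zero] }
    (fun f g => by
      ext z
      change D a (f * g) z = f z * D a g z + g z * D a f z
      by_cases hz : z ∈ ψ.source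
      · have h : fderiv ℝ ((f * g : Fn n Y) ∘ ψ.symm) (ψ z) = _ :=
          fderiv_mul (hfd f z hz) (hfd g z hz)
        rw [hD _ _ z hz, hD _ _ z hz, hD _ _ z hz, h]
        simp only [ψ.left_inv hz, add_apply, smul_apply, smul_eq_mul]
        change b₁ (ψ z) * (f z * fderiv ℝ (g ∘ ψ.symm) (ψ z) (bs a) +
          g z * fderiv ℝ (f ∘ ψ.symm) (ψ z) (bs a)) = _
        ring
      · rw [hD' _ _ z hz, hD' _ _ z hz, hD' _ _ z hz]
        ring)
  have he : ∀ a f z, z ∈ ψ.source → ψ z ∈ Metric.closedBall c r →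
      e a f z = fderiv ℝ (f ∘ ψ.symm) (ψ z) (bs a) := fun a f z hz hzr =>
    ext_ball _ (hfs f a) z hz hzr
  refine ⟨χ, y, e, fun z hz hzr => ?_, fun z hz => ⟨(hχ z hz).1, fun a => ?_⟩, fun a f z hz => ?_,
    fun z hz a b => ?_, fun z hz v hv f => ?_⟩
  · exact (Set.indicator_of_mem hz _).trans
      (b₀.one_of_mem_closedBall (Metric.ball_subset_closedBall hzr))
  · exact ext_ball _ (hlin a).contDiffOn z (hχ z hz).1 (Metric.ball_subset_closedBall (hχ z hz).2)
  · have hs : z ∈ ψ.source := by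
      by_contra h
      exact hz (hD' a f z h)
    refine ⟨hs, fun h => hz ?_⟩
    refine (hD a f z hs).trans ?_
    rw [h, mul_zero]
  · obtain ⟨hs, hb⟩ := hχ z hz
    rw [he a _ z hs (Metric.ball_subset_closedBall hb)]
    have h1 : (y b ∘ ψ.symm) =ᶠ[nhds (ψ z)]
        LinearMap.toContinuousLinearMap (bs.coord b) := by
      filter_upwards [Metric.isOpen_ball.mem_nhds hb] with p hp
      have hpt : p ∈ ψ.target := hsub (Metric.ball_subset_closedBall
        (Metric.ball_subset_ball (by linarith) hp))
      change y b (ψ.symm p) = _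
      refine (ext_ball _ (hlin b).contDiffOn _ (ψ.map_target hpt) ?_).trans ?_
      · rw [ψ.right_inv hpt]; exact Metric.ball_subset_closedBall hp
      · rw [ψ.right_inv hpt]; rfl
    rw [h1.fderiv_eq, ContinuousLinearMap.fderiv]
    change bs.repr (bs a) b = _
    rw [Module.Basis.repr_self, Finsupp.single_apply]
  · obtain ⟨hs, hb⟩ := hχ z hz
    let F : EuclideanSpace ℝ (Fin n) → ℝ := fun p => b₁ p * f (ψ.symm p)
    have hF : ContDiff ℝ ∞ F := by
      refine contDiff_iff_contDiffAt.2 fun p => ?_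
      by_cases hp : p ∈ ψ.target
      · exact b₁.contDiffAt.mul ((hf f).contDiffAt (ψ.open_target.mem_nhds hp))
      · refine (contDiffAt_const (c := (0 : ℝ))).congr_of_eventuallyEq ?_
        filter_upwards [hK.isClosed.isOpen_compl.mem_nhds fun h => hp (hsub h)] with q hq
        simp only [F, hb₁ q hq, zero_mul]
    obtain ⟨g, hg, hgz, hFg⟩ := exists_hadamard hF (ψ z)
    have hF1 : ∀ x ∈ ψ.source, ψ x ∈ Metric.ball c r → F (ψ x) = f x := fun x hx hxr => by
      simp only [F]
      rw [ψ.left_inv hx, b₁.one_of_mem_closedBall (Metric.ball_subset_closedBall hxr), one_mul]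
    have hgs : ∀ a, ContDiffOn ℝ ∞ (fun p => g p (bs a)) ψ.target := fun a =>
      (hg.clm_apply contDiff_const).contDiffOn
    let G : J → Fn n Y := fun a => ext (fun p => g p (bs a)) (hgs a)
    have hGz : ∀ a, G a z = e a f z := fun a => by
      rw [he a f z hs (Metric.ball_subset_closedBall hb)]
      refine (ext_ball _ (hgs a) z hs (Metric.ball_subset_closedBall hb)).trans ?_
      rw [hgz]
      refine congrArg (fun l : EuclideanSpace ℝ (Fin n) →L[ℝ] ℝ => l (bs a)) ?_
      refine Filter.EventuallyEq.fderiv_eq ?_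
      filter_upwards [Metric.isOpen_ball.mem_nhds hb] with p hp
      simp only [F]
      rw [b₁.one_of_mem_closedBall (Metric.ball_subset_closedBall hp), one_mul]
      rfl
    refine (hv.sum (g := G) hz fun x => ?_).trans
      (Finset.sum_congr rfl fun a _ => by rw [hGz])
    by_cases hx : χ x = 0
    · rw [hx, zero_mul, zero_mul]
    obtain ⟨hxs, hxb⟩ := hχ x hx
    refine congrArg _ ?_
    have hy : ∀ a, y a x - y a z = bs.repr (ψ x - ψ z) a := fun a => by
      rw [map_sub]
      exact congrArg₂ (· - ·) (ext_ball _ (hlin a).contDiffOn x hxs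
          (Metric.ball_subset_closedBall hxb))
        (ext_ball _ (hlin a).contDiffOn z hs (Metric.ball_subset_closedBall hb))
    have hG : ∀ a, G a x = g (ψ x) (bs a) := fun a =>
      ext_ball _ (hgs a) x hxs (Metric.ball_subset_closedBall hxb)
    rw [← hF1 x hxs hxb, hFg, hF1 z hs hb]
    conv_lhs => rw [← bs.sum_repr (ψ x - ψ z), map_sum]
    exact congrArg _ (Finset.sum_congr rfl fun a _ => by rw [hy, hG, map_smul, smul_eq_mul])

end Charts

/-! ### Adapted coordinates along a submanifold -/

section Embedding

variable {m n : ℕ} {X Y : Type*}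
  [TopologicalSpace X] [ChartedSpace (EuclideanSpace ℝ (Fin m)) X]
  [TopologicalSpace Y] [ChartedSpace (EuclideanSpace ℝ (Fin n)) Y]

/-- A chart of the ambient manifold in which the submanifold is a linear subspace. -/
lemma exists_adapted_chart {i : X → Y} (hi : Manifold.IsSmoothEmbedding (𝓡 m) (𝓡 n) ∞ i) (x₀ : X) :
    ∃ (F : Type) (_ : NormedAddCommGroup F) (_ : NormedSpace ℝ F)
      (l : (EuclideanSpace ℝ (Fin m) × F) ≃L[ℝ] EuclideanSpace ℝ (Fin n))
      (ψ : OpenPartialHomeomorph Y (EuclideanSpace ℝ (Fin n)))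
      (η : OpenPartialHomeomorph X (EuclideanSpace ℝ (Fin m))),
      ContMDiffOn (𝓡 n) (𝓡 n) ∞ ψ ψ.source ∧ ContMDiffOn (𝓡 n) (𝓡 n) ∞ ψ.symm ψ.target ∧
      ContMDiffOn (𝓡 m) (𝓡 m) ∞ η.symm η.target ∧ x₀ ∈ η.source ∧
      (∀ x, x ∈ η.source ↔ i x ∈ ψ.source) ∧ ∀ x ∈ η.source, ψ (i x) = l (η x, 0) := by
  obtain ⟨F, _, _, h⟩ := hi.isImmersion.isImmersionAt x₀
  obtain ⟨O, hO, hOs⟩ := hi.isEmbedding.isOpen_iff.1 h.domChart.open_source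
  refine ⟨F, _, _, h.equiv, h.codChart.restrOpen O hO, h.domChart,
    (contMDiffOn_of_mem_maximalAtlas h.codChart_mem_maximalAtlas).mono ?_,
    (contMDiffOn_symm_of_mem_maximalAtlas h.codChart_mem_maximalAtlas).mono ?_,
    contMDiffOn_symm_of_mem_maximalAtlas h.domChart_mem_maximalAtlas,
    h.mem_domChart_source, fun x => ?_, fun x hx => ?_⟩
  · exact fun z hz => hz.1
  · exact fun z hz => hz.1
  · rw [← hOs]
    refine ⟨fun hx => ⟨h.source_subset_preimage_source ?_, hx⟩, fun hx => hx.2⟩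
    rw [← hOs]; exact hx
  · have h1 := h.writtenInCharts (show h.domChart x ∈ (h.domChart.extend (𝓡 m)).target by
      simpa using h.domChart.map_source hx)
    simpa [h.domChart.left_inv hx] using h1

/-- Smooth functions on a compact submanifold extend to the ambient manifold. -/
theorem pullback_surjective [IsManifold (𝓡 n) ∞ Y] [T2Space Y] [SigmaCompactSpace Y]
    [CompactSpace X] {i : C^∞⟮𝓡 m, X; 𝓡 n, Y⟯}
    (hi : Manifold.IsSmoothEmbedding (𝓡 m) (𝓡 n) ∞ i) : Function.Surjective (pullback i) := by
  intro s
  have hcl : IsClosed (Set.range i) := (isCompact_range i.contMDiff.continuous).isClosed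
  obtain ⟨f, hf⟩ := exists_contMDiffMap_forall_mem_convex_of_local (𝓡 n) (n := ⊤) (F := ℝ)
    (t := fun y => {r | ∀ x, i x = y → r = s x}) (fun y a ha b hb p q _ _ hpq x hx => by
      have h1 : a = s x := ha x hx
      have h2 : b = s x := hb x hx
      rw [h1, h2, ← add_smul, hpq, one_smul]) (fun y => by
      by_cases hy : y ∈ Set.range i
      · obtain ⟨x₀, rfl⟩ := hy
        obtain ⟨F, _, _, l, ψ, η, hψ, -, hη, hx₀, hsrc, hl⟩ := exists_adapted_chart hi x₀
        let q : Y → EuclideanSpace ℝ (Fin m) := fun y => (l.symm (ψ y)).1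
        have hq : ContMDiffOn (𝓡 n) (𝓡 m) ∞ q ψ.source := by
          have h : ContDiff ℝ ∞ fun p => (l.symm p).1 := l.symm.contDiff.fst
          exact h.contMDiff.comp_contMDiffOn hψ
        have hq' : ∀ x ∈ η.source, q (i x) = η x := fun x hx => by
          simp only [q, hl x hx, l.symm_apply_apply]
        refine ⟨ψ.source ∩ q ⁻¹' η.target, ?_, s ∘ η.symm ∘ q, ?_, ?_⟩
        · refine (hq.continuousOn.isOpen_inter_preimage ψ.open_source η.open_target).mem_nhds
            ⟨(hsrc x₀).1 hx₀, ?_⟩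
          rw [Set.mem_preimage, hq' x₀ hx₀]
          exact η.map_source hx₀
        · exact s.contMDiff.comp_contMDiffOn
            (hη.comp (hq.mono Set.inter_subset_left) fun z hz => hz.2)
        · rintro _ hz x rfl
          have hx := (hsrc x).2 hz.1
          simp only [Function.comp_apply, hq' x hx, η.left_inv hx]
      · exact ⟨(Set.range i)ᶜ, hcl.isOpen_compl.mem_nhds hy, fun _ => 0, contMDiffOn_const,
          fun z hz x hx => (hz ⟨x, hx⟩).elim⟩)
  refine ⟨f, ?_⟩
  ext x
  exact hf (i x) x rfl

/-- Coordinate functions and coordinate vector fields of `Y` near a point of the submanifold `X`,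
cut off so as to be global: the expansion of tangent vectors is valid where `cut` does not vanish.
The vector fields with index in `J` are tangent to `X`, and the coordinates with index in `J'`
vanish on `X`. -/
structure AdaptedCoordinates (i : C^∞⟮𝓡 m, X; 𝓡 n, Y⟯) (J J' : Type*) [Fintype J] [Fintype J']
    [DecidableEq J] [DecidableEq J'] where
  cut : Fn n Y
  coord : J ⊕ J' → Fn n Y
  field : J ⊕ J' → Vec (Fn n Y)
  expand : ∀ z, cut z ≠ 0 → ∀ v : Fn n Y →ₗ[ℝ] ℝ, IsPointDerivation z v →
    ∀ f, v f = ∑ a, v (coord a) * field a f z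
  dual : ∀ z, cut z ≠ 0 → ∀ a b, field a (coord b) z = if a = b then 1 else 0
  tangent : ∀ a f, (∀ x, f (i x) = 0) → ∀ x, field (Sum.inl a) f (i x) = 0
  normal : ∀ b x, cut (i x) ≠ 0 → coord (Sum.inr b) (i x) = 0

/-- In a chart that makes the submanifold a linear subspace, a basis of this subspace is extended to
a basis of the ambient space. -/
theorem exists_adaptedCoordinates [T2Space Y] {k : ℕ} (hk : m + k = n)
    {i : C^∞⟮𝓡 m, X; 𝓡 n, Y⟯} (hi : Manifold.IsSmoothEmbedding (𝓡 m) (𝓡 n) ∞ i) (x₀ : X) :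
    ∃ A : AdaptedCoordinates i (Fin m) (Fin k),
      ∃ U, IsOpen U ∧ i x₀ ∈ U ∧ ∀ z ∈ U, A.cut z = 1 := by
  obtain ⟨F, _, _, l, ψ, η, hψ, hψ', hη, hx₀, hsrc, hl⟩ := exists_adapted_chart hi x₀
  have hF : Module.Finite ℝ F := Module.Finite.of_surjective
    ((LinearMap.snd ℝ (EuclideanSpace ℝ (Fin m)) F) ∘ₗ l.symm.toLinearEquiv.toLinearMap)
    fun f => ⟨l (0, f), by simp⟩
  have hdim : Module.finrank ℝ F = k := by
    have h := l.toLinearEquiv.finrank_eq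
    rw [Module.finrank_prod, finrank_euclideanSpace_fin, finrank_euclideanSpace_fin] at h
    omega
  let bs : Module.Basis (Fin m ⊕ Fin k) ℝ (EuclideanSpace ℝ (Fin n)) :=
    (((EuclideanSpace.basisFun (Fin m) ℝ).toBasis).prod
      (Module.finBasisOfFinrankEq ℝ F hdim)).map l.toLinearEquiv
  have hbs : ∀ a, ∃ u, bs (Sum.inl a) = l (u, 0) := fun a => ⟨_, by simp [bs]; rfl⟩
  have hbs' : ∀ u b, bs.repr (l (u, 0)) (Sum.inr b) = 0 := fun u b => by simp [bs]
  obtain ⟨r, hr, hsub⟩ : ∃ r, 0 < r ∧ Metric.closedBall (ψ (i x₀)) (2 * r) ⊆ ψ.target := by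
    obtain ⟨r, hr, h⟩ := Metric.nhds_basis_closedBall.mem_iff.1
      (ψ.open_target.mem_nhds (ψ.map_source ((hsrc x₀).1 hx₀)))
    exact ⟨r / 2, by linarith, by rwa [mul_div_cancel₀ r two_ne_zero]⟩
  obtain ⟨χ, y, e, h1, h2, h3, h4, h5⟩ := exists_cutoff_coordinates hψ hψ' bs hr hsub
  refine ⟨⟨χ, y, e, h5, h4, fun a f hf x => ?_, fun b x hx => ?_⟩,
    ψ.source ∩ ψ ⁻¹' Metric.ball (ψ (i x₀)) (r / 2),
    ψ.isOpen_inter_preimage Metric.isOpen_ball,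
    ⟨(hsrc x₀).1 hx₀, Metric.mem_ball_self (by linarith)⟩, fun z hz => h1 z hz.1 hz.2⟩
  · by_contra h
    obtain ⟨hs, h'⟩ := h3 _ f _ h
    have hx := (hsrc x).2 hs
    apply h'
    obtain ⟨u, hu⟩ := hbs a
    rw [hu, hl x hx]
    have hd : DifferentiableAt ℝ (f ∘ ψ.symm) (l (η x, 0)) := by
      rw [← hl x hx]
      exact ((f.contMDiff.comp_contMDiffOn hψ').contDiffOn.differentiableOn
        (by simp)).differentiableAt (ψ.open_target.mem_nhds (ψ.map_source hs))
    -- the function vanishes on the linear subspace that represents the submanifold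
    have hz : ((f ∘ ψ.symm) ∘ fun u : EuclideanSpace ℝ (Fin m) => l (u, 0)) =ᶠ[nhds (η x)]
        fun _ => 0 := by
      filter_upwards [η.open_target.mem_nhds (η.map_source hx)] with u hu
      have hu' := η.map_target hu
      have h6 := hl _ hu'
      rw [η.right_inv hu] at h6
      change f (ψ.symm (l (u, 0))) = 0
      rw [← h6, ψ.left_inv ((hsrc _).1 hu'), hf]
    have hlin : HasFDerivAt (fun u : EuclideanSpace ℝ (Fin m) => l (u, 0))
        (l.toContinuousLinearMap ∘L ContinuousLinearMap.inl ℝ _ F) (η x) :=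
      (l.toContinuousLinearMap ∘L ContinuousLinearMap.inl ℝ _ F).hasFDerivAt
    have h7 := (hd.hasFDerivAt.comp (η x) hlin).fderiv
    rw [hz.fderiv_eq, fderiv_fun_const] at h7
    exact (congrArg (fun L : EuclideanSpace ℝ (Fin m) →L[ℝ] ℝ => L u) h7).symm
  · obtain ⟨hs, h⟩ := h2 _ hx
    rw [h, hl x ((hsrc x).2 hs), hbs']

end Embedding

section Atlas

variable {m n : ℕ} {X Y : Type*}
  [TopologicalSpace X] [ChartedSpace (EuclideanSpace ℝ (Fin m)) X]
  [TopologicalSpace Y] [ChartedSpace (EuclideanSpace ℝ (Fin n)) Y]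

/-- Finitely many systems of adapted coordinates, glued by weights that sum up to `1` near the
submanifold. -/
structure AdaptedAtlas (i : C^∞⟮𝓡 m, X; 𝓡 n, Y⟯) (k : ℕ) where
  size : ℕ
  chart : Fin size → AdaptedCoordinates i (Fin m) (Fin k)
  weight : Fin size → Fn n Y
  domain : Set Y
  isOpen_domain : IsOpen domain
  range_subset : Set.range i ⊆ domain
  cut_ne_zero : ∀ j z, weight j z ≠ 0 → (chart j).cut z ≠ 0
  sum_weight : ∀ z ∈ domain, ∑ j, weight j z = 1

/-- By compactness, finitely many systems of adapted coordinates suffice. -/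
theorem exists_adaptedAtlas [T2Space Y] [CompactSpace X] {k : ℕ} (hk : m + k = n)
    {i : C^∞⟮𝓡 m, X; 𝓡 n, Y⟯} (hi : Manifold.IsSmoothEmbedding (𝓡 m) (𝓡 n) ∞ i) :
    Nonempty (AdaptedAtlas i k) := by
  choose A U hU hxU hA using exists_adaptedCoordinates hk hi
  obtain ⟨t, ht⟩ := isCompact_univ.elim_finite_subcover (fun x => i ⁻¹' U x)
    (fun x => (hU x).preimage i.contMDiff.continuous) (fun x _ => Set.mem_iUnion.2 ⟨x, hxU x⟩)
  let p : Fin t.card → X := fun j => t.equivFin.symm j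
  -- With the cutoffs `χ_j` the weights are `χ_j ∏_{l < j} (1 - χ_l)`; they sum up to
  -- `1 - ∏ (1 - χ_j)`, which is `1` as soon as one of the cutoffs is.
  let W : Fin t.card → Fn n Y := fun j =>
    (A (p j)).cut * ∏ l ∈ Finset.univ with l < j, (1 - (A (p l)).cut)
  have hW : ∑ j, W j = 1 - ∏ j, (1 - (A (p j)).cut) := by
    rw [Finset.prod_one_sub_ordered, sub_sub_cancel]
  refine ⟨⟨t.card, fun j => A (p j), W, ⋃ j, U (p j), isOpen_iUnion fun j => hU _, ?_, ?_, ?_⟩⟩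
  · rintro _ ⟨x, rfl⟩
    obtain ⟨y, hy, hxy⟩ := Set.mem_iUnion₂.1 (ht (Set.mem_univ x))
    refine Set.mem_iUnion.2 ⟨t.equivFin ⟨y, hy⟩, ?_⟩
    simp only [p, Equiv.symm_apply_apply]
    exact hxy
  · intro j z hz h
    refine hz ?_
    change (A (p j)).cut z * _ = 0
    rw [h, zero_mul]
  · intro z hz
    obtain ⟨j, hj⟩ := Set.mem_iUnion.1 hz
    have h0 : (∏ j, (1 - (A (p j)).cut)) z = 0 := by
      rw [← Finset.mul_prod_erase _ _ (Finset.mem_univ j)]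
      change (1 - (A (p j)).cut z) * _ = 0
      rw [hA _ z hj, sub_self, zero_mul]
    rw [← fn_sum_apply, hW]
    change 1 - (∏ j, (1 - (A (p j)).cut)) z = 1
    rw [h0, sub_zero]

namespace AdaptedAtlas

variable {i : C^∞⟮𝓡 m, X; 𝓡 n, Y⟯} {k : ℕ} (A : AdaptedAtlas i k)

/-- The coordinate functions of the atlas. -/
def x (p : Fin A.size × (Fin m ⊕ Fin k)) : Fn n Y := (A.chart p.1).coord p.2

/-- The coordinate vector fields of the atlas, multiplied with the weights. -/
def e (p : Fin A.size × (Fin m ⊕ Fin k)) : Vec (Fn n Y) := A.weight p.1 • (A.chart p.1).field p.2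

lemma expand_point {z : Y} (hz : z ∈ A.domain) {v : Fn n Y →ₗ[ℝ] ℝ} (hv : IsPointDerivation z v)
    (f : Fn n Y) : v f = ∑ p, v (A.x p) * A.e p f z := by
  have h : ∀ j, A.weight j z * v f =
      ∑ a, v ((A.chart j).coord a) * (A.weight j z * (A.chart j).field a f z) := fun j => by
    by_cases h : A.weight j z = 0
    · simp [h]
    · rw [(A.chart j).expand z (A.cut_ne_zero j z h) v hv f, Finset.mul_sum]
      exact Finset.sum_congr rfl fun a _ => mul_left_comm _ _ _
  rw [Fintype.sum_prod_type, ← one_mul (v f), ← A.sum_weight z hz, Finset.sum_mul]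
  exact Finset.sum_congr rfl fun j _ => h j

lemma expand_field (D : Vec (Fn n Y)) (f : Fn n Y) {z : Y} (hz : z ∈ A.domain) :
    D f z = ∑ p, D (A.x p) z * A.e p f z :=
  A.expand_point hz (isPointDerivation_valueAt z D) f

/-- The frame along the submanifold given by an atlas. -/
def toFrame : Frame i where
  size := Fintype.card (Fin A.size × (Fin m ⊕ Fin k))
  x a := A.x ((Fintype.equivFin _).symm a)
  e a := A.e ((Fintype.equivFin _).symm a)
  domain := A.domain
  isOpen_domain := A.isOpen_domain
  range_subset := A.range_subset
  expand D f z hz := by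
    rw [A.expand_field D f hz]
    exact ((Fintype.equivFin _).symm.sum_comp fun p => D (A.x p) z * A.e p f z).symm

lemma along_expand (δ : AlongField (pullback i)) (f : Fn n Y) :
    alongVal δ f = ∑ p, alongVal δ (A.x p) * pullback i (A.e p f) := by
  ext x
  let v : Fn n Y →ₗ[ℝ] ℝ :=
    { toFun := fun f => alongVal δ f x
      map_add' := fun f g => congrArg (fun s : Fn m X => s x) (map_add δ f g)
      map_smul' := fun c f => congrArg (fun s : Fn m X => s x) (δ.map_smul c f) }
  have hv : IsPointDerivation (i x) v := fun f g =>
    congrArg (fun s : Fn m X => s x) (δ.leibniz f g)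
  rw [fn_sum_apply]
  exact A.expand_point (A.range_subset ⟨x, rfl⟩) hv f

lemma along_sum (δ : AlongField (pullback i)) :
    ∑ p, alongVal δ (A.x p) • restrictField (pullback i) (A.e p) = δ := by
  ext f
  rw [← Derivation.coeFnAddMonoidHom_apply, map_sum, Finset.sum_apply]
  exact (A.along_expand δ f).symm

lemma exists_lift (A : AdaptedAtlas i k) (hφ : Function.Surjective (pullback i))
    (δ : AlongField (pullback i)) :
    ∃ D, restrictField (pullback i) D = δ := by
  choose g hg using fun p => hφ (alongVal δ (A.x p))
  refine ⟨∑ p, g p • A.e p, ?_⟩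
  conv_rhs => rw [← A.along_sum δ]
  ext f
  rw [restrictField_apply, ← Derivation.coeFnAddMonoidHom_apply,
    ← Derivation.coeFnAddMonoidHom_apply, map_sum, map_sum, Finset.sum_apply, Finset.sum_apply,
    map_sum]
  refine Finset.sum_congr rfl fun p _ => ?_
  rw [← hg]
  exact map_mul (pullback i) _ _

end AdaptedAtlas

end Atlas

/-! ### The identification of the normal bundle of a Lagrangian submanifold -/

section Descent

variable {R S : Type*} [CommRing R] [Algebra ℝ R] [CommRing S] [Algebra ℝ S] {φ : R →ₐ[ℝ] S}

/-- A vector field that preserves the ideal of a submanifold restricts to the submanifold. -/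
lemma exists_extends_of_preserves (hφ : Function.Surjective φ) (D : Vec R)
    (h : ∀ f, φ f = 0 → φ (D f) = 0) : ∃ E : Vec S, Extends φ D E := by
  obtain ⟨σ, hσ⟩ := hφ.hasRightInverse
  have key : ∀ f g, φ f = φ g → φ (D f) = φ (D g) := fun f g hfg => by
    have := h (f - g) (by rw [map_sub, hfg, sub_self])
    rwa [map_sub, map_sub, sub_eq_zero] at this
  refine ⟨Derivation.mk'
    { toFun := fun s => φ (D (σ s))
      map_add' := fun s t => by
        rw [← map_add, ← map_add]
        exact key _ _ (by rw [map_add, hσ, hσ, hσ])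
      map_smul' := fun c s => by
        rw [RingHom.id_apply, ← map_smul φ, ← D.map_smul]
        exact key _ _ (by rw [map_smul, hσ, hσ]) } (fun s t => ?_), fun f => ?_⟩
  · change φ (D (σ (s * t))) = s * φ (D (σ t)) + t * φ (D (σ s))
    rw [key _ (σ s * σ t) (by rw [map_mul, hσ, hσ, hσ]), Derivation.leibniz, smul_eq_mul,
      smul_eq_mul, map_add, map_mul, map_mul, hσ, hσ]
  · exact key _ _ (hσ _).symm

lemma normalPart_surjective (h : ∀ δ : AlongField φ, ∃ D, restrictField φ D = δ) (ν : Normal φ) :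
    ∃ D, normalPart φ D = ν := by
  obtain ⟨δ, rfl⟩ := Submodule.Quotient.mk_surjective _ ν
  obtain ⟨D, rfl⟩ := h δ
  exact ⟨D, rfl⟩

lemma IsCanonical.unique {w : SymplecticForm R}
    (h : ∀ δ : AlongField φ, ∃ D, restrictField φ D = δ) {Φ Φ' : Normal φ ≃ₗ[S] OneForm S}
    (hΦ : IsCanonical w φ Φ) (hΦ' : IsCanonical w φ Φ') : Φ = Φ' := by
  ext ν V
  obtain ⟨D, rfl⟩ := normalPart_surjective h ν
  obtain ⟨D', hD'⟩ := h (pushField φ V)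
  have hV : Extends φ D' V := fun f => congrArg (fun δ : AlongField φ => alongVal δ f) hD'
  rw [hΦ D D' V hV, hΦ' D D' V hV]

/-- The value of a section of `TY|_X` on a function, as a linear function of the section. -/
def alongEval (φ : R →ₐ[ℝ] S) (f : R) : AlongField φ →ₗ[S] S where
  toFun δ := alongVal δ f
  map_add' _ _ := rfl
  map_smul' _ _ := rfl

end Descent

section Bump

variable {m n : ℕ} {X Y : Type*}
  [TopologicalSpace X] [ChartedSpace (EuclideanSpace ℝ (Fin m)) X] [CompactSpace X]
  [TopologicalSpace Y] [ChartedSpace (EuclideanSpace ℝ (Fin n)) Y]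
  [IsManifold (𝓡 n) ∞ Y] [T2Space Y] [SigmaCompactSpace Y]

lemma exists_bump (i : C^∞⟮𝓡 m, X; 𝓡 n, Y⟯) {U : Set Y} (hU : IsOpen U) (h : Set.range i ⊆ U) :
    ∃ b : Fn n Y, pullback i b = 1 ∧ ∀ f : Fn n Y, (∀ z ∈ U, f z = 0) → b * f = 0 := by
  obtain ⟨b, h0, h1, -⟩ := exists_contMDiffMap_zero_one_of_isClosed (n := ⊤) (𝓡 n)
    hU.isClosed_compl (isCompact_range i.contMDiff.continuous).isClosed
    (Set.disjoint_compl_left_iff_subset.2 h)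
  refine ⟨b, ?_, fun f hf => ?_⟩
  · ext x
    exact h1 ⟨x, rfl⟩
  · ext z
    change b z * f z = 0
    by_cases hz : z ∈ U
    · rw [hf z hz, mul_zero]
    · rw [h0 hz]
      exact zero_mul _

end Bump

namespace AdaptedAtlas

section Tangent

variable {m n k : ℕ} {X Y : Type*}
  [TopologicalSpace X] [ChartedSpace (EuclideanSpace ℝ (Fin m)) X]
  [TopologicalSpace Y] [ChartedSpace (EuclideanSpace ℝ (Fin n)) Y]
  {i : C^∞⟮𝓡 m, X; 𝓡 n, Y⟯} (A : AdaptedAtlas i k)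

lemma exists_extends_field (A : AdaptedAtlas i k) (hφ : Function.Surjective (pullback i))
    (j : Fin A.size) (a : Fin m) :
    ∃ E, Extends (pullback i) ((A.chart j).field (Sum.inl a)) E :=
  exists_extends_of_preserves hφ _ fun f hf => by
    ext x
    exact (A.chart j).tangent a f (fun x => congrArg (fun s : Fn m X => s x) hf) x

lemma exists_extends_e (A : AdaptedAtlas i k) (hφ : Function.Surjective (pullback i))
    (q : Fin A.size × Fin m) :
    ∃ E, Extends (pullback i) (A.e (q.1, Sum.inl q.2)) E := by
  obtain ⟨E, hE⟩ := A.exists_extends_field hφ q.1 q.2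
  refine ⟨pullback i (A.weight q.1) • E, fun f => ?_⟩
  change pullback i (_ * _) = _ * _
  rw [map_mul]
  exact congrArg _ (hE f)

variable (hφ : Function.Surjective (pullback i))

/-- The coordinates and coordinate vector fields of the submanifold. -/
def vecFrame : VecFrame (Fin A.size × Fin m) (Fn m X) where
  coord q := pullback i (A.x (q.1, Sum.inl q.2))
  field q := (A.exists_extends_e hφ q).choose

lemma extends_field (q : Fin A.size × Fin m) :
    Extends (pullback i) (A.e (q.1, Sum.inl q.2)) ((A.vecFrame hφ).field q) :=
  (A.exists_extends_e hφ q).choose_spec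

/-- Where the normal coordinates are defined, they vanish along the submanifold, and so do their
tangential derivatives. -/
lemma tangent_normal (V : Vec (Fn m X)) (j : Fin A.size) (b : Fin k) {x : X}
    (hx : (A.chart j).cut (i x) ≠ 0) :
    V (pullback i ((A.chart j).coord (Sum.inr b))) x = 0 := by
  let C := A.chart j
  have h0 : pullback i C.cut * pullback i (C.coord (Sum.inr b)) = 0 := by
    ext y
    change C.cut (i y) * C.coord (Sum.inr b) (i y) = 0
    by_cases hy : C.cut (i y) = 0
    · rw [hy, zero_mul]
    · rw [C.normal b y hy, mul_zero]
  have h1 := congrArg (fun s : Fn m X => V s x) h0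
  simp only [Derivation.leibniz, map_zero] at h1
  change C.cut (i x) * V (pullback i (C.coord (Sum.inr b))) x +
    C.coord (Sum.inr b) (i x) * _ = 0 at h1
  rw [C.normal b x hx, zero_mul, add_zero] at h1
  exact (mul_eq_zero.1 h1).resolve_left hx

/-- A section of `TY|_X` whose normal coordinates vanish is determined by its tangential
coordinates. -/
lemma along_eq_sum (δ : AlongField (pullback i))
    (h : ∀ j b x, A.weight j (i x) ≠ 0 → alongVal δ ((A.chart j).coord (Sum.inr b)) x = 0)
    (f : Fn n Y) :
    alongVal δ f = ∑ q : Fin A.size × Fin m, alongVal δ (A.x (q.1, Sum.inl q.2)) *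
      (A.vecFrame hφ).field q (pullback i f) := by
  rw [A.along_expand, Fintype.sum_prod_type, Fintype.sum_prod_type]
  refine Finset.sum_congr rfl fun j _ => ?_
  rw [Fintype.sum_sum_type]
  have h0 : ∀ b, alongVal δ (A.x (j, Sum.inr b)) * pullback i (A.e (j, Sum.inr b) f) = 0 :=
    fun b => by
      ext x
      change alongVal δ ((A.chart j).coord (Sum.inr b)) x * (A.weight j (i x) * _) = 0
      by_cases hw : A.weight j (i x) = 0
      · rw [hw, zero_mul, mul_zero]
      · rw [h j b x hw, zero_mul]
  rw [Finset.sum_eq_zero fun b _ => h0 b, add_zero]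
  exact Finset.sum_congr rfl fun a _ => congrArg _ (A.extends_field hφ (j, a) f)

lemma vecFrame_expands : (A.vecFrame hφ).Expands := fun V s => by
  obtain ⟨f, rfl⟩ := hφ s
  exact A.along_eq_sum hφ (pushField (pullback i) V)
    (fun j b x hx => A.tangent_normal V j b (A.cut_ne_zero j _ hx)) f

/-- A projection of `TY|_X` onto `TX`. -/
def proj : AlongField (pullback i) →ₗ[Fn m X] Vec (Fn m X) :=
  ∑ q : Fin A.size × Fin m,
    (alongEval (pullback i) (A.x (q.1, Sum.inl q.2))).smulRight ((A.vecFrame hφ).field q)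

lemma proj_apply (δ : AlongField (pullback i)) (s : Fn m X) :
    A.proj hφ δ s = ∑ q : Fin A.size × Fin m,
      alongVal δ (A.x (q.1, Sum.inl q.2)) * (A.vecFrame hφ).field q s := by
  rw [proj, LinearMap.sum_apply, ← Derivation.coeFnAddMonoidHom_apply, map_sum, Finset.sum_apply]
  rfl

lemma proj_pushField (V : Vec (Fn m X)) : A.proj hφ (pushField (pullback i) V) = V := by
  ext1 s
  rw [A.proj_apply]
  exact (A.vecFrame_expands hφ V s).symm

/-- A section of `TY|_X` is tangent if its normal coordinates vanish. -/
lemma mem_range_pushField (hφ : Function.Surjective (pullback i))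
    (δ : AlongField (pullback i))
    (h : ∀ j b x, A.weight j (i x) ≠ 0 → alongVal δ ((A.chart j).coord (Sum.inr b)) x = 0) :
    δ ∈ LinearMap.range (pushField (pullback i)) := by
  refine ⟨A.proj hφ δ, ?_⟩
  ext1 f
  exact (A.proj_apply hφ δ _).trans (A.along_eq_sum hφ δ h f).symm

end Tangent

end AdaptedAtlas

section Canonical

variable {m n k : ℕ} {X Y : Type*}
  [TopologicalSpace X] [ChartedSpace (EuclideanSpace ℝ (Fin m)) X] [CompactSpace X]
  [TopologicalSpace Y] [ChartedSpace (EuclideanSpace ℝ (Fin n)) Y]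
  [IsManifold (𝓡 n) ∞ Y] [T2Space Y] [SigmaCompactSpace Y]
  {i : C^∞⟮𝓡 m, X; 𝓡 n, Y⟯}

namespace AdaptedAtlas

/-- Along the submanifold, the values of a linear form on vector fields depend only on the
restrictions of the vector fields. -/
lemma map_oneForm_expand (A : AdaptedAtlas i k) (β : OneForm (Fn n Y)) (D : Vec (Fn n Y)) :
    pullback i (β D) = ∑ p, pullback i (D (A.x p)) * pullback i (β (A.e p)) := by
  obtain ⟨b, hb, hb0⟩ := exists_bump i A.isOpen_domain A.range_subset
  have h : b • (D - ∑ p, D (A.x p) • A.e p) = 0 := by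
    ext1 f
    refine hb0 _ fun z hz => ?_
    change (D f - (∑ p, D (A.x p) • A.e p : Vec (Fn n Y)) f) z = 0
    rw [← Derivation.coeFnAddMonoidHom_apply (∑ p, D (A.x p) • A.e p), map_sum, Finset.sum_apply]
    change D f z - (∑ p, D (A.x p) * A.e p f) z = 0
    rw [fn_sum_apply, sub_eq_zero]
    exact A.expand_field D f hz
  have h1 := congrArg (fun D => pullback i (β D)) h
  rw [map_smul, map_sub, map_sum, map_zero, map_zero, smul_eq_mul, map_mul, hb, one_mul, map_sub,
    map_sum, sub_eq_zero] at h1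
  simpa only [map_smul, smul_eq_mul, map_mul] using h1

lemma map_form_expand (A : AdaptedAtlas i k) (w : SymplecticForm (Fn n Y)) (D D' : Vec (Fn n Y)) :
    pullback i (w.form D D') =
      ∑ p, pullback i (D (A.x p)) * pullback i (w.form (A.e p) D') := by
  rw [w.form_swap, map_neg, A.map_oneForm_expand, ← Finset.sum_neg_distrib]
  refine Finset.sum_congr rfl fun p _ => ?_
  rw [w.form_swap D', map_neg, mul_neg, neg_neg]

/-- The value of the symplectic form at a point of the submanifold, in adapted coordinates. -/
lemma form_expand_point (A : AdaptedAtlas i k) (w : SymplecticForm (Fn n Y)) (j : Fin A.size)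
    {x : X} (hx : (A.chart j).cut (i x) ≠ 0) (D D' : Vec (Fn n Y)) :
    w.form D D' (i x) = ∑ a, D ((A.chart j).coord a) (i x) *
      w.form ((A.chart j).field a) D' (i x) := by
  let C := A.chart j
  -- the coefficients, frozen at the point
  let c : Fin m ⊕ Fin k → Fn n Y := fun a => algebraMap ℝ (Fn n Y) (D (C.coord a) (i x))
  have h0 : ∀ f, (D - ∑ a, c a • C.field a) f (i x) = 0 := fun f => by
    rw [Derivation.sub_apply, ← Derivation.coeFnAddMonoidHom_apply (∑ a, c a • C.field a),
      map_sum, Finset.sum_apply]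
    change D f (i x) - (∑ a, c a * C.field a f) (i x) = 0
    rw [fn_sum_apply, sub_eq_zero]
    exact C.expand (i x) hx (valueAt (i x) D) (isPointDerivation_valueAt _ D) f
  have h1 : w.form (D - ∑ a, c a • C.field a) D' (i x) = 0 := by
    refine (congrArg (fun s : Fn m X => s x) (A.map_form_expand w _ D')).trans ?_
    rw [fn_sum_apply]
    refine Finset.sum_eq_zero fun p _ => ?_
    change (D - ∑ a, c a • C.field a) (A.x p) (i x) * _ = 0
    rw [h0, zero_mul]
  rw [map_sub, map_sum, LinearMap.sub_apply, LinearMap.sum_apply] at h1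
  change w.form D D' (i x) - (∑ a, w.form (c a • C.field a) D' : Fn n Y) (i x) = 0 at h1
  rw [fn_sum_apply, sub_eq_zero] at h1
  rw [h1]
  refine Finset.sum_congr rfl fun a _ => ?_
  rw [map_smul]
  rfl

/-- The map `TY|_X → Ω¹X`, `δ ↦ ω(δ, ·)|_{TX}`. -/
def interior (A : AdaptedAtlas i k) (w : SymplecticForm (Fn n Y)) :
    AlongField (pullback i) →ₗ[Fn m X] OneForm (Fn m X) :=
  ∑ p, (alongEval (pullback i) (A.x p)).smulRight
    (∑ q, pullback i (w.form (A.e p) (A.e q)) • differential (pullback i (A.x q)))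

lemma interior_apply (A : AdaptedAtlas i k) (w : SymplecticForm (Fn n Y)) (D D' : Vec (Fn n Y))
    (V : Vec (Fn m X)) (hV : Extends (pullback i) D' V) :
    A.interior w (restrictField (pullback i) D) V = pullback i (w.form D D') := by
  rw [interior, LinearMap.sum_apply, LinearMap.sum_apply, A.map_form_expand]
  refine Finset.sum_congr rfl fun p _ => ?_
  rw [LinearMap.smulRight_apply, LinearMap.smul_apply, LinearMap.sum_apply, A.map_oneForm_expand]
  refine congrArg (pullback i (D (A.x p)) * ·) (Finset.sum_congr rfl fun q _ => ?_)
  rw [hV, mul_comm]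
  rfl

lemma interior_surjective (A : AdaptedAtlas i k) (w : SymplecticForm (Fn n Y))
    (hφ : Function.Surjective (pullback i)) : Function.Surjective (A.interior w) := fun α => by
  -- the functional `α ∘ proj` on `TY|_X` extends to a 1-form on `Y`, represented by a vector field
  choose g hg using fun q => hφ (α (A.proj hφ (restrictField (pullback i) (A.e q))))
  obtain ⟨D, hD⟩ := w.nondegenerate.2 (∑ q, g q • differential (A.x q))
  refine ⟨restrictField (pullback i) D, ?_⟩
  ext1 V
  obtain ⟨D', hD'⟩ := A.exists_lift hφ (pushField (pullback i) V)
  have hV : Extends (pullback i) D' V :=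
    fun f => congrArg (fun δ : AlongField (pullback i) => alongVal δ f) hD'
  rw [A.interior_apply w D D' V hV, hD, LinearMap.sum_apply, map_sum]
  conv_rhs => rw [← A.proj_pushField hφ V, ← A.along_sum (pushField (pullback i) V),
    map_sum, map_sum]
  refine Finset.sum_congr rfl fun q _ => ?_
  rw [map_smul, map_smul, ← hg, LinearMap.smul_apply, smul_eq_mul, map_mul, mul_comm]
  exact congrArg (· * _) (hV _)

/-- The kernel of `δ ↦ ω(δ, ·)|_{TX}` consists of tangent fields: at a point of `X`, the pairing
of the normal with the tangential coordinate directions is a square matrix, and it is invertible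
since every covector of `X` is of the form `ω(δ, ·)`. -/
lemma interior_ker (A : AdaptedAtlas i m) (w : SymplecticForm (Fn n Y))
    (hφ : Function.Surjective (pullback i)) (hX : IsLagrangian w (pullback i))
    (δ : AlongField (pullback i)) (hδ : A.interior w δ = 0) :
    δ ∈ LinearMap.range (pushField (pullback i)) := by
  refine A.mem_range_pushField hφ δ fun j b x hw => ?_
  have hx := A.cut_ne_zero j _ hw
  let C := A.chart j
  choose E hE using A.exists_extends_field hφ j
  let M : Matrix (Fin m) (Fin m) ℝ :=
    Matrix.of fun b a => w.form (C.field (Sum.inr b)) (C.field (Sum.inl a)) (i x)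
  have key : ∀ D a, A.interior w (restrictField (pullback i) D) (E a) x =
      ∑ b, D (C.coord (Sum.inr b)) (i x) * M b a := fun D a => by
    rw [A.interior_apply w D _ (E a) (hE a)]
    refine (A.form_expand_point w j hx D (C.field (Sum.inl a))).trans ?_
    rw [Fintype.sum_sum_type]
    refine (add_eq_right.2 (Finset.sum_eq_zero fun c _ => ?_))
    have h : w.form (C.field (Sum.inl c)) (C.field (Sum.inl a)) (i x) = 0 :=
      congrArg (fun s : Fn m X => s x) (hX _ _ _ _ (hE c) (hE a))
    exact (congrArg _ h).trans (mul_zero _)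
  choose ν hν using fun a =>
    A.interior_surjective w hφ (differential (pullback i (C.coord (Sum.inl a))))
  choose G hG using fun a => A.exists_lift hφ (ν a)
  let N : Matrix (Fin m) (Fin m) ℝ := Matrix.of fun a b => G a (C.coord (Sum.inr b)) (i x)
  have hNM : N * M = 1 := by
    ext a c
    rw [Matrix.mul_apply, Matrix.one_apply]
    refine (key (G a) c).symm.trans ?_
    rw [hG, hν]
    change E c (pullback i (C.coord (Sum.inl a))) x = _
    rw [← hE]
    refine (C.dual (i x) hx (Sum.inl c) (Sum.inl a)).trans ?_
    simp only [Sum.inl.injEq, eq_comm]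
  obtain ⟨D, rfl⟩ := A.exists_lift hφ δ
  let v : Fin m → ℝ := fun b => D (C.coord (Sum.inr b)) (i x)
  have hv : Matrix.vecMul v M = 0 := by
    ext a
    refine (key D a).symm.trans ?_
    rw [hδ]
    rfl
  have hv0 : v = 0 := by
    rw [← Matrix.vecMul_one v, ← mul_eq_one_comm.1 hNM, ← Matrix.vecMul_vecMul, hv,
      Matrix.zero_vecMul]
  exact congrFun hv0 b

end AdaptedAtlas

/-- The symplectic form identifies the normal bundle of a Lagrangian submanifold with its cotangent
bundle. -/
theorem exists_isCanonical (A : AdaptedAtlas i m) (w : SymplecticForm (Fn n Y))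
    (hφ : Function.Surjective (pullback i)) (hX : IsLagrangian w (pullback i)) :
    ∃ Φ : Normal (pullback i) ≃ₗ[Fn m X] OneForm (Fn m X), IsCanonical w (pullback i) Φ := by
  have hle : LinearMap.range (pushField (pullback i)) ≤ LinearMap.ker (A.interior w) := by
    rintro _ ⟨V, rfl⟩
    obtain ⟨D, hD⟩ := A.exists_lift hφ (pushField (pullback i) V)
    rw [LinearMap.mem_ker, ← hD]
    ext1 V'
    obtain ⟨D', hD'⟩ := A.exists_lift hφ (pushField (pullback i) V')
    have hV : Extends (pullback i) D V :=
      fun f => congrArg (fun δ : AlongField (pullback i) => alongVal δ f) hD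
    have hV' : Extends (pullback i) D' V' :=
      fun f => congrArg (fun δ : AlongField (pullback i) => alongVal δ f) hD'
    rw [A.interior_apply w D D' V' hV', hX D D' V V' hV hV']
    rfl
  refine ⟨LinearEquiv.ofBijective ((LinearMap.range (pushField (pullback i))).liftQ
    (A.interior w) hle) ⟨?_, ?_⟩, fun D D' V hV => A.interior_apply w D D' V hV⟩
  · rw [← LinearMap.ker_eq_bot, Submodule.ker_liftQ_eq_bot]
    exact fun δ hδ => A.interior_ker w hφ hX δ hδ
  · intro α
    obtain ⟨δ, hδ⟩ := A.interior_surjective w hφ α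
    exact ⟨Submodule.Quotient.mk δ, hδ⟩

/-- The algebraic data of a Lagrangian submanifold, for any choice of a frame near it. -/
theorem exists_lagrangianFrame (A : AdaptedAtlas i k) {w : SymplecticForm (Fn n Y)}
    (hφ : Function.Surjective (pullback i)) (F : Frame i)
    {Φ : Normal (pullback i) ≃ₗ[Fn m X] OneForm (Fn m X)} (hΦ : IsCanonical w (pullback i) Φ) :
    ∃ L : LagrangianFrame w (pullback i) (Fin F.size) (Fin A.size × Fin m),
      L.x = F.x ∧ L.e = F.e ∧ L.equiv = Φ := by
  obtain ⟨b, hb, hb0⟩ := exists_bump i F.isOpen_domain F.range_subset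
  refine ⟨⟨F.x, F.e, b, hb, fun D f => hb0 _ fun z hz => ?_, A.vecFrame hφ, A.vecFrame_expands hφ,
    hφ, A.exists_lift hφ, A.proj hφ, A.proj_pushField hφ, Φ, hΦ⟩, rfl, rfl, rfl⟩
  change D f z - (∑ a, D (F.x a) * F.e a f) z = 0
  rw [fn_sum_apply, sub_eq_zero]
  exact F.expand D f z hz

end Canonical

end OddContact

end

theorem mainTheorem4 (m : ℕ) {X Y : Type*}
    [TopologicalSpace Y] [ChartedSpace (EuclideanSpace ℝ (Fin (2 * m))) Y]
    [IsManifold (𝓡 (2 * m)) ∞ Y] [T2Space Y] [SigmaCompactSpace Y]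
    [TopologicalSpace X] [ChartedSpace (EuclideanSpace ℝ (Fin m)) X]
    [IsManifold (𝓡 m) ∞ X] [CompactSpace X]
    (w : OddContact.SymplecticForm (OddContact.Fn (2 * m) Y))
    (i : C^∞⟮𝓡 m, X; 𝓡 (2 * m), Y⟯)
    (hi : Manifold.IsSmoothEmbedding (𝓡 m) (𝓡 (2 * m)) ∞ i)
    (hX : OddContact.IsLagrangian w (OddContact.pullback i)) :
    Nonempty (OddContact.Frame i) ∧
    (∃! Φ : OddContact.Normal (OddContact.pullback i) ≃ₗ[OddContact.Fn m X]
        OddContact.OneForm (OddContact.Fn m X),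
      OddContact.IsCanonical w (OddContact.pullback i) Φ) ∧
    ∀ (F : OddContact.Frame i)
      (Φ : OddContact.Normal (OddContact.pullback i) ≃ₗ[OddContact.Fn m X]
        OddContact.OneForm (OddContact.Fn m X)),
      OddContact.IsCanonical w (OddContact.pullback i) Φ →
      ∀ p : ZMod 2,
        ∃ T : Submodule ℝ (OddContact.NormalSections (OddContact.incl (OddContact.pullback i)) p),
          (T : Set _) = OddContact.zariskiTangent F w p ∧
          ∃ K : T ≃ₗ[ℝ] OddContact.closedForms (OddContact.Fn m X) (p + 1),
            ∀ (D : OddContact.SuperDer (OddContact.incl (OddContact.pullback i)) p)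
              (hD : Submodule.Quotient.mk D ∈ T),
              (K ⟨Submodule.Quotient.mk D, hD⟩ : OddContact.Forms (OddContact.Fn m X)) =
                ExteriorAlgebra.map (Φ : OddContact.Normal (OddContact.pullback i)
                  →ₗ[OddContact.Fn m X] OddContact.OneForm (OddContact.Fn m X))
                  (OddContact.contraction F D) := by
  have hφ : Function.Surjective (OddContact.pullback i) := OddContact.pullback_surjective hi
  have A : OddContact.AdaptedAtlas i m :=
    (OddContact.exists_adaptedAtlas (two_mul m).symm hi).some
  exact ⟨⟨A.toFrame⟩, (OddContact.exists_isCanonical A w hφ hX).elim fun Φ hΦ =>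
      ⟨Φ, hΦ, fun Φ' hΦ' => hΦ'.unique (A.exists_lift hφ) hΦ⟩,
    fun F Φ hΦ p => (OddContact.exists_lagrangianFrame A hφ F hΦ).elim fun L hL =>
      L.exists_zariskiTangent_equiv hL.1 hL.2.1 hL.2.2 p⟩
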